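/- Let $n\ge 1$ and write $x=(x',x_n)\in\mathbb R^{n-1}\times\mathbb R$. Let $\mathcal Q$ be the set of dyadic cubes $Q_{J,v}=2^{-J}v+(0,2^{-J})^n$, $J\in\mathbb Z$, $v\in\mathbb Z^n$. For $0<p,q\le\infty$, $\tau\ge0$ and measurable functions $g_j$ on $\mathbb R^n$, $j\ge 0$, put (with the usual modifications if $p$ or $q$ is $\infty$) $$\|(g_j)\|_{\ell^qL^p_\tau}=\sup_{Q_{J,v}\in\mathcal Q}2^{nJ\tau}\Big(\sum_{j\ge\max(0,J)}\|g_j\|_{L^p(Q_{J,v})}^q\Big)^{1/q},\qquad \|(g_j)\|_{L^p_\tau\ell^q}=\sup_{Q_{J,v}\in\mathcal Q}2^{nJ\tau}\Big(\int_{Q_{J,v}}\Big(\sum_{j\ge\max(0,J)}|g_j|^q\Big)^{p/q}dx\Big)^{1/p},$$ $$\|(g_j)\|_{\ell^qM^p_\tau}=\Big(\sum_{j\ge0}\sup_{Q_{J,v}\in\mathcal Q}2^{nJ\tau q}\|g_j\|_{L^p(Q_{J,v})}^q\Big)^{1/q}.$$ Fix Schwartz functions $(\lambda_j)_{j\ge0}$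 such that $\hat\lambda_0(\xi)=\int\lambda_0(x)e^{-2\pi i x\cdot\xi}dx$ is supported in $\{|\xi|<2\}$ and equals $1$ on $\{|\xi|<1\}$, and $\lambda_j(x)=2^{jn}\lambda_0(2^jx)-2^{(j-1)n}\lambda_0(2^{j-1}x)$ for $j\ge1$. For $s\in\mathbb R$, let $\mathscr B^{s\tau}_{pq}(\mathbb R^n)$, $\mathscr F^{s\tau}_{pq}(\mathbb R^n)$ ($p<\infty$) and $\mathscr N^{s\tau}_{pq}(\mathbb R^n)$ be the spaces of those $f\in\mathscr S'(\mathbb R^n)$ for which the quasi-norm of $(2^{js}\lambda_j*f)_{j\ge0}$ in $\ell^qL^p_\tau$, $L^p_\tau\ell^q$ and $\ell^qM^p_\tau$, respectively, is finite. Let $\mathscr F^s_{\infty q}(\mathbb R^n)$ be defined by the quasi-norm $\sup_{J\ge0,\,v\in\mathbb Z^n}2^{Jn/q}\big(\int_{Q_{J,v}}\sum_{j\ge J}2^{jsq}|\lambda_j*f|^q\,dx\big)^{1/q}$, which for $q=\infty$ means $\sup_{j}2^{js}\|\lambda_j*f\|_{L^\infty}$. For an open set $U$ let $\mathscr S'(U)=\{\tilde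 f|_U:\tilde f\in\mathscr S'(\mathbb R^n)\}$, and for each of these spaces $\mathscr A$ and $f\in\mathscr S'(U)$ put $\|f\|_{\mathscr A(U)}=\inf\{\|\tilde f\|_{\mathscr A(\mathbb R^n)}:\tilde f\in\mathscr A(\mathbb R^n),\ \tilde f|_U=f\}$ ($=\infty$ if there is no such $\tilde f$). **Theorem.** Let $\Omega=\{(x',x_n):x_n>\rho(x')\}\subset\mathbb R^n$ with $\rho:\mathbb R^{n-1}\to\mathbb R$ Lipschitz. Let $(\phi_j)_{j\ge0}$ be a Littlewood–Paley family associated with $\Omega$, that is, a sequence of Schwartz functions with: $\int x^\alpha\phi_1(x)\,dx=0$ for all multi-indices $\alpha$; $\phi_j(x)=2^{(j-1)n}\phi_1(2^{j-1}x)$ for $j\ge2$; $\sum_{j\ge0}\phi_j=\delta_0$ in $\mathscr S'(\mathbb R^n)$; and $\operatorname{supp}\phi_j\subset\{x_n<-\|\nabla\rho\|_{L^\infty}|x'|\}$ for all $j\ge0$. For $f\in\mathscr S'(\Omega)$ the function $\phi_j*f$ on $\Omega$ is $\phi_j*\tilde f$, for any extension $\tilde f\in\mathscr S'(\mathbb R^n)$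 of $f$. Then for $0<p,q\le\infty$, $s\in\mathbb R$, $\tau\ge0$ and all $f\in\mathscr S'(\Omega)$: $$\|f\|_{\mathscr B^{s\tau}_{pq}(\Omega)}\approx\|(2^{js}\mathbf 1_\Omega\cdot(\phi_j*f))_j\|_{\ell^qL^p_\tau}=\sup_{Q_{J,v}\in\mathcal Q}2^{nJ\tau}\Big(\sum_{j\ge\max(0,J)}2^{jsq}\|\phi_j*f\|^q_{L^p(Q_{J,v}\cap\Omega)}\Big)^{1/q};$$ $$\|f\|_{\mathscr F^{s\tau}_{pq}(\Omega)}\approx\|(2^{js}\mathbf 1_\Omega\cdot(\phi_j*f))_j\|_{L^p_\tau\ell^q}=\sup_{Q_{J,v}\in\mathcal Q}2^{nJ\tau}\Big(\int_{Q_{J,v}\cap\Omega}\Big(\sum_{j\ge\max(0,J)}2^{jsq}|\phi_j*f|^q\Big)^{p/q}dx\Big)^{1/p}\quad\text{if }p<\infty;$$ $$\|f\|_{\mathscr N^{s\tau}_{pq}(\Omega)}\approx\|(2^{js}\mathbf 1_\Omega\cdot(\phi_j*f))_j\|_{\ell^qM^p_\tau}=\Big(\sum_{j\ge0}\sup_{Q_{J,v}\in\mathcal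 Q}2^{(js+nJ\tau)q}\|\phi_j*f\|^q_{L^p(Q_{J,v}\cap\Omega)}\Big)^{1/q}.$$ Moreover, for $0<q\le\infty$, $s\in\mathbb R$ and all $f\in\mathscr S'(\Omega)$, $$\|f\|_{\mathscr F^s_{\infty q}(\Omega)}\approx\sup_{J\in\mathbb Z,\,v\in\mathbb Z^n}2^{Jn/q}\Big(\int_{Q_{J,v}\cap\Omega}\sum_{j\ge\max(0,J)}2^{jsq}|\phi_j*f|^q\,dx\Big)^{1/q}.$$ Here $A\approx B$ means $C^{-1}A\le B\le CA$ in $[0,\infty]$. Once $(\lambda_j)$ is fixed, $C$ depends only on $\phi,p,q,s,\tau$ in the first three cases and only on $\phi,q,s$ in the last; it depends neither on $f$ nor on the domain $\Omega$ with which $\phi$ is associated. -/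

import Mathlib

open MeasureTheory Filter Topology
open scoped ENNReal NNReal SchwartzMap FourierTransform

noncomputable section

namespace LPDomain

/-! ### Euclidean space, special Lipschitz domains, dyadic cubes

The ambient space is `ℝⁿ` with `n = d + 1` and its Euclidean norm. -/

/-- The Euclidean space `ℝⁿ`, `n = d + 1`. -/
abbrev Rn (d : ℕ) := EuclideanSpace ℝ (Fin (d + 1))

/-- The first `n - 1` coordinates `x'` of `x = (x', xₙ)`. -/
def head {d : ℕ} (x : Rn d) : EuclideanSpace ℝ (Fin d) :=
  WithLp.toLp 2 (fun i : Fin d => x i.castSucc)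

/-- The last coordinate `xₙ` of `x = (x', xₙ)`. -/
def last {d : ℕ} (x : Rn d) : ℝ := x (Fin.last d)

/-- The domain `{(x', xₙ) : xₙ > ρ(x')}`; it is a special Lipschitz domain if `ρ` is Lipschitz. -/
def epigraph {d : ℕ} (ρ : EuclideanSpace ℝ (Fin d) → ℝ) : Set (Rn d) :=
  {x | ρ (head x) < last x}

/-- `‖∇ρ‖_{L^∞}` (finite for Lipschitz `ρ`). -/
def gradSup {d : ℕ} (ρ : EuclideanSpace ℝ (Fin d) → ℝ) : ℝ :=
  (eLpNorm (gradient ρ) ∞ volume).toReal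

/-- The open dyadic cube `Q_{J,v} = 2^{-J} v + (0, 2^{-J})^n`. -/
def dyadicCube {d : ℕ} (J : ℤ) (v : Fin (d + 1) → ℤ) : Set (Rn d) :=
  {x | ∀ i, (2 : ℝ) ^ (-J) * (v i : ℝ) < x i ∧ x i < (2 : ℝ) ^ (-J) * (v i : ℝ) + (2 : ℝ) ^ (-J)}

/-! ### Tempered distributions: convolution and restriction to a set -/

/-- For a Schwartz function `φ` and `x ∈ ℝⁿ`, the Schwartz function `y ↦ φ (x - y)`. -/
def reflectAt {d : ℕ} (φ : 𝓢(Rn d, ℂ)) (x : Rn d) : 𝓢(Rn d, ℂ) :=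
  SchwartzMap.compSubConstCLM ℂ x
    (SchwartzMap.compCLMOfContinuousLinearEquiv ℂ (ContinuousLinearEquiv.neg ℝ) φ)

theorem reflectAt_apply {d : ℕ} (φ : 𝓢(Rn d, ℂ)) (x y : Rn d) :
    reflectAt φ x y = φ (x - y) := by
  simp [reflectAt]

/-- The convolution `φ ∗ F` of a Schwartz function and a tempered distribution, as a function:
`(φ ∗ F)(x) = ⟨F, φ (x - ·)⟩`. -/
def conv {d : ℕ} (φ : 𝓢(Rn d, ℂ)) (F : 𝓢'(Rn d, ℂ)) (x : Rn d) : ℂ :=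
  F (reflectAt φ x)

/-- The test functions `C_c^∞(U)`, realised as Schwartz functions with compact support in `U`. -/
abbrev TestFun {d : ℕ} (U : Set (Rn d)) :=
  {u : 𝓢(Rn d, ℂ) // HasCompactSupport u ∧ tsupport u ⊆ U}

/-- The restriction `F|_U` of a tempered distribution to an open set `U`, as a functional on
`C_c^∞(U)`. -/
def restr {d : ℕ} (U : Set (Rn d)) (F : 𝓢'(Rn d, ℂ)) : TestFun U → ℂ :=
  fun u => F u.1

/-! ### Littlewood-Paley families -/

/-- `φ = (φ_j)_{j ≥ 0}` is a Littlewood-Paley family associated with the special Lipschitz domain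
`{xₙ > ρ(x')}`. -/
structure IsLPFamily {d : ℕ} (ρ : EuclideanSpace ℝ (Fin d) → ℝ) (φ : ℕ → 𝓢(Rn d, ℂ)) : Prop where
  /-- All moments of `φ_1` vanish. -/
  moment : ∀ α : Fin (d + 1) → ℕ, ∫ x : Rn d, (∏ i, x i ^ α i : ℝ) • φ 1 x = 0
  /-- `φ_j(x) = 2^{(j-1)n} φ_1(2^{j-1} x)` for `j ≥ 2`. -/
  scaling : ∀ j : ℕ, 2 ≤ j → ∀ x : Rn d,
    φ j x = ((2 : ℝ) ^ ((j - 1) * (d + 1))) • φ 1 ((2 : ℝ) ^ (j - 1) • x)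
  /-- `∑_j φ_j = δ_0`, with convergence as tempered distributions. -/
  approxId : ∀ g : 𝓢(Rn d, ℂ),
    Tendsto (fun J : ℕ => ∑ j ∈ Finset.range J, ∫ x : Rn d, φ j x * g x) atTop (𝓝 (g 0))
  /-- `supp φ_j ⊂ {xₙ < -‖∇ρ‖_{L^∞} |x'|}`. -/
  support : ∀ j : ℕ, tsupport (φ j) ⊆ {x : Rn d | last x < -(gradSup ρ) * ‖head x‖}

/-- `lam = (λ_j)_{j ≥ 0}` is a classical Littlewood-Paley family on `ℝⁿ`: the Fourier transform
`ξ ↦ ∫ λ_0(x) e^{-2πi x·ξ} dx` is supported in `{|ξ| < 2}` and equal to `1` on `{|ξ| < 1}`, and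
`λ_j(x) = 2^{jn} λ_0(2^j x) - 2^{(j-1)n} λ_0(2^{j-1} x)` for `j ≥ 1`. -/
structure IsClassicalLPFamily {d : ℕ} (lam : ℕ → 𝓢(Rn d, ℂ)) : Prop where
  fourier_support : tsupport (𝓕 (lam 0) : 𝓢(Rn d, ℂ)) ⊆ Metric.ball 0 2
  fourier_one : ∀ ξ : Rn d, ‖ξ‖ < 1 → (𝓕 (lam 0) : 𝓢(Rn d, ℂ)) ξ = 1
  scaling : ∀ j : ℕ, 1 ≤ j → ∀ x : Rn d,
    lam j x = ((2 : ℝ) ^ (j * (d + 1))) • lam 0 ((2 : ℝ) ^ j • x)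
      - ((2 : ℝ) ^ ((j - 1) * (d + 1))) • lam 0 ((2 : ℝ) ^ (j - 1) • x)

/-! ### Sequence space quasi-norms (with values in `[0, ∞]`) -/

/-- The `ℓ^q` quasi-norm, `0 < q ≤ ∞`, of a family of elements of `[0, ∞]`. -/
def lqNorm {ι : Type*} (q : ℝ≥0∞) (a : ι → ℝ≥0∞) : ℝ≥0∞ :=
  if q = ∞ then ⨆ j, a j else (∑' j, a j ^ q.toReal) ^ (1 / q.toReal)

/-- The indices `j ≥ max(0, J)`. -/
abbrev Tail (J : ℤ) := {j : ℕ // max 0 J ≤ (j : ℤ)}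

/-- The weight `2^{nJτ}`, `n = d + 1`. -/
def cubeWeight (d : ℕ) (J : ℤ) (τ : ℝ) : ℝ≥0∞ := (2 : ℝ≥0∞) ^ (((d : ℝ) + 1) * (J : ℝ) * τ)

/-- The quasi-norm of `ℓ^q L^p_τ`. -/
def lqLpNorm {d : ℕ} (p q : ℝ≥0∞) (τ : ℝ) (g : ℕ → Rn d → ℂ) : ℝ≥0∞ :=
  ⨆ (J : ℤ) (v : Fin (d + 1) → ℤ), cubeWeight d J τ *
    lqNorm q (fun j : Tail J => eLpNorm (g j) p (volume.restrict (dyadicCube J v)))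

/-- The quasi-norm of `L^p_τ ℓ^q`. -/
def LplqNorm {d : ℕ} (p q : ℝ≥0∞) (τ : ℝ) (g : ℕ → Rn d → ℂ) : ℝ≥0∞ :=
  ⨆ (J : ℤ) (v : Fin (d + 1) → ℤ), cubeWeight d J τ *
    eLpNorm (fun x => lqNorm q (fun j : Tail J => ‖g j x‖ₑ)) p (volume.restrict (dyadicCube J v))

/-- The Morrey quasi-norm of `M^p_τ`. -/
def morreyNorm {d : ℕ} (p : ℝ≥0∞) (τ : ℝ) (g : Rn d → ℂ) : ℝ≥0∞ :=
  ⨆ (J : ℤ) (v : Fin (d + 1) → ℤ), cubeWeight d J τ *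
    eLpNorm g p (volume.restrict (dyadicCube J v))

/-- The quasi-norm of `ℓ^q M^p_τ`. -/
def lqMpNorm {d : ℕ} (p q : ℝ≥0∞) (τ : ℝ) (g : ℕ → Rn d → ℂ) : ℝ≥0∞ :=
  lqNorm q (fun j : ℕ => morreyNorm p τ (g j))

/-! ### Function space quasi-norms

A space consists of the distributions whose quasi-norm, an element of `[0, ∞]`, is finite. -/

/-- The sequence `(2^{js} (φ_j ∗ F))_{j ≥ 0}`. -/
def lpSeq {d : ℕ} (φ : ℕ → 𝓢(Rn d, ℂ)) (s : ℝ) (F : 𝓢'(Rn d, ℂ)) : ℕ → Rn d → ℂ :=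
  fun j x => ((2 : ℝ) ^ ((j : ℝ) * s)) • conv (φ j) F x

/-- The quasi-norm of the Besov-type space `B^{sτ}_{pq}(ℝⁿ)`. -/
def normB {d : ℕ} (lam : ℕ → 𝓢(Rn d, ℂ)) (p q : ℝ≥0∞) (s τ : ℝ) (F : 𝓢'(Rn d, ℂ)) : ℝ≥0∞ :=
  lqLpNorm p q τ (lpSeq lam s F)

/-- The quasi-norm of the Triebel-Lizorkin-type space `F^{sτ}_{pq}(ℝⁿ)`, `p < ∞`. -/
def normF {d : ℕ} (lam : ℕ → 𝓢(Rn d, ℂ)) (p q : ℝ≥0∞) (s τ : ℝ) (F : 𝓢'(Rn d, ℂ)) : ℝ≥0∞ :=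
  LplqNorm p q τ (lpSeq lam s F)

/-- The quasi-norm of the Besov-Morrey space `N^{sτ}_{pq}(ℝⁿ)`. -/
def normN {d : ℕ} (lam : ℕ → 𝓢(Rn d, ℂ)) (p q : ℝ≥0∞) (s τ : ℝ) (F : 𝓢'(Rn d, ℂ)) : ℝ≥0∞ :=
  lqMpNorm p q τ (lpSeq lam s F)

/-- The quasi-norm of the endpoint Triebel-Lizorkin space `F^s_{∞q}(ℝⁿ)`: the supremum over the
dyadic cubes `Q_{J,v}` of side length at most one of
`2^{Jn/q} (∫_{Q_{J,v}} ∑_{j ≥ J} 2^{jsq} |λ_j ∗ F|^q)^{1/q}`. For `q = ∞` this is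
`sup_j 2^{js} ‖λ_j ∗ F‖_{L^∞}`, the norm of `B^s_{∞∞}(ℝⁿ)`. -/
def normFInf {d : ℕ} (lam : ℕ → 𝓢(Rn d, ℂ)) (q : ℝ≥0∞) (s : ℝ) (F : 𝓢'(Rn d, ℂ)) : ℝ≥0∞ :=
  ⨆ (J : ℕ) (v : Fin (d + 1) → ℤ), cubeWeight d J (q⁻¹).toReal *
    eLpNorm (fun x => lqNorm q (fun j : {j : ℕ // J ≤ j} => ‖lpSeq lam s F j x‖ₑ)) q
      (volume.restrict (dyadicCube (J : ℤ) v))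

/-- The quotient quasi-norm on a set `U` derived from a quasi-norm on `ℝⁿ`: the infimum over all
tempered extensions of `f` (it is `∞` if no extension has finite quasi-norm). -/
def restrNorm {d : ℕ} (norm : 𝓢'(Rn d, ℂ) → ℝ≥0∞) (U : Set (Rn d)) (f : TestFun U → ℂ) : ℝ≥0∞ :=
  ⨅ (F : 𝓢'(Rn d, ℂ)) (_ : restr U F = f), norm F

/-- The sequence `(2^{js} 1_U (φ_j ∗ F))_{j ≥ 0}`. -/
def lpSeqOn {d : ℕ} (U : Set (Rn d)) (φ : ℕ → 𝓢(Rn d, ℂ)) (s : ℝ) (F : 𝓢'(Rn d, ℂ)) :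
    ℕ → Rn d → ℂ :=
  fun j => U.indicator (lpSeq φ s F j)

/-- `A ≈ B` with constant `C`. -/
def EquivWith (C : ℝ≥0) (A B : ℝ≥0∞) : Prop := A ≤ C * B ∧ B ≤ C * A

end LPDomain

end

/-!
The proof rests on Rychkov's universal extension operator. If `(φ_j)` is a Littlewood-Paley family
associated with a special Lipschitz domain `Ω`, then it is generated by `φ₀`, which has the moments
of `δ₀` (`IsLPFamily.eq_lpFam`, `IsLPFamily.deltaLike`), and it is supported in a cone `Γ` with
`Ω - Γ ⊆ Ω` (`isAdmissible_epigraph`; that `‖∇ρ‖_{L^∞}` is a Lipschitz constant of `ρ` is Rademacher's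
theorem, `abs_sub_le_gradSup_mul`). The polynomial `3t² - 2t³`, which takes the value `1` to second
order at `t = 1`, provides a dual family `(ψ_j)` with `∑_j ψ_j ∗ φ_j = δ₀`, again supported in `Γ` and
with vanishing moments for `j ≥ 1` (`dualFam`). Hence `∑_k ψ_k ∗ (1_Ω (φ_k ∗ f))` depends only on the
restriction of `f` to `Ω`, and it extends this restriction (`exists_extension`,
`extSum_eq_of_support_subset`).

For any dyadic family `(θ_j)` with vanishing moments, almost orthogonality
(`IsDyadicFamily.exists_sconv_bound`) bounds the pieces `θ_j ∗ G` of the extension `G` by averages of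
the `1_Ω |φ_k ∗ f|` with kernels that decay as fast as desired in `|j - k|` and in the distance. With
`θ = φ` this reads: the sequence `1_Ω |φ_k ∗ f|` is bounded by such averages of itself. Inequalities of
this kind improve themselves: they hold for arbitrarily small powers as well (`scaleInt_pow_le`, where
the temperedness of `f` is used). This reduces all exponents `p, q > 0` to exponents greater than `1`,
for which the averages are bounded operators (`PowNorm`, `PowNorm.exists_le`).

For large exponents the boundedness of such averages is a property of norms (`ConvNorm`) that holds for
`ℓ^q(L^p)`, for `L^p(ℓ^q)` by a vector-valued inequality derived from the Hardy-Littlewood maximal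
theorem (`exists_lintegral_cv_le`), and for `ℓ^q(M^p_τ)`. It is inherited by the localization to dyadic
cubes with the weight `2^{nJτ}` (`ConvNorm.localized`), because fast decay of the kernels compensates
both the number and the weights of the neighbouring and the larger cubes. So all the quasi-norms are
treated at once: `PowNorm.exists_extension_bound` gives one inequality, and its case `Ω = ℝⁿ`, where no
support condition is needed, allows the passage from `(λ_j)` to `(φ_j)` on the whole space
(`PowNorm.exists_change_bound`), hence the other inequality. All constants come from `λ` and from
properties of `φ` that do not involve the domain.

The endpoint space `F^s_{∞q}` is the case `p = q`, `τ = 1/q`: dyadic cubes of side length larger than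
one do not contribute to that quasi-norm (`iSup_nat_eq_LplqE`, `LplqE_eq_lqLpE`).
-/

noncomputable section

namespace LPDomain

/-! ### The Hardy-Littlewood maximal function -/

/-- The centred Hardy-Littlewood maximal function over the balls of radius `2^i`, `i ∈ ℤ`. -/
def maximal {d : ℕ} (u : Rn d → ℝ≥0∞) (x : Rn d) : ℝ≥0∞ :=
  ⨆ i : ℤ, (volume (Metric.ball x ((2 : ℝ) ^ i)))⁻¹ * ∫⁻ z in Metric.ball x ((2 : ℝ) ^ i), u z

theorem measurable_lintegral_ball {d : ℕ} {u : Rn d → ℝ≥0∞} (hu : Measurable u) (r : ℝ) :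
    Measurable fun x : Rn d => ∫⁻ z in Metric.ball x r, u z := by
  have h : ∀ x : Rn d, ∫⁻ z in Metric.ball x r, u z =
      ∫⁻ z, ({p : Rn d × Rn d | dist p.2 p.1 < r}.indicator (fun p => u p.2)) (x, z) := by
    intro x
    rw [← lintegral_indicator Metric.isOpen_ball.measurableSet]
    rfl
  simp_rw [h]
  refine Measurable.lintegral_prod_right' (f := {p : Rn d × Rn d | dist p.2 p.1 < r}.indicator
    (fun p => u p.2)) ?_
  refine (hu.comp measurable_snd).indicator ?_
  exact (isOpen_lt (by fun_prop) continuous_const).measurableSet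

theorem measurable_maximal {d : ℕ} {u : Rn d → ℝ≥0∞} (hu : Measurable u) :
    Measurable (maximal u) := by
  unfold maximal
  refine Measurable.iSup fun i => ?_
  have h : ∀ x : Rn d, volume (Metric.ball x ((2 : ℝ) ^ i)) =
      volume (Metric.ball (0 : Rn d) ((2 : ℝ) ^ i)) := fun x =>
    Measure.addHaar_ball_center _ _ _
  simp_rw [h]
  exact (measurable_lintegral_ball hu _).const_mul _

theorem maximal_le_of_le {d : ℕ} {u : Rn d → ℝ≥0∞} {c : ℝ≥0∞} (h : ∀ x, u x ≤ c) (x : Rn d) :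
    maximal u x ≤ c := by
  refine iSup_le fun i => ?_
  have hpos : volume (Metric.ball x ((2 : ℝ) ^ i)) ≠ 0 :=
    (Metric.measure_ball_pos _ _ (by positivity)).ne'
  have hfin : volume (Metric.ball x ((2 : ℝ) ^ i)) ≠ ∞ := measure_ball_lt_top.ne
  calc _ ≤ (volume (Metric.ball x ((2 : ℝ) ^ i)))⁻¹ *
        ∫⁻ z in Metric.ball x ((2 : ℝ) ^ i), c := by gcongr; exact h _
    _ = c := by
        rw [setLIntegral_const, mul_comm c, ← mul_assoc, ENNReal.inv_mul_cancel hpos hfin, one_mul]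

theorem maximal_add_le {d : ℕ} {u v : Rn d → ℝ≥0∞} (hu : Measurable u) (x : Rn d) :
    maximal (u + v) x ≤ maximal u x + maximal v x := by
  refine iSup_le fun i => ?_
  simp only [Pi.add_apply]
  rw [lintegral_add_left hu, mul_add]
  exact add_le_add (le_iSup (fun i : ℤ => (volume (Metric.ball x ((2 : ℝ) ^ i)))⁻¹ *
      ∫⁻ z in Metric.ball x ((2 : ℝ) ^ i), u z) i)
    (le_iSup (fun i : ℤ => (volume (Metric.ball x ((2 : ℝ) ^ i)))⁻¹ *
      ∫⁻ z in Metric.ball x ((2 : ℝ) ^ i), v z) i)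

theorem maximal_mono {d : ℕ} {u v : Rn d → ℝ≥0∞} (h : u ≤ v) (x : Rn d) :
    maximal u x ≤ maximal v x := by
  refine iSup_mono fun i => ?_
  gcongr
  exact h _

/-- The weak type `(1, 1)` inequality, by Vitali's covering lemma. -/
theorem maximal_weak {d : ℕ} (u : Rn d → ℝ≥0∞) {t : ℝ≥0∞} (ht : 0 < t) :
    t * volume {x | t < maximal u x} ≤ 5 ^ (d + 1) * ∫⁻ z, u z := by
  by_cases hI : ∫⁻ z, u z = ∞
  · rw [hI, ENNReal.mul_top (by positivity)]; exact le_top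
  set A := {x | t < maximal u x}
  have hx : ∀ x : A, ∃ i : ℤ, t * volume (Metric.ball (x : Rn d) ((2 : ℝ) ^ i)) <
      ∫⁻ z in Metric.ball (x : Rn d) ((2 : ℝ) ^ i), u z := by
    intro x
    obtain ⟨i, hi⟩ := lt_iSup_iff.1 (show t < maximal u x from x.2)
    refine ⟨i, ?_⟩
    rw [← ENNReal.div_eq_inv_mul] at hi
    have hpos : volume (Metric.ball (x : Rn d) ((2 : ℝ) ^ i)) ≠ 0 :=
      (Metric.measure_ball_pos _ _ (by positivity)).ne'
    have hfin : volume (Metric.ball (x : Rn d) ((2 : ℝ) ^ i)) ≠ ∞ := measure_ball_lt_top.ne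
    exact (ENNReal.lt_div_iff_mul_lt (Or.inl hpos) (Or.inl hfin)).1 hi
  choose i hi using hx
  -- the radii are bounded, because the integral of `u` is finite
  obtain ⟨R, hR⟩ : ∃ R : ℝ, ∀ x : A, (2 : ℝ) ^ i x ≤ R := by
    have hlim : Tendsto (fun n : ℕ => volume (Metric.ball (0 : Rn d) n)) atTop
        (𝓝 (volume (⋃ n : ℕ, Metric.ball (0 : Rn d) n))) :=
      tendsto_measure_iUnion_atTop fun a b hab => Metric.ball_subset_ball (by exact_mod_cast hab)
    rw [Metric.iUnion_ball_nat, measure_univ_of_isAddLeftInvariant] at hlim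
    have hlt : (∫⁻ z, u z) / t < ∞ := ENNReal.div_lt_top hI ht.ne'
    obtain ⟨n, hn⟩ := (hlim.eventually (lt_mem_nhds hlt)).exists
    refine ⟨n, fun x => ?_⟩
    by_contra! hlt'
    have h1 := (hi x).trans_le (setLIntegral_le_lintegral _ _)
    rw [Measure.addHaar_ball_center] at h1
    have h2 : volume (Metric.ball (0 : Rn d) n) ≤ volume (Metric.ball (0 : Rn d) ((2 : ℝ) ^ i x)) :=
      measure_mono (Metric.ball_subset_ball hlt'.le)
    have h3 := (ENNReal.div_lt_iff (Or.inl ht.ne') (Or.inr hI)).1 (hn.trans_le h2)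
    rw [mul_comm] at h3
    exact lt_asymm h1 h3
  obtain ⟨s, -, hdisj, hcov⟩ := Vitali.exists_disjoint_subfamily_covering_enlargement_closedBall
    (Set.univ : Set A) (fun x => (x : Rn d)) (fun x => (2 : ℝ) ^ i x) R (fun a _ => hR a) 5
    (by norm_num)
  have hdisj' : s.PairwiseDisjoint fun a => Metric.ball (a : Rn d) ((2 : ℝ) ^ i a) :=
    hdisj.mono fun a => Metric.ball_subset_closedBall
  have hcount : s.Countable := by
    refine hdisj'.countable_of_isOpen (fun a _ => Metric.isOpen_ball) fun a _ =>
      Metric.nonempty_ball.2 (by positivity)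
  have hsub : A ⊆ ⋃ b ∈ s, Metric.closedBall (b : Rn d) (5 * (2 : ℝ) ^ i b) := by
    intro x hx
    obtain ⟨b, hb, hsub⟩ := hcov ⟨x, hx⟩ (Set.mem_univ _)
    simp only [Set.mem_iUnion]
    exact ⟨b, hb, hsub (Metric.mem_closedBall_self (by positivity))⟩
  have hvol : ∀ b : A, volume (Metric.closedBall (b : Rn d) (5 * (2 : ℝ) ^ i b)) =
      5 ^ (d + 1) * volume (Metric.ball (b : Rn d) ((2 : ℝ) ^ i b)) := by
    intro b
    rw [Measure.addHaar_closedBall_mul _ _ (by norm_num) (by positivity),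
      Measure.addHaar_closedBall_center, Measure.addHaar_ball_center,
      Measure.addHaar_closedBall_eq_addHaar_ball]
    simp only [finrank_euclideanSpace, Fintype.card_fin]
    rw [ENNReal.ofReal_pow (by norm_num)]
    norm_num
  have := hcount.to_subtype
  calc t * volume A
      ≤ t * ∑' b : s, volume (Metric.closedBall ((b : A) : Rn d) (5 * (2 : ℝ) ^ i b)) := by
        gcongr
        exact (measure_mono hsub).trans (measure_biUnion_le _ hcount _)
    _ = 5 ^ (d + 1) * ∑' b : s, t * volume (Metric.ball ((b : A) : Rn d) ((2 : ℝ) ^ i b)) := by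
        simp_rw [hvol]
        rw [ENNReal.tsum_mul_left, ENNReal.tsum_mul_left]; ring
    _ ≤ 5 ^ (d + 1) * ∑' b : s, ∫⁻ z in Metric.ball ((b : A) : Rn d) ((2 : ℝ) ^ i b), u z := by
        gcongr with b
        exact (hi b).le
    _ = 5 ^ (d + 1) * ∫⁻ z in ⋃ b ∈ s, Metric.ball (b : Rn d) ((2 : ℝ) ^ i b), u z := by
        rw [lintegral_biUnion hcount (fun b _ => Metric.isOpen_ball.measurableSet) hdisj']
    _ ≤ _ := mul_le_mul_right (setLIntegral_le_lintegral _ _) _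

/-- Layer cake for the constant `b`. -/
theorem rpow_eq_lintegral {p : ℝ} (hp : 0 < p) (b : ℝ≥0∞) :
    b ^ p = ENNReal.ofReal p * ∫⁻ t in Set.Ioi (0 : ℝ),
      (if ENNReal.ofReal t < b then ENNReal.ofReal (t ^ (p - 1)) else 0) := by
  have key : ∀ b : ℝ≥0, (b : ℝ≥0∞) ^ p = ENNReal.ofReal p * ∫⁻ t in Set.Ioi (0 : ℝ),
      (if ENNReal.ofReal t < b then ENNReal.ofReal (t ^ (p - 1)) else 0) := by
    intro b
    have h := lintegral_rpow_eq_lintegral_meas_lt_mul (Measure.dirac ())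
      (f := fun _ => (b : ℝ)) (Eventually.of_forall fun _ => b.2) measurable_const.aemeasurable hp
    simp only [lintegral_dirac] at h
    rw [← ENNReal.ofReal_coe_nnreal, ENNReal.ofReal_rpow_of_nonneg b.coe_nonneg hp.le, h]
    congr 1
    refine setLIntegral_congr_fun measurableSet_Ioi fun t ht => ?_
    simp only [ENNReal.ofReal_lt_ofReal_iff_of_nonneg (le_of_lt ht : (0 : ℝ) ≤ t)]
    by_cases hlt : t < b <;> simp [hlt]
  induction b with
  | coe b => exact key b
  | top =>
    rw [ENNReal.top_rpow_of_pos hp]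
    refine (ENNReal.eq_top_of_forall_nnreal_le fun r => ?_).symm
    have hr : (r : ℝ≥0∞) = ((r ^ (1 / p) : ℝ≥0) : ℝ≥0∞) ^ p := by
      rw [← ENNReal.coe_rpow_of_nonneg _ hp.le, ← NNReal.rpow_mul, one_div_mul_cancel hp.ne',
        NNReal.rpow_one]
    rw [hr, key]
    gcongr with t
    split_ifs with h1 h2 h2
    · exact le_rfl
    · exact absurd ENNReal.ofReal_lt_top h2
    · exact zero_le
    · exact le_rfl

/-- The Hardy-Littlewood maximal inequality. -/
theorem exists_lintegral_maximal_rpow_le (d : ℕ) {p : ℝ} (hp : 1 < p) :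
    ∃ C : ℝ≥0∞, C ≠ ∞ ∧ ∀ u : Rn d → ℝ≥0∞, Measurable u →
      ∫⁻ x, maximal u x ^ p ≤ C * ∫⁻ x, u x ^ p := by
  have hp1 : 0 < p - 1 := by linarith
  have hpp : ENNReal.ofReal (p - 1) ≠ 0 := by simpa using hp1
  refine ⟨ENNReal.ofReal p * (2 * 5 ^ (d + 1)) * (ENNReal.ofReal (p - 1))⁻¹ * 2 ^ (p - 1),
    by finiteness, fun u hu => ?_⟩
  have hM := measurable_maximal hu
  have hmeas : ∀ v : Rn d → ℝ≥0∞, Measurable v → ∀ r : ℝ,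
      Measurable fun q : Rn d × ℝ =>
        if ENNReal.ofReal q.2 < v q.1 then ENNReal.ofReal (q.2 ^ r) else 0 := by
    intro v hv r
    refine Measurable.ite (measurableSet_lt (by fun_prop) (by fun_prop)) (by fun_prop)
      measurable_const
  -- split `u` at height `t / 2` and apply the weak type inequality to the large part
  have hlevel : ∀ t ∈ Set.Ioi (0 : ℝ), ∫⁻ x, (if ENNReal.ofReal t < maximal u x then
      ENNReal.ofReal (t ^ (p - 1)) else 0) ≤ (2 * 5 ^ (d + 1)) * ∫⁻ x, u x *
        (if ENNReal.ofReal t < 2 * u x then ENNReal.ofReal (t ^ (p - 1 - 1)) else 0) := by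
    intro t ht
    have ht0 : (0 : ℝ) < t := ht
    set T := ENNReal.ofReal t
    have hT : 0 < T := ENNReal.ofReal_pos.2 ht0
    set v : Rn d → ℝ≥0∞ := {x | T < 2 * u x}.indicator u
    have hvs : MeasurableSet {x | T < 2 * u x} := measurableSet_lt measurable_const (by fun_prop)
    have hv : Measurable v := hu.indicator hvs
    have hle : u ≤ v + fun _ => T / 2 := by
      intro x
      by_cases hx : x ∈ {x | T < 2 * u x}
      · simp [v, Set.indicator_of_mem hx]
      · simp only [v, Pi.add_apply, Set.indicator_of_notMem hx, zero_add]
        rw [ENNReal.le_div_iff_mul_le (by simp) (by simp), mul_comm]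
        exact not_lt.1 hx
    have hsub : {x | T < maximal u x} ⊆ {x | T / 2 < maximal v x} := by
      intro x hx
      have h1 := (maximal_mono hle x).trans (maximal_add_le hv x)
      have h2 : maximal (fun _ : Rn d => T / 2) x ≤ T / 2 := maximal_le_of_le (fun _ => le_rfl) x
      by_contra h3
      have h4 : maximal u x ≤ T / 2 + T / 2 := h1.trans (add_le_add (not_lt.1 h3) h2)
      rw [ENNReal.add_halves] at h4
      exact absurd hx (not_lt.2 h4)
    have hweak := maximal_weak v (t := T / 2) (ENNReal.half_pos hT.ne')
    have hTt : ENNReal.ofReal (t ^ (p - 1)) = T * ENNReal.ofReal (t ^ (p - 1 - 1)) := by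
      rw [← ENNReal.ofReal_mul ht0.le]
      congr 1
      rw [← Real.rpow_one_add' ht0.le (by linarith)]; congr 1; ring
    have hL : ∫⁻ x, (if T < maximal u x then ENNReal.ofReal (t ^ (p - 1)) else 0) =
        ENNReal.ofReal (t ^ (p - 1)) * volume {x | T < maximal u x} := by
      rw [← lintegral_indicator_const (measurableSet_lt measurable_const hM)]
      refine lintegral_congr fun x => ?_
      by_cases hx : T < maximal u x <;> simp [Set.indicator, hx]
    have hR : ∫⁻ x, u x * (if T < 2 * u x then ENNReal.ofReal (t ^ (p - 1 - 1)) else 0) =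
        ENNReal.ofReal (t ^ (p - 1 - 1)) * ∫⁻ x, v x := by
      rw [← lintegral_const_mul _ hv]
      refine lintegral_congr fun x => ?_
      by_cases hx : T < 2 * u x
      · simp only [v, hx, if_true]
        rw [Set.indicator_of_mem (show x ∈ {x | T < 2 * u x} from hx), mul_comm]
      · simp only [v, hx, if_false]
        rw [Set.indicator_of_notMem (show x ∉ {x | T < 2 * u x} from hx)]; simp
    rw [hL, hR, hTt]
    calc T * ENNReal.ofReal (t ^ (p - 1 - 1)) * volume {x | T < maximal u x}
        = ENNReal.ofReal (t ^ (p - 1 - 1)) * (2 * (T / 2 * volume {x | T < maximal u x})) := by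
          rw [← mul_assoc 2, ENNReal.mul_div_cancel (by simp) (by simp)]; ring
      _ ≤ ENNReal.ofReal (t ^ (p - 1 - 1)) * (2 * (5 ^ (d + 1) * ∫⁻ x, v x)) := by
          refine mul_le_mul_right (mul_le_mul_right (le_trans ?_ hweak) _) _
          exact mul_le_mul_right (measure_mono hsub) _
      _ = _ := by ring
  calc ∫⁻ x, maximal u x ^ p
      = ENNReal.ofReal p * ∫⁻ t in Set.Ioi (0 : ℝ), ∫⁻ x,
          (if ENNReal.ofReal t < maximal u x then ENNReal.ofReal (t ^ (p - 1)) else 0) := by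
        simp_rw [rpow_eq_lintegral (by linarith : 0 < p)]
        rw [lintegral_const_mul _ (Measurable.lintegral_prod_right' (hmeas _ hM _)),
          lintegral_lintegral_swap (hmeas _ hM _).aemeasurable]
    _ ≤ ENNReal.ofReal p * ∫⁻ t in Set.Ioi (0 : ℝ), (2 * 5 ^ (d + 1)) * ∫⁻ x, u x *
        (if ENNReal.ofReal t < 2 * u x then ENNReal.ofReal (t ^ (p - 1 - 1)) else 0) := by
        exact mul_le_mul_right (setLIntegral_mono' measurableSet_Ioi hlevel) _
    _ = ENNReal.ofReal p * ((2 * 5 ^ (d + 1)) * ∫⁻ x, u x * ∫⁻ t in Set.Ioi (0 : ℝ),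
        (if ENNReal.ofReal t < 2 * u x then ENNReal.ofReal (t ^ (p - 1 - 1)) else 0)) := by
        have hm2 : Measurable fun q : Rn d × ℝ => u q.1 *
            (if ENNReal.ofReal q.2 < 2 * u q.1 then ENNReal.ofReal (q.2 ^ (p - 1 - 1)) else 0) :=
          (hu.comp measurable_fst).mul (hmeas (fun x => 2 * u x) (by fun_prop) (p - 1 - 1))
        rw [lintegral_const_mul _ (Measurable.lintegral_prod_left' hm2),
          ← lintegral_lintegral_swap hm2.aemeasurable]
        congr 2
        refine lintegral_congr fun x => ?_
        exact lintegral_const_mul (u x) ((hmeas (fun x => 2 * u x) (by fun_prop) (p - 1 - 1)).comp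
          (measurable_prodMk_left (x := x)))
    _ = _ := by
        have h3 : ∀ x, u x * ∫⁻ t in Set.Ioi (0 : ℝ),
            (if ENNReal.ofReal t < 2 * u x then ENNReal.ofReal (t ^ (p - 1 - 1)) else 0) =
            ((ENNReal.ofReal (p - 1))⁻¹ * 2 ^ (p - 1)) * u x ^ p := by
          intro x
          have h4 := rpow_eq_lintegral hp1 (2 * u x)
          rw [ENNReal.mul_rpow_of_nonneg _ _ hp1.le] at h4
          have h5 : u x ^ p = u x * u x ^ (p - 1) := by
            conv_lhs => rw [show p = 1 + (p - 1) by ring]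
            rw [ENNReal.rpow_add_of_nonneg _ _ zero_le_one hp1.le, ENNReal.rpow_one]
          rw [h5, mul_left_comm, mul_assoc _ (2 ^ (p - 1)), h4, ← mul_assoc _ (ENNReal.ofReal _),
            ENNReal.inv_mul_cancel hpp ENNReal.ofReal_ne_top, one_mul]
        simp_rw [h3]
        rw [lintegral_const_mul _ (by fun_prop)]
        ring

/-! ### Convolution with rapidly decreasing kernels -/

/-- The kernel `2^{kn} (1 + 2^k |x|)^{-N}`. -/
def ker {d : ℕ} (N k : ℕ) (x : Rn d) : ℝ≥0∞ :=
  2 ^ (k * (d + 1)) * (1 + 2 ^ k * ‖x‖ₑ)⁻¹ ^ N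

/-- The convolution of `u` with the kernel `2^{kn} (1 + 2^k |x|)^{-N}`. -/
def cv {d : ℕ} (N k : ℕ) (u : Rn d → ℝ≥0∞) (x : Rn d) : ℝ≥0∞ :=
  ∫⁻ z, ker N k (x - z) * u z

@[fun_prop]
theorem measurable_ker {d : ℕ} (N k : ℕ) : Measurable (ker (d := d) N k) := by
  unfold ker
  fun_prop

@[fun_prop]
theorem measurable_cv {d : ℕ} (N k : ℕ) {u : Rn d → ℝ≥0∞} (hu : Measurable u) :
    Measurable (cv N k u) :=
  Measurable.lintegral_prod_right' (f := fun p : Rn d × Rn d => ker N k (p.1 - p.2) * u p.2)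
    (by fun_prop)

theorem bump_le_one {d : ℕ} (k : ℕ) (x : Rn d) : (1 + 2 ^ k * ‖x‖ₑ)⁻¹ ≤ (1 : ℝ≥0∞) :=
  ENNReal.inv_le_one.2 le_self_add

theorem ker_anti {d : ℕ} {N M : ℕ} (h : N ≤ M) (k : ℕ) (x : Rn d) : ker M k x ≤ ker N k x :=
  mul_le_mul_right (pow_le_pow_right_of_le_one' (bump_le_one k x) h) _

theorem cv_anti {d : ℕ} {N M : ℕ} (h : N ≤ M) (k : ℕ) (u : Rn d → ℝ≥0∞) (x : Rn d) :
    cv M k u x ≤ cv N k u x :=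
  lintegral_mono fun _ => mul_le_mul_left (ker_anti h _ _) _

theorem cv_mono {d : ℕ} (N k : ℕ) {u v : Rn d → ℝ≥0∞} (h : u ≤ᵐ[volume] v) (x : Rn d) :
    cv N k u x ≤ cv N k v x := by
  refine lintegral_mono_ae ?_
  filter_upwards [h] with z hz
  exact mul_le_mul_right hz _

/-- A bound, uniform in the scale `k`, for the integral of `ker (d + 2) k`. The exponent `d + 2 = n + 1`
is the least integer for which the kernel is integrable. -/
def cvConst (d : ℕ) : ℝ≥0∞ := 2 ^ (d + 2) * volume (Metric.ball (0 : Rn d) 1) * 2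

theorem cvConst_ne_top (d : ℕ) : cvConst d ≠ ∞ := by
  have : volume (Metric.ball (0 : Rn d) 1) ≠ ∞ := measure_ball_lt_top.ne
  unfold cvConst
  finiteness

theorem ker_le_tsum {d : ℕ} (k : ℕ) (x : Rn d) : ker (d + 2) k x ≤ ∑' i : ℕ,
    2 ^ (d + 2) * 2⁻¹ ^ (i * (d + 2)) * 2 ^ (k * (d + 1)) *
      (Metric.ball (0 : Rn d) ((2 : ℝ) ^ ((i : ℤ) - k))).indicator 1 x := by
  have hex : ∃ i : ℕ, ‖x‖ < (2 : ℝ) ^ ((i : ℤ) - k) := by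
    obtain ⟨i, hi⟩ := pow_unbounded_of_one_lt (‖x‖ * 2 ^ k) (one_lt_two (α := ℝ))
    refine ⟨i, ?_⟩
    rw [zpow_sub₀ two_ne_zero, zpow_natCast, zpow_natCast, lt_div_iff₀ (by positivity)]
    exact hi
  classical
  refine le_trans ?_ (ENNReal.le_tsum (Nat.find hex))
  have hmem : x ∈ Metric.ball (0 : Rn d) ((2 : ℝ) ^ ((Nat.find hex : ℤ) - k)) := by
    simpa using Nat.find_spec hex
  rw [Set.indicator_of_mem hmem, Pi.one_apply, mul_one, ker, mul_comm]
  refine mul_le_mul_left ?_ _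
  rcases Nat.eq_zero_or_pos (Nat.find hex) with h0 | h0
  · rw [h0, zero_mul, pow_zero, mul_one]
    exact (pow_le_one' (bump_le_one k x) _).trans (one_le_pow₀ one_le_two)
  · obtain ⟨i, hi⟩ := Nat.exists_eq_succ_of_ne_zero h0.ne'
    have hlt : ¬ ‖x‖ < (2 : ℝ) ^ ((i : ℤ) - k) := Nat.find_min hex (by omega)
    rw [not_lt, zpow_sub₀ two_ne_zero, zpow_natCast, zpow_natCast,
      div_le_iff₀ (by positivity)] at hlt
    have h1 : (2 : ℝ≥0∞) ^ i ≤ 1 + 2 ^ k * ‖x‖ₑ := by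
      refine le_trans ?_ le_add_self
      have h2 := ENNReal.ofReal_le_ofReal hlt
      rw [ENNReal.ofReal_mul (norm_nonneg _), ENNReal.ofReal_pow (by norm_num),
        ENNReal.ofReal_pow (by norm_num), ofReal_norm] at h2
      simpa [mul_comm] using h2
    have h3 : (1 + 2 ^ k * ‖x‖ₑ)⁻¹ ≤ (2 * 2⁻¹ ^ (i + 1) : ℝ≥0∞) := by
      have : (2 * 2⁻¹ ^ (i + 1) : ℝ≥0∞) = (2 ^ i)⁻¹ := by
        rw [pow_succ', ← mul_assoc, ENNReal.mul_inv_cancel (by simp) (by simp), one_mul,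
          ENNReal.inv_pow]
      rw [this]
      exact ENNReal.inv_le_inv.2 h1
    rw [hi, pow_mul, ← mul_pow]
    exact pow_le_pow_left' h3 _

/-- Convolution with a rapidly decreasing kernel is dominated by the maximal function. -/
theorem cv_le_maximal {d : ℕ} (k : ℕ) {u : Rn d → ℝ≥0∞} (hu : Measurable u) (x : Rn d) :
    cv (d + 2) k u x ≤ cvConst d * maximal u x := by
  have hball : ∀ i : ℕ, ∫⁻ z in Metric.ball x ((2 : ℝ) ^ ((i : ℤ) - k)), u z ≤
      ((2 ^ (k * (d + 1)))⁻¹ * 2 ^ (i * (d + 1)) * volume (Metric.ball (0 : Rn d) 1)) *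
        maximal u x := by
    intro i
    have hvol : volume (Metric.ball x ((2 : ℝ) ^ ((i : ℤ) - k))) =
        (2 ^ (k * (d + 1)))⁻¹ * 2 ^ (i * (d + 1)) * volume (Metric.ball (0 : Rn d) 1) := by
      rw [Measure.addHaar_ball_of_pos _ _ (by positivity)]
      simp only [finrank_euclideanSpace, Fintype.card_fin]
      congr 1
      rw [zpow_sub₀ two_ne_zero, zpow_natCast, zpow_natCast, div_eq_mul_inv, mul_pow, inv_pow,
        ← pow_mul, ← pow_mul, ENNReal.ofReal_mul (by positivity),
        ENNReal.ofReal_inv_of_pos (by positivity), ENNReal.ofReal_pow (by norm_num),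
        ENNReal.ofReal_pow (by norm_num), mul_comm]
      norm_num
    have hpos : volume (Metric.ball x ((2 : ℝ) ^ ((i : ℤ) - k))) ≠ 0 :=
      (Metric.measure_ball_pos _ _ (by positivity)).ne'
    have hfin : volume (Metric.ball x ((2 : ℝ) ^ ((i : ℤ) - k))) ≠ ∞ := measure_ball_lt_top.ne
    rw [← hvol]
    refine le_trans (le_of_eq ?_) (mul_le_mul_right (le_iSup (fun i : ℤ =>
      (volume (Metric.ball x ((2 : ℝ) ^ i)))⁻¹ *
        ∫⁻ z in Metric.ball x ((2 : ℝ) ^ i), u z) ((i : ℤ) - k)) _)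
    rw [← mul_assoc, ENNReal.mul_inv_cancel hpos hfin, one_mul]
  have hind : ∀ (r : ℝ) (z : Rn d), (Metric.ball (0 : Rn d) r).indicator (1 : Rn d → ℝ≥0∞) (x - z) *
      u z = (Metric.ball x r).indicator u z := by
    intro r z
    by_cases hz : z ∈ Metric.ball x r
    · have : x - z ∈ Metric.ball (0 : Rn d) r := by
        rw [mem_ball_zero_iff, ← dist_eq_norm, dist_comm]; exact hz
      simp [Set.indicator_of_mem hz, Set.indicator_of_mem this]
    · have : x - z ∉ Metric.ball (0 : Rn d) r := by
        rw [mem_ball_zero_iff, ← dist_eq_norm, dist_comm]; exact hz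
      simp [Set.indicator_of_notMem hz, Set.indicator_of_notMem this]
  calc cv (d + 2) k u x ≤ ∫⁻ z, ∑' i : ℕ, 2 ^ (d + 2) * 2⁻¹ ^ (i * (d + 2)) * 2 ^ (k * (d + 1)) *
        (Metric.ball x ((2 : ℝ) ^ ((i : ℤ) - k))).indicator u z := by
        refine lintegral_mono fun z => ?_
        refine (mul_le_mul_left (ker_le_tsum k (x - z)) _).trans (le_of_eq ?_)
        rw [← ENNReal.tsum_mul_right]
        congr 1 with i
        rw [mul_assoc, hind]
    _ = ∑' i : ℕ, 2 ^ (d + 2) * 2⁻¹ ^ (i * (d + 2)) * 2 ^ (k * (d + 1)) *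
        ∫⁻ z in Metric.ball x ((2 : ℝ) ^ ((i : ℤ) - k)), u z := by
        rw [lintegral_tsum fun i =>
          ((hu.indicator Metric.isOpen_ball.measurableSet).const_mul _).aemeasurable]
        congr 1 with i
        rw [lintegral_const_mul _ (hu.indicator Metric.isOpen_ball.measurableSet),
          lintegral_indicator Metric.isOpen_ball.measurableSet]
    _ ≤ ∑' i : ℕ, (2 ^ (d + 2) * volume (Metric.ball (0 : Rn d) 1) * maximal u x) * 2⁻¹ ^ i := by
        refine ENNReal.tsum_le_tsum fun i => ?_
        refine (mul_le_mul_right (hball i) _).trans (le_of_eq ?_)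
        have h1 : (2⁻¹ : ℝ≥0∞) ^ (i * (d + 2)) * 2 ^ (i * (d + 1)) = 2⁻¹ ^ i := by
          rw [show i * (d + 2) = i * (d + 1) + i by ring, pow_add, mul_right_comm, ← mul_pow,
            ENNReal.inv_mul_cancel (by simp) (by simp), one_pow, one_mul]
        have h2 : (2 : ℝ≥0∞) ^ (k * (d + 1)) * (2 ^ (k * (d + 1)))⁻¹ = 1 :=
          ENNReal.mul_inv_cancel (by simp) (by finiteness)
        calc _ = 2 ^ (d + 2) * volume (Metric.ball (0 : Rn d) 1) * maximal u x *
              (2⁻¹ ^ (i * (d + 2)) * 2 ^ (i * (d + 1))) *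
              (2 ^ (k * (d + 1)) * (2 ^ (k * (d + 1)))⁻¹) := by ring
          _ = _ := by rw [h1, h2, mul_one]
    _ = cvConst d * maximal u x := by
        rw [ENNReal.tsum_mul_left, ENNReal.tsum_geometric, ENNReal.one_sub_inv_two, inv_inv,
          cvConst]
        ring

theorem lintegral_ker_sub_le {d : ℕ} (k : ℕ) (x : Rn d) :
    ∫⁻ z, ker (d + 2) k (x - z) ≤ cvConst d := by
  have h := cv_le_maximal k (u := fun _ : Rn d => 1) measurable_const x
  simp only [cv, mul_one] at h
  exact h.trans (mul_le_of_le_one_right' (maximal_le_of_le (fun _ => le_rfl) x))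

theorem lintegral_ker_sub_le' {d : ℕ} (k : ℕ) (z : Rn d) :
    ∫⁻ x, ker (d + 2) k (x - z) ≤ cvConst d := by
  have : ∀ x : Rn d, ker (d + 2) k (x - z) = ker (d + 2) k (z - x) := fun x => by
    simp only [ker]
    rw [← enorm_neg, neg_sub]
  simp_rw [this]
  exact lintegral_ker_sub_le k z

theorem lintegral_cv_mul {d : ℕ} (N k : ℕ) {u h : Rn d → ℝ≥0∞} (hu : Measurable u)
    (hh : Measurable h) : ∫⁻ x, cv N k u x * h x = ∫⁻ x, u x * cv N k h x := by
  simp only [cv]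
  have h1 : ∀ x, (∫⁻ z, ker N k (x - z) * u z) * h x = ∫⁻ z, ker N k (x - z) * u z * h x := by
    intro x
    rw [lintegral_mul_const]
    fun_prop
  have h2 : ∀ x, u x * (∫⁻ z, ker N k (x - z) * h z) = ∫⁻ z, ker N k (z - x) * u x * h z := by
    intro x
    rw [← lintegral_const_mul]
    · refine lintegral_congr fun z => ?_
      have : ker N k (x - z) = ker N k (z - x) := by
        simp only [ker]
        rw [← enorm_neg, neg_sub]
      rw [this]; ring
    · fun_prop
  simp_rw [h1, h2]
  rw [lintegral_lintegral_swap]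
  exact Measurable.aemeasurable (by fun_prop)

theorem lintegral_cv_le {d : ℕ} (k : ℕ) {u : Rn d → ℝ≥0∞} (hu : Measurable u) :
    ∫⁻ x, cv (d + 2) k u x ≤ cvConst d * ∫⁻ x, u x := by
  have h := lintegral_cv_mul (d + 2) k hu (h := fun _ => 1) measurable_const
  simp only [mul_one] at h
  rw [h, ← lintegral_const_mul _ hu]
  refine lintegral_mono fun x => ?_
  simp only [cv, mul_one]
  rw [mul_comm]
  exact mul_le_mul_left (lintegral_ker_sub_le k x) _

/-- Hölder's inequality for the measure `κ dμ` and an auxiliary weight `W`. -/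
theorem lintegral_mul_rpow_le {α : Type*} [MeasurableSpace α] {μ : Measure α} {κ u W : α → ℝ≥0∞}
    (hκ : Measurable κ) (hu : Measurable u) (hW : Measurable W) {Q : ℝ} (hQ : 1 < Q)
    (h : ∀ᵐ z ∂μ, u z = 0 ∨ (W z ≠ 0 ∧ W z ≠ ∞)) :
    (∫⁻ z, κ z * u z ∂μ) ^ Q ≤
      (∫⁻ z, κ z * (u z ^ Q * W z ^ (-(Q - 1))) ∂μ) * (∫⁻ z, κ z * W z ∂μ) ^ (Q - 1) := by
  set Q' := Q / (Q - 1)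
  have hQ0 : 0 < Q := by linarith
  have hQ1 : 0 < Q - 1 := by linarith
  have hQ' : 0 < Q' := by positivity
  have hconj : Q'.HolderConjugate Q := (Real.HolderConjugate.conjExponent hQ).symm
  have hsum : 1 / Q' + 1 / Q = 1 := by
    have := hconj.inv_add_inv_eq_one; simpa using this
  have hHol := ENNReal.lintegral_mul_le_Lp_mul_Lq μ hconj
    (f := fun z => (κ z * W z) ^ (1 / Q')) (g := fun z => κ z ^ (1 / Q) * (u z * W z ^ (-(1 / Q'))))
    (by fun_prop) (by fun_prop)
  have e1 : ∫⁻ z, κ z * u z ∂μ = ∫⁻ z, ((fun z => (κ z * W z) ^ (1 / Q')) *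
      fun z => κ z ^ (1 / Q) * (u z * W z ^ (-(1 / Q')))) z ∂μ := by
    refine lintegral_congr_ae ?_
    filter_upwards [h] with z hz
    rcases hz with hz | ⟨hz0, hz1⟩
    · simp [hz]
    · simp only [Pi.mul_apply]
      rw [ENNReal.mul_rpow_of_nonneg _ _ (by positivity)]
      calc κ z * u z = κ z ^ (1 / Q' + 1 / Q) * u z * W z ^ (1 / Q' + -(1 / Q')) := by
            rw [hsum]; simp
        _ = _ := by
            rw [ENNReal.rpow_add_of_nonneg _ _ (by positivity) (by positivity),
              ENNReal.rpow_add _ _ hz0 hz1]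
            ring
  have e2 : ∀ z, ((κ z * W z) ^ (1 / Q')) ^ Q' = κ z * W z := by
    intro z
    rw [← ENNReal.rpow_mul, one_div_mul_cancel hQ'.ne', ENNReal.rpow_one]
  have e3 : ∀ z, (κ z ^ (1 / Q) * (u z * W z ^ (-(1 / Q')))) ^ Q =
      κ z * (u z ^ Q * W z ^ (-(Q - 1))) := by
    intro z
    rw [ENNReal.mul_rpow_of_nonneg _ _ hQ0.le, ENNReal.mul_rpow_of_nonneg _ _ hQ0.le,
      ← ENNReal.rpow_mul, ← ENNReal.rpow_mul, one_div_mul_cancel hQ0.ne', ENNReal.rpow_one]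
    congr 3
    simp only [Q']
    field_simp
  rw [← e1] at hHol
  simp_rw [e2, e3] at hHol
  calc (∫⁻ z, κ z * u z ∂μ) ^ Q ≤ _ := ENNReal.rpow_le_rpow hHol hQ0.le
    _ = _ := by
      rw [ENNReal.mul_rpow_of_nonneg _ _ hQ0.le, ← ENNReal.rpow_mul, ← ENNReal.rpow_mul,
        one_div_mul_cancel hQ0.ne', ENNReal.rpow_one, mul_comm]
      congr 2
      simp only [Q']
      field_simp

/-- Jensen's inequality for the convolution operators. -/
theorem cv_rpow_le {d : ℕ} (k : ℕ) {u : Rn d → ℝ≥0∞} (hu : Measurable u) {Q : ℝ} (hQ : 1 ≤ Q)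
    (x : Rn d) : cv (d + 2) k u x ^ Q ≤
      cvConst d ^ (Q - 1) * cv (d + 2) k (fun z => u z ^ Q) x := by
  rcases hQ.eq_or_lt with rfl | hQ
  · simp
  have h := lintegral_mul_rpow_le (μ := volume) (κ := fun z => ker (d + 2) k (x - z))
    (W := fun _ => 1) (by fun_prop) hu measurable_const hQ (by simp)
  simp only [ENNReal.one_rpow, mul_one] at h
  rw [mul_comm]
  exact h.trans (mul_le_mul_right (ENNReal.rpow_le_rpow (lintegral_ker_sub_le k x)
    (by linarith)) _)

/-! ### The vector-valued inequality -/

/-- Hölder's inequality combined with the maximal inequality for the conjugate exponent. -/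
theorem lintegral_maximal_mul_le (d : ℕ) {S : ℝ} (hS : 1 < S) :
    ∃ C : ℝ≥0∞, C ≠ ∞ ∧ ∀ V h : Rn d → ℝ≥0∞, Measurable V → Measurable h →
      ∫⁻ x, V x * maximal (fun z => h z ^ (S - 1)) x ≤
        C * ((∫⁻ x, V x ^ S) ^ (1 / S) * (∫⁻ x, h x ^ S) ^ (1 - 1 / S)) := by
  have hS1 : 0 < S - 1 := by linarith
  have hconj : S.HolderConjugate (S / (S - 1)) := Real.HolderConjugate.conjExponent hS
  have hS' : 1 < S / (S - 1) := hconj.symm.lt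
  obtain ⟨C, hC, hM⟩ := exists_lintegral_maximal_rpow_le d hS'
  have he : 1 / (S / (S - 1)) = 1 - 1 / S := by field_simp
  refine ⟨C ^ (1 - 1 / S), ?_, fun V h hV hh => ?_⟩
  · have : 0 ≤ 1 - 1 / S := by rw [← he]; positivity
    finiteness
  have hmm := measurable_maximal (u := fun z => h z ^ (S - 1)) (by fun_prop)
  refine (ENNReal.lintegral_mul_le_Lp_mul_Lq volume hconj hV.aemeasurable
    hmm.aemeasurable).trans ?_
  rw [mul_left_comm, he]
  refine mul_le_mul_right ?_ _
  rw [← ENNReal.mul_rpow_of_nonneg _ _ (by rw [← he]; positivity)]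
  refine ENNReal.rpow_le_rpow ((hM _ (by fun_prop)).trans (le_of_eq ?_)) (by rw [← he]; positivity)
  congr 1
  refine lintegral_congr fun x => ?_
  rw [← ENNReal.rpow_mul]
  congr 1
  field_simp

/-- The case `q ≤ p` of the vector-valued inequality, after Jensen's inequality: duality with a
truncation of `(∑ η_k ∗ v_k)^{S-1}` and the maximal inequality. -/
theorem lintegral_tsum_cv_rpow_le (d : ℕ) {S : ℝ} (hS : 1 ≤ S) :
    ∃ C : ℝ≥0∞, C ≠ ∞ ∧ ∀ v : ℕ → Rn d → ℝ≥0∞, (∀ k, Measurable (v k)) →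
      ∫⁻ x, (∑' k, cv (d + 2) k (v k) x) ^ S ≤ C * ∫⁻ x, (∑' k, v k x) ^ S := by
  rcases hS.eq_or_lt with rfl | hS
  · refine ⟨cvConst d, cvConst_ne_top d, fun v hv => ?_⟩
    simp only [ENNReal.rpow_one]
    rw [lintegral_tsum fun k => (measurable_cv _ k (hv k)).aemeasurable,
      lintegral_tsum fun k => (hv k).aemeasurable, ← ENNReal.tsum_mul_left]
    exact ENNReal.tsum_le_tsum fun k => lintegral_cv_le k (hv k)
  have hS0 : 0 < S := by linarith
  have hS1 : 0 < S - 1 := by linarith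
  obtain ⟨C, hC, hM⟩ := lintegral_maximal_mul_le d hS
  have hK := cvConst_ne_top d
  refine ⟨(cvConst d * C) ^ S, by finiteness, fun v hv => ?_⟩
  set U : Rn d → ℝ≥0∞ := fun x => ∑' k, cv (d + 2) k (v k) x with hU
  set V : Rn d → ℝ≥0∞ := fun x => ∑' k, v k x with hVdef
  have hUm : Measurable U := Measurable.tsum fun k => measurable_cv _ k (hv k)
  have hVm : Measurable V := Measurable.tsum hv
  -- truncations of `U` with a finite norm, so that the norm can be cancelled in the estimate
  set T : ℕ → Rn d → ℝ≥0∞ := fun n => (Metric.ball 0 n).indicator fun x => min (U x) n with hT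
  have hTm : ∀ n, Measurable (T n) := fun n =>
    (hUm.min measurable_const).indicator Metric.isOpen_ball.measurableSet
  have hTU : ∀ n x, T n x ≤ U x := fun n x =>
    Set.indicator_le' (fun _ _ => min_le_left _ _) (fun _ _ => zero_le) x
  have hTmono : Monotone T := by
    intro a b hab
    refine Set.indicator_le fun y hy => ?_
    simp only [hT]
    rw [Set.indicator_of_mem (Metric.ball_subset_ball (by exact_mod_cast hab) hy)]
    exact min_le_min_left _ (by exact_mod_cast hab)
  have hfin : ∀ n, ∫⁻ x, T n x ^ S ≠ ∞ := by
    intro n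
    have hle : ∀ x, T n x ^ S ≤
        (Metric.ball (0 : Rn d) n).indicator (fun _ => (n : ℝ≥0∞) ^ S) x := by
      intro x
      by_cases hx : x ∈ Metric.ball (0 : Rn d) n
      · rw [Set.indicator_of_mem hx, hT]
        simp only [Set.indicator_of_mem hx]
        exact ENNReal.rpow_le_rpow (min_le_right _ _) hS0.le
      · simp only [hT, Set.indicator_of_notMem hx, ENNReal.zero_rpow_of_pos hS0, le_refl]
    refine ((lintegral_mono hle).trans_lt ?_).ne
    rw [lintegral_indicator_const Metric.isOpen_ball.measurableSet]
    exact ENNReal.mul_lt_top (by finiteness) measure_ball_lt_top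
  have hbound : ∀ n, ∫⁻ x, T n x ^ S ≤ (cvConst d * C) ^ S * ∫⁻ x, V x ^ S := by
    intro n
    set A := ∫⁻ x, T n x ^ S with hA
    by_cases hA0 : A = 0
    · rw [hA0]; exact zero_le
    have h1 : A ≤ (cvConst d * C) * ((∫⁻ x, V x ^ S) ^ (1 / S) * A ^ (1 - 1 / S)) := by
      calc A ≤ ∫⁻ x, U x * T n x ^ (S - 1) := by
            refine lintegral_mono fun x => ?_
            have : T n x ^ S = T n x * T n x ^ (S - 1) := by
              conv_lhs => rw [show S = 1 + (S - 1) by ring]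
              rw [ENNReal.rpow_add_of_nonneg _ _ zero_le_one hS1.le, ENNReal.rpow_one]
            rw [this]
            exact mul_le_mul_left (hTU n x) _
        _ = ∑' k, ∫⁻ x, v k x * cv (d + 2) k (fun z => T n z ^ (S - 1)) x := by
            have : ∀ x, U x * T n x ^ (S - 1) =
                ∑' k, cv (d + 2) k (v k) x * T n x ^ (S - 1) := fun x => by
              rw [ENNReal.tsum_mul_right]
            simp_rw [this]
            have hm : ∀ k, Measurable fun x => cv (d + 2) k (v k) x * T n x ^ (S - 1) := fun k =>
              (measurable_cv _ k (hv k)).mul ((hTm n).pow_const _)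
            rw [lintegral_tsum fun k => (hm k).aemeasurable]
            congr 1 with k
            exact lintegral_cv_mul _ _ (hv k) ((hTm n).pow_const _)
        _ ≤ ∑' k, ∫⁻ x, v k x * (cvConst d * maximal (fun z => T n z ^ (S - 1)) x) := by
            refine ENNReal.tsum_le_tsum fun k => lintegral_mono fun x => mul_le_mul_right ?_ _
            exact cv_le_maximal k ((hTm n).pow_const _) x
        _ = cvConst d * ∫⁻ x, V x * maximal (fun z => T n z ^ (S - 1)) x := by
            have hmm := measurable_maximal ((hTm n).pow_const (S - 1))
            have hm : ∀ k, Measurable fun x => v k x *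
                (cvConst d * maximal (fun z => T n z ^ (S - 1)) x) := fun k =>
              (hv k).mul (hmm.const_mul _)
            have hm' : Measurable fun x => V x * maximal (fun z => T n z ^ (S - 1)) x := hVm.mul hmm
            rw [← lintegral_tsum fun k => (hm k).aemeasurable, ← lintegral_const_mul _ hm']
            refine lintegral_congr fun x => ?_
            rw [ENNReal.tsum_mul_right]; ring
        _ ≤ _ := by
            rw [mul_assoc]
            exact mul_le_mul_right (hM V (T n) hVm (hTm n)) _
    -- divide by the finite positive factor `A ^ (1 - 1 / S)`
    have h2 : A ^ (1 / S) ≤ (cvConst d * C) * (∫⁻ x, V x ^ S) ^ (1 / S) := by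
      have h3 : A ^ (1 / S) * A ^ (1 - 1 / S) = A := by
        rw [← ENNReal.rpow_add _ _ hA0 (hfin n)]; simp
      have h4 : A ^ (1 - 1 / S) ≠ 0 := (ENNReal.rpow_pos (pos_iff_ne_zero.2 hA0) (hfin n)).ne'
      have h5 : A ^ (1 - 1 / S) ≠ ∞ := by
        have : 0 ≤ 1 - 1 / S := by rw [sub_nonneg, div_le_one hS0]; exact hS.le
        exact ENNReal.rpow_ne_top_of_nonneg this (hfin n)
      rw [← ENNReal.mul_le_mul_iff_left h4 h5, h3]
      rwa [← mul_assoc] at h1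
    calc A = (A ^ (1 / S)) ^ S := by
          rw [← ENNReal.rpow_mul, one_div_mul_cancel hS0.ne', ENNReal.rpow_one]
      _ ≤ _ := ENNReal.rpow_le_rpow h2 hS0.le
      _ = _ := by
          rw [ENNReal.mul_rpow_of_nonneg _ _ hS0.le, ← ENNReal.rpow_mul _ (1 / S),
            one_div_mul_cancel hS0.ne', ENNReal.rpow_one]
  have hsup : ∀ x, U x ^ S = ⨆ n, T n x ^ S := by
    intro x
    have h1 : Tendsto (fun n : ℕ => T n x ^ S) atTop (𝓝 (U x ^ S)) := by
      refine (ENNReal.continuous_rpow_const.tendsto _).comp ?_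
      have h2 : Tendsto (fun n : ℕ => min (U x) n) atTop (𝓝 (min (U x) ∞)) :=
        tendsto_const_nhds.min ENNReal.tendsto_nat_nhds_top
      rw [min_top_right] at h2
      refine h2.congr' ?_
      obtain ⟨m, hm⟩ := exists_nat_gt ‖x‖
      filter_upwards [eventually_ge_atTop m] with n hn
      rw [hT]
      have : x ∈ Metric.ball (0 : Rn d) n :=
        mem_ball_zero_iff.2 (hm.trans_le (by exact_mod_cast hn))
      simp only [Set.indicator_of_mem this]
    refine tendsto_nhds_unique h1 (tendsto_atTop_iSup ?_)
    intro a b hab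
    exact ENNReal.rpow_le_rpow (hTmono hab x) hS0.le
  change ∫⁻ x, U x ^ S ≤ _ * ∫⁻ x, V x ^ S
  simp_rw [hsup]
  rw [lintegral_iSup (fun n => (hTm n).pow_const _)]
  · exact iSup_le hbound
  · intro a b hab x
    exact ENNReal.rpow_le_rpow (hTmono hab x) hS0.le

/-- The case `p < q` of the vector-valued inequality: Hölder's inequality with the weight
`G^{p-q}`, `G = (∑ u_k^q)^{1/q}`, reduces it to the scalar maximal inequality. -/
theorem lintegral_tsum_cv_rpow_le_of_lt (d : ℕ) {P Q : ℝ} (hP : 1 < P) (hPQ : P < Q) :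
    ∃ C : ℝ≥0∞, C ≠ ∞ ∧ ∀ u : ℕ → Rn d → ℝ≥0∞, (∀ k, Measurable (u k)) →
      ∫⁻ x, (∑' k, cv (d + 2) k (u k) x ^ Q) ^ (P / Q) ≤
        C * ∫⁻ x, (∑' k, u k x ^ Q) ^ (P / Q) := by
  have hP0 : 0 < P := by linarith
  have hQ : 1 < Q := hP.trans hPQ
  have hQ0 : 0 < Q := by linarith
  have hQ1 : 0 < Q - 1 := by linarith
  have hd : 0 < Q - P := by linarith
  -- this exponent gives the weight `(G ^ ε) ^ (-(Q - 1)) = G ^ (P - Q)`, and `P / ε > 1` allows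
  -- the maximal inequality to be applied to `G ^ ε`
  set ε := (Q - P) / (Q - 1) with hε
  have hε0 : 0 < ε := by positivity
  have hPε : 1 < P / ε := by
    rw [hε, div_div_eq_mul_div, lt_div_iff₀ hd]; nlinarith
  obtain ⟨C, hC, hM⟩ := exists_lintegral_maximal_rpow_le d hPε
  have hK := cvConst_ne_top d
  have hPQ0 : 0 < P / Q := by positivity
  have hPQ1 : 0 < 1 - P / Q := by rw [sub_pos, div_lt_one hQ0]; exact hPQ
  refine ⟨(cvConst d ^ (Q - 1)) ^ (P / Q) * (cvConst d ^ (P / Q) * C ^ (1 - P / Q)) + 1,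
    by finiteness, fun u hu => ?_⟩
  set G : Rn d → ℝ≥0∞ := fun x => (∑' k, u k x ^ Q) ^ (1 / Q) with hG
  have hGm : Measurable G := (Measurable.tsum fun k => (hu k).pow_const _).pow_const _
  have hGQ : ∀ x, ∑' k, u k x ^ Q = G x ^ Q := fun x => by
    rw [hG]; simp only
    rw [← ENNReal.rpow_mul, one_div_mul_cancel hQ0.ne', ENNReal.rpow_one]
  have hGP : ∀ x, (∑' k, u k x ^ Q) ^ (P / Q) = G x ^ P := fun x => by
    rw [hGQ, ← ENNReal.rpow_mul, mul_div_cancel₀ _ hQ0.ne']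
  simp_rw [hGP]
  by_cases hI : ∫⁻ x, G x ^ P = ∞
  · rw [hI, ENNReal.mul_top (by simp)]; exact le_top
  have hGfin : ∀ᵐ x, G x ≠ ∞ := by
    filter_upwards [ae_lt_top (hGm.pow_const P) hI] with x hx h
    rw [h, ENNReal.top_rpow_of_pos hP0] at hx
    exact lt_irrefl _ hx
  have huG : ∀ k x, u k x ≤ G x := by
    intro k x
    calc u k x = (u k x ^ Q) ^ (1 / Q) := by
          rw [← ENNReal.rpow_mul, mul_one_div_cancel hQ0.ne', ENNReal.rpow_one]
      _ ≤ G x := ENNReal.rpow_le_rpow (ENNReal.le_tsum k) (by positivity)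
  set M := maximal fun z => G z ^ ε with hMdef
  have hMm : Measurable M := measurable_maximal (hGm.pow_const _)
  set w : Rn d → ℝ≥0∞ := fun z => (G z ^ ε) ^ (-(Q - 1)) with hw
  have hwm : Measurable w := (hGm.pow_const _).pow_const _
  have hmw : ∀ k, Measurable fun x => u k x ^ Q * w x := fun k => ((hu k).pow_const _).mul hwm
  set H : Rn d → ℝ≥0∞ := fun x => ∑' k, cv (d + 2) k (fun z => u k z ^ Q * w z) x with hH
  have hHm : Measurable H := Measurable.tsum fun k => measurable_cv _ k (hmw k)
  have hpt : ∀ x, ∑' k, cv (d + 2) k (u k) x ^ Q ≤ cvConst d ^ (Q - 1) * (M x ^ (Q - 1) * H x) := by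
    intro x
    rw [← mul_assoc, hH, ← ENNReal.tsum_mul_left]
    refine ENNReal.tsum_le_tsum fun k => ?_
    have h1 := lintegral_mul_rpow_le (μ := volume) (κ := fun z => ker (d + 2) k (x - z))
      (u := u k) (W := fun z => G z ^ ε) (by fun_prop) (hu k) (hGm.pow_const _) hQ (by
        filter_upwards [hGfin] with z hz
        by_cases h0 : G z = 0
        · left; exact le_antisymm ((huG k z).trans h0.le) zero_le
        · right
          exact ⟨(ENNReal.rpow_pos (pos_iff_ne_zero.2 h0) hz).ne',
            ENNReal.rpow_ne_top_of_nonneg hε0.le hz⟩)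
    refine h1.trans ?_
    rw [mul_comm]
    refine mul_le_mul_left ?_ _
    rw [← ENNReal.mul_rpow_of_nonneg _ _ hQ1.le]
    exact ENNReal.rpow_le_rpow (cv_le_maximal k (hGm.pow_const _) x) hQ1.le
  have hHint : ∫⁻ x, H x ≤ cvConst d * ∫⁻ x, G x ^ P := by
    calc ∫⁻ x, H x ≤ ∑' k, cvConst d * ∫⁻ x, u k x ^ Q * w x := by
          rw [hH, lintegral_tsum fun k => (measurable_cv _ k (hmw k)).aemeasurable]
          exact ENNReal.tsum_le_tsum fun k => lintegral_cv_le k (hmw k)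
      _ = cvConst d * ∫⁻ x, G x ^ Q * w x := by
          rw [ENNReal.tsum_mul_left, ← lintegral_tsum fun k => (hmw k).aemeasurable]
          simp_rw [ENNReal.tsum_mul_right, hGQ]
      _ ≤ _ := by
          refine mul_le_mul_right (lintegral_mono_ae ?_) _
          filter_upwards [hGfin] with x hx
          by_cases h0 : G x = 0
          · simp [h0, ENNReal.zero_rpow_of_pos hQ0]
          · rw [hw]
            simp only
            rw [← ENNReal.rpow_mul (G x), ← ENNReal.rpow_add _ _ h0 hx]
            refine le_of_eq ?_
            congr 1
            rw [hε]
            field_simp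
            ring
  have hMint : ∫⁻ x, M x ^ (P / ε) ≤ C * ∫⁻ x, G x ^ P := by
    refine (hM _ (hGm.pow_const _)).trans (le_of_eq ?_)
    congr 1
    refine lintegral_congr fun x => ?_
    rw [← ENNReal.rpow_mul, mul_div_cancel₀ _ hε0.ne']
  calc ∫⁻ x, (∑' k, cv (d + 2) k (u k) x ^ Q) ^ (P / Q)
      ≤ ∫⁻ x, (cvConst d ^ (Q - 1)) ^ (P / Q) *
          (H x ^ (P / Q) * (M x ^ (P / ε)) ^ (1 - P / Q)) := by
        refine lintegral_mono fun x => (ENNReal.rpow_le_rpow (hpt x) hPQ0.le).trans (le_of_eq ?_)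
        rw [ENNReal.mul_rpow_of_nonneg _ _ hPQ0.le, ENNReal.mul_rpow_of_nonneg _ _ hPQ0.le,
          ← ENNReal.rpow_mul (M x), ← ENNReal.rpow_mul (M x), mul_comm (H x ^ _)]
        congr 3
        rw [hε]
        field_simp
    _ = (cvConst d ^ (Q - 1)) ^ (P / Q) *
        ∫⁻ x, (H x ^ (P / Q) * (M x ^ (P / ε)) ^ (1 - P / Q)) :=
        lintegral_const_mul _ (by fun_prop)
    _ ≤ (cvConst d ^ (Q - 1)) ^ (P / Q) * ((cvConst d * ∫⁻ x, G x ^ P) ^ (P / Q) *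
          (C * ∫⁻ x, G x ^ P) ^ (1 - P / Q)) := by
        refine mul_le_mul_right ?_ _
        refine (ENNReal.lintegral_mul_norm_pow_le hHm.aemeasurable
          (hMm.pow_const _).aemeasurable hPQ0.le hPQ1.le (by ring)).trans ?_
        exact mul_le_mul' (ENNReal.rpow_le_rpow hHint hPQ0.le)
          (ENNReal.rpow_le_rpow hMint hPQ1.le)
    _ = (cvConst d ^ (Q - 1)) ^ (P / Q) * (cvConst d ^ (P / Q) * C ^ (1 - P / Q)) *
        ∫⁻ x, G x ^ P := by
        rw [ENNReal.mul_rpow_of_nonneg _ _ hPQ0.le, ENNReal.mul_rpow_of_nonneg _ _ hPQ1.le]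
        set I := ∫⁻ x, G x ^ P
        have : I ^ (P / Q) * I ^ (1 - P / Q) = I := by
          rw [← ENNReal.rpow_add_of_nonneg _ _ hPQ0.le hPQ1.le]; simp
        calc _ = (cvConst d ^ (Q - 1)) ^ (P / Q) * (cvConst d ^ (P / Q) * C ^ (1 - P / Q)) *
              (I ^ (P / Q) * I ^ (1 - P / Q)) := by ring
          _ = _ := by rw [this]
    _ ≤ _ := mul_le_mul_left le_self_add _

/-- The vector-valued inequality for the convolution operators in `L^p(ℓ^q)`. -/
theorem exists_lintegral_cv_le (d : ℕ) {P Q : ℝ} (hP : 1 < P) (hQ : 1 < Q) :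
    ∃ C : ℝ≥0∞, C ≠ ∞ ∧ ∀ u : ℕ → Rn d → ℝ≥0∞, (∀ k, Measurable (u k)) →
      ∫⁻ x, (∑' k, cv (d + 2) k (u k) x ^ Q) ^ (P / Q) ≤
        C * ∫⁻ x, (∑' k, u k x ^ Q) ^ (P / Q) := by
  rcases lt_or_ge P Q with h | h
  · exact lintegral_tsum_cv_rpow_le_of_lt d hP h
  have hQ0 : 0 < Q := by linarith
  have hPQ : 0 < P / Q := by positivity
  obtain ⟨C, hC, hM⟩ := lintegral_tsum_cv_rpow_le d (S := P / Q) ((one_le_div hQ0).2 h)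
  have hK := cvConst_ne_top d
  have hQ1 : 0 < Q - 1 := by linarith
  refine ⟨(cvConst d ^ (Q - 1)) ^ (P / Q) * C, by finiteness, fun u hu => ?_⟩
  have hm : ∀ k, Measurable fun z => u k z ^ Q := fun k => (hu k).pow_const _
  calc _ ≤ ∫⁻ x, (cvConst d ^ (Q - 1)) ^ (P / Q) *
        (∑' k, cv (d + 2) k (fun z => u k z ^ Q) x) ^ (P / Q) := by
        refine lintegral_mono fun x => ?_
        rw [← ENNReal.mul_rpow_of_nonneg _ _ hPQ.le, ← ENNReal.tsum_mul_left]
        refine ENNReal.rpow_le_rpow (ENNReal.tsum_le_tsum fun k => ?_) hPQ.le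
        exact cv_rpow_le k (hu k) hQ.le x
    _ ≤ _ := by
        rw [lintegral_const_mul _ ((Measurable.tsum fun k => measurable_cv _ k (hm k)).pow_const _),
          mul_assoc]
        exact mul_le_mul_right (hM _ hm) _

/-! ### Quasi-norms of sequences and of `[0, ∞]`-valued functions -/

theorem lqNorm_top {ι : Type*} (a : ι → ℝ≥0∞) : lqNorm ∞ a = ⨆ j, a j := if_pos rfl

theorem lqNorm_of_ne_top {ι : Type*} {q : ℝ≥0∞} (hq : q ≠ ∞) (a : ι → ℝ≥0∞) :
    lqNorm q a = (∑' j, a j ^ q.toReal) ^ (1 / q.toReal) := if_neg hq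

theorem lqNorm_eq_eLpNorm {ι : Type*} [MeasurableSpace ι] [MeasurableSingletonClass ι]
    [Countable ι] {q : ℝ≥0∞} (hq : q ≠ 0) (a : ι → ℝ≥0∞) :
    lqNorm q a = eLpNorm a q Measure.count := by
  by_cases h : q = ∞
  · subst h
    rw [lqNorm_top, eLpNorm_exponent_top, eLpNormEssSup]
    simp only [enorm_eq_self]
    exact (essSup_eq_iSup (by simp) a).symm
  · rw [lqNorm_of_ne_top h, eLpNorm_eq_lintegral_rpow_enorm_toReal hq h, lintegral_count]
    simp only [enorm_eq_self]

theorem eLpNorm_mono_ennreal {α : Type*} [MeasurableSpace α] {μ : Measure α} {f g : α → ℝ≥0∞}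
    (h : f ≤ᵐ[μ] g) (p : ℝ≥0∞) : eLpNorm f p μ ≤ eLpNorm g p μ :=
  eLpNorm_mono_enorm_ae (by simp only [enorm_eq_self]; exact h)

theorem lqNorm_mono {ι : Type*} (q : ℝ≥0∞) {a b : ι → ℝ≥0∞} (h : ∀ j, a j ≤ b j) :
    lqNorm q a ≤ lqNorm q b := by
  unfold lqNorm
  split_ifs
  · exact iSup_mono h
  · gcongr with j
    exact h j

theorem lqNorm_zero {ι : Type*} {q : ℝ≥0∞} (hq : q ≠ 0) : lqNorm q (fun _ : ι => 0) = 0 := by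
  by_cases h : q = ∞
  · simp [h, lqNorm_top]
  · have := ENNReal.toReal_pos hq h
    simp [lqNorm_of_ne_top h, this]

theorem lqNorm_const_mul {ι : Type*} {q : ℝ≥0∞} (hq : q ≠ 0) (c : ℝ≥0∞) (a : ι → ℝ≥0∞) :
    lqNorm q (fun j => c * a j) = c * lqNorm q a := by
  by_cases h : q = ∞
  · simp [h, lqNorm_top, ENNReal.mul_iSup]
  · have := ENNReal.toReal_pos hq h
    simp_rw [lqNorm_of_ne_top h, ENNReal.mul_rpow_of_nonneg _ _ this.le, ENNReal.tsum_mul_left]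
    rw [ENNReal.mul_rpow_of_nonneg _ _ (by positivity), ← ENNReal.rpow_mul,
      mul_one_div_cancel this.ne', ENNReal.rpow_one]

theorem lqNorm_comp_le {ι κ : Type*} {q : ℝ≥0∞} (e : ι → κ) (he : Function.Injective e)
    (a : κ → ℝ≥0∞) : lqNorm q (fun j => a (e j)) ≤ lqNorm q a := by
  unfold lqNorm
  split_ifs
  · exact iSup_comp_le a e
  · gcongr
    exact ENNReal.tsum_comp_le_tsum_of_injective he _

theorem lqNorm_subtype {ι : Type*} {q : ℝ≥0∞} (hq : q ≠ 0) (s : ι → Prop) [DecidablePred s]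
    (a : ι → ℝ≥0∞) :
    lqNorm q (fun j : {j // s j} => a j) = lqNorm q (fun j => if s j then a j else 0) := by
  by_cases h : q = ∞
  · subst h
    rw [lqNorm_top, lqNorm_top]
    apply le_antisymm
    · exact iSup_le fun j => (le_of_eq (if_pos j.2).symm).trans
        (le_iSup (fun j => if s j then a j else 0) j.1)
    · refine iSup_le fun j => ?_
      split_ifs with hj
      · exact le_iSup (fun j : {j // s j} => a j) ⟨j, hj⟩
      · exact zero_le
  · have := ENNReal.toReal_pos hq h
    rw [lqNorm_of_ne_top h, lqNorm_of_ne_top h]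
    congr 1
    refine (tsum_subtype {j | s j} fun j => a j ^ q.toReal).trans ?_
    congr 1 with j
    by_cases hj : s j
    · simp [Set.indicator, hj]
    · simp [Set.indicator, hj, this]

/-- Passing to powers in the `ℓ^q` quasi-norm. -/
theorem lqNorm_pow {ι : Type*} {q : ℝ≥0∞} (hq : q ≠ 0) {m : ℕ} (hm : m ≠ 0) (a : ι → ℝ≥0∞) :
    lqNorm q (fun j => a j ^ m) = lqNorm (m * q) a ^ m := by
  have hm0 : (m : ℝ) ≠ 0 := by exact_mod_cast hm
  by_cases h : q = ∞
  · subst h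
    rw [ENNReal.mul_top (by exact_mod_cast hm), lqNorm_top, lqNorm_top]
    have := (ENNReal.orderIsoRpow (m : ℝ) (by positivity)).map_iSup a
    simp only [ENNReal.orderIsoRpow_apply, ENNReal.rpow_natCast] at this
    exact this.symm
  · have hmq : (m : ℝ≥0∞) * q ≠ ∞ := ENNReal.mul_ne_top (by simp) h
    have hq' := ENNReal.toReal_pos hq h
    rw [lqNorm_of_ne_top h, lqNorm_of_ne_top hmq, ENNReal.toReal_mul, ENNReal.toReal_natCast,
      ← ENNReal.rpow_natCast, ← ENNReal.rpow_mul]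
    congr 1
    · congr 1 with j
      rw [← ENNReal.rpow_natCast, ← ENNReal.rpow_mul]
    · field_simp

theorem eLpNorm_pow {α : Type*} [MeasurableSpace α] {μ : Measure α} {q : ℝ≥0∞} (hq : q ≠ 0)
    {m : ℕ} (hm : m ≠ 0) (f : α → ℝ≥0∞) :
    eLpNorm (fun x => f x ^ m) q μ = eLpNorm f (m * q) μ ^ m := by
  have hm0 : (m : ℝ) ≠ 0 := by exact_mod_cast hm
  by_cases h : q = ∞
  · subst h
    rw [ENNReal.mul_top (by exact_mod_cast hm), eLpNorm_exponent_top, eLpNorm_exponent_top,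
      eLpNormEssSup, eLpNormEssSup]
    have := (ENNReal.orderIsoRpow (m : ℝ) (by positivity)).essSup_apply f μ
    simpa using this.symm
  · have hmq : (m : ℝ≥0∞) * q ≠ ∞ := ENNReal.mul_ne_top (by simp) h
    have hq' := ENNReal.toReal_pos hq h
    rw [eLpNorm_eq_lintegral_rpow_enorm_toReal hq h,
      eLpNorm_eq_lintegral_rpow_enorm_toReal (by simp [hm, hq]) hmq, ENNReal.toReal_mul,
      ENNReal.toReal_natCast, ← ENNReal.rpow_natCast, ← ENNReal.rpow_mul]
    congr 1
    · refine lintegral_congr fun x => ?_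
      simp only [enorm_eq_self]
      rw [← ENNReal.rpow_natCast, ← ENNReal.rpow_mul]
    · field_simp

theorem eLpNorm_const_mul_ennreal {α : Type*} [MeasurableSpace α] {μ : Measure α} {p : ℝ≥0∞}
    {c : ℝ≥0∞} (hc : c ≠ ∞) (f : α → ℝ≥0∞) :
    eLpNorm (fun x => c * f x) p μ = c * eLpNorm f p μ := by
  by_cases hp0 : p = 0
  · simp [hp0]
  by_cases h : p = ∞
  · subst h
    rw [eLpNorm_exponent_top, eLpNorm_exponent_top, eLpNormEssSup, eLpNormEssSup]
    simp only [enorm_eq_self]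
    exact ENNReal.essSup_const_mul
  · have hp' := ENNReal.toReal_pos hp0 h
    rw [eLpNorm_eq_lintegral_rpow_enorm_toReal hp0 h, eLpNorm_eq_lintegral_rpow_enorm_toReal hp0 h]
    simp only [enorm_eq_self]
    simp_rw [ENNReal.mul_rpow_of_nonneg _ _ hp'.le]
    rw [lintegral_const_mul' _ _ (by finiteness), ENNReal.mul_rpow_of_nonneg _ _ (by positivity),
      ← ENNReal.rpow_mul, mul_one_div_cancel hp'.ne', ENNReal.rpow_one]

/-- The countable triangle inequality. -/
theorem eLpNorm_tsum_ennreal_le {α ι : Type*} [MeasurableSpace α] [Countable ι] {μ : Measure α}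
    {p : ℝ≥0∞} (hp : 1 ≤ p) {f : ι → α → ℝ≥0∞} (hf : ∀ i, Measurable (f i)) :
    eLpNorm (fun x => ∑' i, f i x) p μ ≤ ∑' i, eLpNorm (f i) p μ := by
  have hp0 : p ≠ 0 := (zero_lt_one.trans_le hp).ne'
  by_cases h : p = ∞
  · subst h
    simp only [eLpNorm_exponent_top]
    refine essSup_le_of_ae_le _ ?_
    have : ∀ᵐ x ∂μ, ∀ i, f i x ≤ eLpNormEssSup (f i) μ := by
      rw [ae_all_iff]
      intro i
      exact ENNReal.ae_le_essSup (f i)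
    filter_upwards [this] with x hx
    exact ENNReal.tsum_le_tsum hx
  have hp' := ENNReal.toReal_pos hp0 h
  have hfin : ∀ s : Finset ι, eLpNorm (fun x => ∑ i ∈ s, f i x) p μ ≤ ∑' i, eLpNorm (f i) p μ := by
    intro s
    have := eLpNorm_sum_le (s := s) (f := f) (μ := μ)
      (fun i _ => (hf i).aestronglyMeasurable) hp
    refine le_trans (le_of_eq ?_) (this.trans (ENNReal.sum_le_tsum s))
    congr 1 with x
    simp
  have hsup : ∀ x, (∑' i, f i x) ^ p.toReal = ⨆ s : Finset ι, (∑ i ∈ s, f i x) ^ p.toReal := by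
    intro x
    rw [ENNReal.tsum_eq_iSup_sum]
    exact (ENNReal.orderIsoRpow p.toReal hp').map_iSup fun s : Finset ι => ∑ i ∈ s, f i x
  rw [eLpNorm_eq_lintegral_rpow_enorm_toReal hp0 h]
  simp only [enorm_eq_self, hsup]
  rw [lintegral_iSup_directed (fun s => (Measurable.pow_const
    (Finset.measurable_fun_sum s fun i _ => hf i) _).aemeasurable)]
  · have := (ENNReal.orderIsoRpow (1 / p.toReal) (by positivity)).map_iSup
      fun s : Finset ι => ∫⁻ x, (∑ i ∈ s, f i x) ^ p.toReal ∂μ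
    simp only [ENNReal.orderIsoRpow_apply] at this
    rw [this]
    refine iSup_le fun s => ?_
    have h2 := hfin s
    rw [eLpNorm_eq_lintegral_rpow_enorm_toReal hp0 h] at h2
    simpa using h2
  · classical
    intro s t
    refine ⟨s ∪ t, fun x => ?_, fun x => ?_⟩
    · exact ENNReal.rpow_le_rpow (Finset.sum_le_sum_of_subset Finset.subset_union_left) hp'.le
    · exact ENNReal.rpow_le_rpow (Finset.sum_le_sum_of_subset Finset.subset_union_right) hp'.le

theorem lqNorm_tsum_le {ι : Type*} [Countable ι] {q : ℝ≥0∞} (hq : 1 ≤ q)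
    (a : ι → ℕ → ℝ≥0∞) :
    lqNorm q (fun k => ∑' i, a i k) ≤ ∑' i, lqNorm q (a i) := by
  have hq0 : q ≠ 0 := (zero_lt_one.trans_le hq).ne'
  simp_rw [lqNorm_eq_eLpNorm hq0]
  exact eLpNorm_tsum_ennreal_le hq fun i => measurable_of_countable _

theorem measurable_lqNorm {α ι : Type*} [MeasurableSpace α] [Countable ι] (q : ℝ≥0∞)
    {f : ι → α → ℝ≥0∞} (hf : ∀ i, Measurable (f i)) :
    Measurable fun x => lqNorm q fun i => f i x := by
  unfold lqNorm
  split_ifs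
  · exact Measurable.iSup hf
  · exact (Measurable.tsum fun i => (hf i).pow_const _).pow_const _

/-! ### Dyadic cubes -/

theorem measurableSet_dyadicCube {d : ℕ} (J : ℤ) (v : Fin (d + 1) → ℤ) :
    MeasurableSet (dyadicCube J v : Set (Rn d)) := by
  have h : (dyadicCube J v : Set (Rn d)) = ⋂ i, (fun x : Rn d => x i) ⁻¹'
      Set.Ioo ((2 : ℝ) ^ (-J) * (v i : ℝ)) ((2 : ℝ) ^ (-J) * (v i : ℝ) + (2 : ℝ) ^ (-J)) := by
    ext x
    simp [dyadicCube]
  rw [h]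
  exact MeasurableSet.iInter fun i => (by fun_prop : Measurable fun x : Rn d => x i)
    measurableSet_Ioo

theorem volume_dyadicCube_zero {d : ℕ} (v : Fin (d + 1) → ℤ) :
    volume (dyadicCube 0 v : Set (Rn d)) = 1 := by
  have h : (dyadicCube 0 v : Set (Rn d)) = WithLp.ofLp ⁻¹'
      (Set.univ.pi fun i => Set.Ioo (v i : ℝ) (v i + 1)) := by
    ext x
    simp [dyadicCube]
  rw [h, (PiLp.volume_preserving_ofLp (Fin (d + 1))).measure_preimage
    (MeasurableSet.univ_pi fun i => measurableSet_Ioo).nullMeasurableSet, Real.volume_pi_Ioo]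
  simp

/-- The dyadic cubes of a fixed side length cover almost every point. -/
theorem ae_exists_mem_dyadicCube {d : ℕ} (J : ℤ) :
    ∀ᵐ x : Rn d, ∃ v, x ∈ dyadicCube J v := by
  have h0 : ∀ i : Fin (d + 1), ∀ c : ℤ, ∀ᵐ x : Rn d, (2 : ℝ) ^ J * x i ≠ c := by
    intro i c
    have h1 := (PiLp.volume_preserving_ofLp (Fin (d + 1))).quasiMeasurePreserving.ae
      (p := fun f : Fin (d + 1) → ℝ => f i ≠ (2 : ℝ) ^ (-J) * c) (by
        rw [ae_iff]
        simp only [not_not]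
        exact Measure.pi_hyperplane (fun _ => volume) i _)
    filter_upwards [h1] with x hx h
    refine hx ?_
    rw [← h, ← mul_assoc, ← zpow_add₀ two_ne_zero]
    simp
  have h1 : ∀ᵐ x : Rn d, ∀ (i : Fin (d + 1)) (c : ℤ), (2 : ℝ) ^ J * x i ≠ c := by
    rw [ae_all_iff]
    intro i
    rw [ae_all_iff]
    exact h0 i
  filter_upwards [h1] with x hx
  refine ⟨fun i => ⌊(2 : ℝ) ^ J * x i⌋, fun i => ?_⟩
  have hp : (0 : ℝ) < 2 ^ J := by positivity
  have h2 : (⌊(2 : ℝ) ^ J * x i⌋ : ℝ) < 2 ^ J * x i :=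
    lt_of_le_of_ne (Int.floor_le _) fun h => hx i _ h.symm
  have h3 : (2 : ℝ) ^ J * x i < ⌊(2 : ℝ) ^ J * x i⌋ + 1 := Int.lt_floor_add_one _
  rw [zpow_neg, inv_mul_lt_iff₀ hp]
  refine ⟨h2, ?_⟩
  rw [← mul_add_one, lt_inv_mul_iff₀ hp]
  exact h3

theorem mem_dyadicCube_unique {d : ℕ} {J : ℤ} {v w : Fin (d + 1) → ℤ} {x : Rn d}
    (hv : x ∈ dyadicCube J v) (hw : x ∈ dyadicCube J w) : v = w := by
  funext i
  have hp : (0 : ℝ) < 2 ^ (-J) := by positivity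
  have h1 := hv i
  have h2 := hw i
  have h3 : (v i : ℝ) < w i + 1 := by
    have := h1.1.trans h2.2
    rw [← mul_add_one] at this
    exact lt_of_mul_lt_mul_left this hp.le
  have h4 : (w i : ℝ) < v i + 1 := by
    have := h2.1.trans h1.2
    rw [← mul_add_one] at this
    exact lt_of_mul_lt_mul_left this hp.le
  have h5 : v i < w i + 1 := by exact_mod_cast h3
  have h6 : w i < v i + 1 := by exact_mod_cast h4
  omega

theorem dyadicCube_subset {d : ℕ} (J : ℤ) (l : ℕ) (v : Fin (d + 1) → ℤ) :
    (dyadicCube J v : Set (Rn d)) ⊆ dyadicCube (J - l) fun i => v i / 2 ^ l := by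
  intro x hx i
  have hp : (0 : ℝ) < 2 ^ (-J) := by positivity
  have e : (2 : ℝ) ^ (-(J - (l : ℤ))) = 2 ^ (-J) * 2 ^ l := by
    rw [← zpow_natCast, ← zpow_add₀ two_ne_zero]; congr 1; ring
  have h1 : (2 : ℤ) ^ l * (v i / 2 ^ l) ≤ v i := Int.mul_ediv_self_le (by positivity)
  have h2 : v i + 1 ≤ 2 ^ l * (v i / 2 ^ l) + 2 ^ l := by
    have := Int.lt_mul_ediv_self_add (x := v i) (k := 2 ^ l) (by positivity)
    omega
  have h1' : (2 : ℝ) ^ l * (v i / 2 ^ l : ℤ) ≤ v i := by exact_mod_cast h1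
  have h2' : (v i : ℝ) + 1 ≤ 2 ^ l * (v i / 2 ^ l : ℤ) + 2 ^ l := by exact_mod_cast h2
  obtain ⟨h3, h4⟩ := hx i
  rw [e, mul_assoc, ← mul_add]
  refine ⟨lt_of_le_of_lt (mul_le_mul_of_nonneg_left h1' hp.le) h3, h4.trans_le ?_⟩
  rw [← mul_add_one]
  exact mul_le_mul_of_nonneg_left h2' hp.le

theorem tsum_indicator_dyadicCube {d : ℕ} (J : ℤ) (f : Rn d → ℝ≥0∞) :
    (fun x => ∑' v, (dyadicCube J v).indicator f x) =ᵐ[volume] f := by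
  filter_upwards [ae_exists_mem_dyadicCube (d := d) J] with x ⟨v, hv⟩
  rw [tsum_eq_single v]
  · exact Set.indicator_of_mem hv f
  · intro w hw
    refine Set.indicator_of_notMem (fun h => hw (mem_dyadicCube_unique h hv)) f

/-! ### Norms of function sequences that are stable under convolutions and shifts -/

/-- The sequence `(u_{j+m})_{j ≥ 0}`, with `u_k = 0` for `k < 0`. -/
def shift {d : ℕ} (m : ℤ) (u : ℕ → Rn d → ℝ≥0∞) (j : ℕ) (x : Rn d) : ℝ≥0∞ :=
  if 0 ≤ (j : ℤ) + m then u ((j : ℤ) + m).toNat x else 0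

/-- The properties of a quasi-norm of sequences `(u_k)_{k ≥ 0}` of functions that the estimates
need: monotonicity, the countable triangle inequality, boundedness of
`(u_k) ↦ (η_k ∗ u_k)` for rapidly decreasing `η_k` at scale `2^{-k}`, and at most exponential
growth under shifts of the index. -/
structure ConvNorm {d : ℕ} (𝒩 : (ℕ → Rn d → ℝ≥0∞) → ℝ≥0∞) : Prop where
  mono_ae : ∀ u v : ℕ → Rn d → ℝ≥0∞, (∀ k, u k ≤ᵐ[volume] v k) → 𝒩 u ≤ 𝒩 v
  tsum_le : ∀ {ι : Type} [Countable ι] (u : ι → ℕ → Rn d → ℝ≥0∞), (∀ i k, Measurable (u i k)) →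
    𝒩 (fun k x => ∑' i, u i k x) ≤ ∑' i, 𝒩 (u i)
  smul_le : ∀ (c : ℝ≥0∞) (u : ℕ → Rn d → ℝ≥0∞), c ≠ ∞ → 𝒩 (fun k x => c * u k x) ≤ c * 𝒩 u
  conv_le : ∃ (N : ℕ) (C : ℝ≥0∞), C ≠ ∞ ∧ ∀ u : ℕ → Rn d → ℝ≥0∞, (∀ k, Measurable (u k)) →
    𝒩 (fun k => cv N k (u k)) ≤ C * 𝒩 u
  shift_le : ∃ A : ℕ, ∀ (m : ℤ) (u : ℕ → Rn d → ℝ≥0∞), 𝒩 (shift m u) ≤ 2 ^ (A * m.natAbs) * 𝒩 u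

theorem tsum_int_two_inv_pow_le : ∑' m : ℤ, (2⁻¹ : ℝ≥0∞) ^ m.natAbs ≤ 4 := by
  rw [tsum_of_nat_of_neg_add_one ENNReal.summable ENNReal.summable]
  have h1 : ∀ n : ℕ, (2⁻¹ : ℝ≥0∞) ^ (-((n : ℤ) + 1)).natAbs ≤ 2⁻¹ ^ n := by
    intro n
    rw [show (-((n : ℤ) + 1)).natAbs = n + 1 by omega]
    exact pow_le_pow_right_of_le_one' (by simp) (Nat.le_succ n)
  refine (add_le_add_right (ENNReal.tsum_le_tsum h1) _).trans ?_
  simp only [Int.natAbs_natCast]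
  rw [ENNReal.tsum_geometric, ENNReal.one_sub_inv_two, inv_inv]
  norm_num

/-- Substitution of `m = k - j` in a sum over `k`. -/
theorem tsum_nat_le_tsum_int (j : ℕ) (f : ℕ → ℝ≥0∞) :
    ∑' k, f k ≤ ∑' m : ℤ, if 0 ≤ (j : ℤ) + m then f ((j : ℤ) + m).toNat else 0 := by
  have hinj : Function.Injective fun k : ℕ => (k : ℤ) - j := fun a b h => by simpa using h
  refine le_trans (le_of_eq ?_) (ENNReal.tsum_comp_le_tsum_of_injective hinj
    fun m : ℤ => if 0 ≤ (j : ℤ) + m then f ((j : ℤ) + m).toNat else 0)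
  congr 1 with k
  simp

/-- An almost diagonal family of convolution operators is bounded: for `m = k - j` the decay
`2^{-N|m|}` compensates for the growth of the norm under a shift by `m`. -/
theorem ConvNorm.exists_le {d : ℕ} {𝒩 : (ℕ → Rn d → ℝ≥0∞) → ℝ≥0∞} (h𝒩 : ConvNorm 𝒩) :
    ∃ N : ℕ, ∃ C : ℝ≥0∞, C ≠ ∞ ∧ ∀ u H : ℕ → Rn d → ℝ≥0∞, (∀ k, Measurable (u k)) →
      (∀ j x, H j x ≤ ∑' k : ℕ, 2⁻¹ ^ (N * ((k : ℤ) - j).natAbs) * cv N k (u k) x) →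
      𝒩 H ≤ C * 𝒩 u := by
  obtain ⟨N₀, C₀, hC₀, hconv⟩ := h𝒩.conv_le
  obtain ⟨A, hA⟩ := h𝒩.shift_le
  refine ⟨N₀ + A + 1, 4 * C₀, by finiteness, fun u H hu hH => ?_⟩
  set N := N₀ + A + 1
  set w : ℕ → Rn d → ℝ≥0∞ := fun k => cv N₀ k (u k) with hw
  have hwm : ∀ k, Measurable (w k) := fun k => measurable_cv _ k (hu k)
  have hsm : ∀ m k, Measurable (shift m w k) := by
    intro m k
    unfold shift
    split_ifs
    · exact hwm _
    · exact measurable_const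
  have h1 : ∀ j x, H j x ≤ ∑' m : ℤ, 2⁻¹ ^ (N * m.natAbs) * shift m w j x := by
    intro j x
    refine (hH j x).trans ((tsum_nat_le_tsum_int j _).trans (ENNReal.tsum_le_tsum fun m => ?_))
    unfold shift
    split_ifs with hm
    · have e : (((j : ℤ) + m).toNat : ℤ) - j = m := by omega
      rw [e]
      exact mul_le_mul_right (cv_anti (by omega) _ _ _) _
    · exact zero_le
  calc 𝒩 H ≤ 𝒩 fun j x => ∑' m : ℤ, 2⁻¹ ^ (N * m.natAbs) * shift m w j x :=
        h𝒩.mono_ae _ _ fun j => Eventually.of_forall (h1 j)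
    _ ≤ ∑' m : ℤ, 𝒩 fun j x => 2⁻¹ ^ (N * m.natAbs) * shift m w j x :=
        h𝒩.tsum_le _ fun m k => (hsm m k).const_mul _
    _ ≤ ∑' m : ℤ, 2⁻¹ ^ m.natAbs * (C₀ * 𝒩 u) := by
        refine ENNReal.tsum_le_tsum fun m => ?_
        refine (h𝒩.smul_le _ _ (by finiteness)).trans ?_
        refine (mul_le_mul_right ((hA m w).trans (mul_le_mul_right (hconv u hu) _)) _).trans ?_
        rw [← mul_assoc]
        refine mul_le_mul_left ?_ _
        have : N * m.natAbs = A * m.natAbs + (N₀ + 1) * m.natAbs := by simp only [N]; ring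
        rw [this, pow_add, mul_right_comm, ← mul_pow, ENNReal.inv_mul_cancel (by simp) (by simp),
          one_pow, one_mul]
        exact pow_le_pow_right_of_le_one' (by simp) (Nat.le_mul_of_pos_left _ (by omega))
    _ ≤ 4 * C₀ * 𝒩 u := by
        rw [ENNReal.tsum_mul_right, mul_assoc]
        exact mul_le_mul_left tsum_int_two_inv_pow_le _

/-! ### The norms of `ℓ^q(L^p)`, `L^p(ℓ^q)` and `ℓ^q(M^p_τ)` -/

/-- The norm of `ℓ^q(L^p(ℝⁿ))`. -/
def baseB {d : ℕ} (p q : ℝ≥0∞) (u : ℕ → Rn d → ℝ≥0∞) : ℝ≥0∞ :=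
  lqNorm q fun k => eLpNorm (u k) p volume

/-- The norm of `L^p(ℝⁿ; ℓ^q)`. -/
def baseF {d : ℕ} (p q : ℝ≥0∞) (u : ℕ → Rn d → ℝ≥0∞) : ℝ≥0∞ :=
  eLpNorm (fun x => lqNorm q fun k => u k x) p volume

/-- The norm of the Morrey space `M^p_τ` for functions with values in `[0, ∞]`. -/
def morrey {d : ℕ} (p : ℝ≥0∞) (τ : ℝ) (u : Rn d → ℝ≥0∞) : ℝ≥0∞ :=
  ⨆ (J : ℤ) (v : Fin (d + 1) → ℤ), cubeWeight d J τ *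
    eLpNorm u p (volume.restrict (dyadicCube J v))

/-- The norm of `ℓ^q(M^p_τ)`. -/
def baseN {d : ℕ} (p q : ℝ≥0∞) (τ : ℝ) (u : ℕ → Rn d → ℝ≥0∞) : ℝ≥0∞ :=
  lqNorm q fun k => morrey p τ (u k)

theorem lqNorm_shift_le {q : ℝ≥0∞} (hq : q ≠ 0) (m : ℤ) (a : ℕ → ℝ≥0∞) :
    lqNorm q (fun j : ℕ => if 0 ≤ (j : ℤ) + m then a ((j : ℤ) + m).toNat else 0) ≤ lqNorm q a := by
  rw [← lqNorm_subtype hq (fun j : ℕ => 0 ≤ (j : ℤ) + m) fun j : ℕ => a ((j : ℤ) + m).toNat]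
  refine lqNorm_comp_le (fun j : {j : ℕ // 0 ≤ (j : ℤ) + m} => ((j : ℤ) + m).toNat) ?_ a
  rintro ⟨i, hi⟩ ⟨j, hj⟩ h
  simp only at h
  ext
  simp only
  omega

theorem cubeWeight_ne_top (d : ℕ) (J : ℤ) (τ : ℝ) : cubeWeight d J τ ≠ ∞ :=
  by simp [cubeWeight, ENNReal.rpow_eq_top_iff]

theorem cubeWeight_pos (d : ℕ) (J : ℤ) (τ : ℝ) : 0 < cubeWeight d J τ :=
  ENNReal.rpow_pos (by simp) (by simp)

theorem ConvNorm.baseB {d : ℕ} {p q : ℝ≥0∞} (hp : 1 ≤ p) (hq : 1 ≤ q) :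
    ConvNorm (baseB (d := d) p q) := by
  have hp0 : p ≠ 0 := (zero_lt_one.trans_le hp).ne'
  have hq0 : q ≠ 0 := (zero_lt_one.trans_le hq).ne'
  refine ⟨fun u v h => lqNorm_mono q fun k => eLpNorm_mono_ennreal (h k) p, ?_, ?_, ?_, ?_⟩
  · intro ι _ u hu
    exact (lqNorm_mono q fun k => eLpNorm_tsum_ennreal_le hp fun i => hu i k).trans
      (lqNorm_tsum_le hq fun i k => eLpNorm (u i k) p volume)
  · intro c u hc
    simp only [LPDomain.baseB]
    simp_rw [eLpNorm_const_mul_ennreal hc]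
    exact (lqNorm_const_mul hq0 c _).le
  · refine ⟨d + 2, cvConst d, cvConst_ne_top d, fun u hu => ?_⟩
    rw [LPDomain.baseB, LPDomain.baseB, ← lqNorm_const_mul hq0]
    refine lqNorm_mono q fun k => ?_
    by_cases h : p = ∞
    · subst h
      simp only [eLpNorm_exponent_top]
      refine essSup_le_of_ae_le _ (Eventually.of_forall fun x => ?_)
      simp only [enorm_eq_self]
      refine (cv_mono _ k (v := fun _ => eLpNormEssSup (u k) volume)
        (ENNReal.ae_le_essSup (u k)) x).trans ?_
      simp only [cv]
      rw [lintegral_mul_const _ (by fun_prop)]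
      exact mul_le_mul_left (lintegral_ker_sub_le k x) _
    · have hp' : 1 ≤ p.toReal := by
        rw [← ENNReal.toReal_one]; exact (ENNReal.toReal_le_toReal (by simp) h).2 hp
      have hp'' : 0 < p.toReal := by linarith
      rw [eLpNorm_eq_lintegral_rpow_enorm_toReal hp0 h,
        eLpNorm_eq_lintegral_rpow_enorm_toReal hp0 h]
      simp only [enorm_eq_self]
      have h1 : ∫⁻ x, cv (d + 2) k (u k) x ^ p.toReal ≤
          cvConst d ^ p.toReal * ∫⁻ x, u k x ^ p.toReal := by
        refine (lintegral_mono fun x => cv_rpow_le k (hu k) hp' x).trans ?_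
        have hm : Measurable fun x => u k x ^ p.toReal := (hu k).pow_const _
        rw [lintegral_const_mul _ (measurable_cv _ k hm)]
        refine (mul_le_mul_right (lintegral_cv_le k hm) _).trans (le_of_eq ?_)
        rw [← mul_assoc]
        congr 1
        conv_rhs => rw [show p.toReal = (p.toReal - 1) + 1 by ring]
        rw [ENNReal.rpow_add_of_nonneg _ _ (by linarith) zero_le_one, ENNReal.rpow_one]
      refine (ENNReal.rpow_le_rpow h1 (by positivity)).trans (le_of_eq ?_)
      rw [ENNReal.mul_rpow_of_nonneg _ _ (by positivity), ← ENNReal.rpow_mul,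
        mul_one_div_cancel hp''.ne', ENNReal.rpow_one]
  · refine ⟨0, fun m u => ?_⟩
    rw [zero_mul, pow_zero, one_mul]
    refine le_trans (lqNorm_mono q fun k => ?_)
      (lqNorm_shift_le hq0 m fun k => eLpNorm (u k) p volume)
    by_cases hk : 0 ≤ (k : ℤ) + m
    · have : shift m u k = u ((k : ℤ) + m).toNat := funext fun x => if_pos hk
      rw [this, if_pos hk]
    · have : shift m u k = fun _ => 0 := funext fun x => if_neg hk
      rw [this]
      simp

/-- The convolution property is the vector-valued inequality if `q < ∞`. If `q = ∞`, then the
supremum over `k` can be taken inside of the convolutions, and the scalar maximal inequality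
suffices. -/
theorem ConvNorm.baseF {d : ℕ} {p q : ℝ≥0∞} (hp : 1 < p) (hp' : p ≠ ∞) (hq : 1 < q) :
    ConvNorm (baseF (d := d) p q) := by
  have hp0 : p ≠ 0 := (zero_lt_one.trans hp).ne'
  have hq0 : q ≠ 0 := (zero_lt_one.trans hq).ne'
  have hpr : 1 < p.toReal := by
    rw [← ENNReal.toReal_one]; exact (ENNReal.toReal_lt_toReal (by simp) hp').2 hp
  have hpr0 : 0 < p.toReal := by linarith
  refine ⟨?_, ?_, ?_, ?_, ?_⟩
  · intro u v h
    refine eLpNorm_mono_ennreal ?_ p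
    filter_upwards [ae_all_iff.2 h] with x hx
    exact lqNorm_mono q hx
  · intro ι _ u hu
    refine le_trans (eLpNorm_mono_ennreal (Eventually.of_forall fun x =>
      lqNorm_tsum_le hq.le fun i k => u i k x) p) ?_
    exact eLpNorm_tsum_ennreal_le hp.le fun i => measurable_lqNorm q (hu i)
  · intro c u hc
    simp only [LPDomain.baseF]
    simp_rw [lqNorm_const_mul hq0]
    exact (eLpNorm_const_mul_ennreal hc _).le
  · by_cases hqt : q = ∞
    · subst hqt
      obtain ⟨C, hC, hM⟩ := exists_lintegral_maximal_rpow_le d hpr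
      have hK := cvConst_ne_top d
      refine ⟨d + 2, cvConst d * C ^ (1 / p.toReal), by finiteness, fun u hu => ?_⟩
      simp only [LPDomain.baseF, lqNorm_top]
      have hm : Measurable fun x => ⨆ k, u k x := Measurable.iSup hu
      calc _ ≤ eLpNorm (fun x => cvConst d * maximal (fun z => ⨆ k, u k z) x) p volume := by
            refine eLpNorm_mono_ennreal (Eventually.of_forall fun x => iSup_le fun k => ?_) p
            refine (cv_mono _ k (Eventually.of_forall fun z => ?_) x).trans (cv_le_maximal k hm x)
            exact le_iSup (fun k => u k z) k
        _ ≤ _ := by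
            rw [eLpNorm_const_mul_ennreal hK, mul_assoc]
            refine mul_le_mul_right ?_ _
            rw [eLpNorm_eq_lintegral_rpow_enorm_toReal hp0 hp',
              eLpNorm_eq_lintegral_rpow_enorm_toReal hp0 hp']
            simp only [enorm_eq_self]
            rw [← ENNReal.mul_rpow_of_nonneg _ _ (by positivity)]
            exact ENNReal.rpow_le_rpow (hM _ hm) (by positivity)
    · have hqr : 1 < q.toReal := by
        rw [← ENNReal.toReal_one]; exact (ENNReal.toReal_lt_toReal (by simp) hqt).2 hq
      obtain ⟨C, hC, hM⟩ := exists_lintegral_cv_le d hpr hqr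
      refine ⟨d + 2, C ^ (1 / p.toReal), by finiteness, fun u hu => ?_⟩
      simp only [LPDomain.baseF, lqNorm_of_ne_top hqt]
      rw [eLpNorm_eq_lintegral_rpow_enorm_toReal hp0 hp',
        eLpNorm_eq_lintegral_rpow_enorm_toReal hp0 hp']
      simp only [enorm_eq_self, ← ENNReal.rpow_mul, one_div_mul_eq_div]
      rw [← ENNReal.mul_rpow_of_nonneg _ _ (by positivity)]
      exact ENNReal.rpow_le_rpow (hM u hu) (by positivity)
  · refine ⟨0, fun m u => ?_⟩
    rw [zero_mul, pow_zero, one_mul]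
    exact eLpNorm_mono_ennreal (Eventually.of_forall fun x =>
      lqNorm_shift_le hq0 m fun k => u k x) p

/-- The Morrey norm is almost invariant under translations, with the number `2^n` of cubes that a
translated cube can meet as the constant. -/
theorem setLIntegral_dyadicCube_translate_le {d : ℕ} (J : ℤ) (v : Fin (d + 1) → ℤ)
    {f : Rn d → ℝ≥0∞} (hf : Measurable f) {B : ℝ≥0∞}
    (hB : ∀ w, ∫⁻ x in dyadicCube J w, f x ≤ B) (y : Rn d) :
    ∫⁻ x in dyadicCube J v, f (x - y) ≤ 2 ^ (d + 1) * B := by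
  set w : Fin (d + 1) → ℤ := fun i => ⌊(v i : ℝ) - 2 ^ J * y i⌋ with hw
  have hp : (0 : ℝ) < 2 ^ J := by positivity
  -- the translated cube meets at most two cubes in each coordinate direction
  have hsub : ∀ᵐ z : Rn d, z + y ∈ dyadicCube J v →
      ∃ e : Fin (d + 1) → Bool, z ∈ dyadicCube J fun i => w i + if e i then 1 else 0 := by
    filter_upwards [ae_exists_mem_dyadicCube (d := d) J] with z ⟨v', hv'⟩ hz
    have key : ∀ i, v' i = w i ∨ v' i = w i + 1 := by
      intro i
      obtain ⟨h1, h2⟩ := hz i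
      obtain ⟨h3, h4⟩ := hv' i
      rw [zpow_neg] at h1 h2 h3 h4
      rw [inv_mul_lt_iff₀ hp] at h1 h3
      rw [← mul_add_one, lt_inv_mul_iff₀ hp] at h2 h4
      simp only [PiLp.add_apply, mul_add] at h1 h2
      have h5 : (w i : ℝ) ≤ v i - 2 ^ J * y i := Int.floor_le _
      have h6 : (v i : ℝ) - 2 ^ J * y i < w i + 1 := Int.lt_floor_add_one _
      have h7 : (v' i : ℝ) < w i + 2 := by linarith
      have h8 : (w i : ℝ) < v' i + 1 := by linarith
      have h9 : v' i < w i + 2 := by exact_mod_cast h7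
      have h10 : w i < v' i + 1 := by exact_mod_cast h8
      omega
    refine ⟨fun i => decide (v' i = w i + 1), ?_⟩
    convert hv' using 2
    funext i
    rcases key i with h | h <;> simp [h]
  calc ∫⁻ x in dyadicCube J v, f (x - y)
      = ∫⁻ z, (dyadicCube J v).indicator (fun x => f (x - y)) (z + y) := by
        rw [← lintegral_indicator (measurableSet_dyadicCube J v)]
        exact (lintegral_add_right_eq_self _ y).symm
    _ ≤ ∫⁻ z, ∑ e : Fin (d + 1) → Bool,
          (dyadicCube J fun i => w i + if e i then 1 else 0).indicator f z := by
        refine lintegral_mono_ae ?_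
        filter_upwards [hsub] with z hz
        by_cases hzy : z + y ∈ dyadicCube J v
        · obtain ⟨e, he⟩ := hz hzy
          rw [Set.indicator_of_mem hzy, add_sub_cancel_right]
          refine le_trans (le_of_eq (Set.indicator_of_mem he f).symm)
            (Finset.single_le_sum (f := fun e : Fin (d + 1) → Bool =>
              (dyadicCube J fun i => w i + if e i then 1 else 0).indicator f z)
              (fun _ _ => zero_le) (Finset.mem_univ e))
        · rw [Set.indicator_of_notMem hzy]
          exact zero_le
    _ ≤ ∑ e : Fin (d + 1) → Bool, B := by
        rw [lintegral_finsetSum _ fun e _ => hf.indicator (measurableSet_dyadicCube _ _)]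
        refine Finset.sum_le_sum fun e _ => ?_
        rw [lintegral_indicator (measurableSet_dyadicCube _ _)]
        exact hB _
    _ = _ := by simp

/-- Convolutions are bounded in the Morrey spaces: by Jensen's inequality `(η_k ∗ u)^p` is dominated
by an average of translates of `u^p`. -/
theorem eLpNorm_cv_dyadicCube_le {d : ℕ} {p : ℝ≥0∞} (hp : 1 ≤ p) (k : ℕ) {u : Rn d → ℝ≥0∞}
    (hu : Measurable u) (J : ℤ) (v : Fin (d + 1) → ℤ) {B : ℝ≥0∞}
    (hB : ∀ w, eLpNorm u p (volume.restrict (dyadicCube J w)) ≤ B) :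
    eLpNorm (cv (d + 2) k u) p (volume.restrict (dyadicCube J v)) ≤
      (cvConst d * 2 ^ (d + 1)) * B := by
  have hp0 : p ≠ 0 := (zero_lt_one.trans_le hp).ne'
  by_cases h : p = ∞
  · subst h
    have hall : ∀ᵐ x : Rn d, u x ≤ B := by
      have h1 : ∀ᵐ x : Rn d, ∀ w, x ∈ dyadicCube J w → u x ≤ B := by
        rw [ae_all_iff]
        intro w
        rw [← ae_restrict_iff' (measurableSet_dyadicCube J w)]
        filter_upwards [ENNReal.ae_le_essSup (μ := volume.restrict (dyadicCube J w)) u] with x hx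
        exact hx.trans (hB w)
      filter_upwards [h1, ae_exists_mem_dyadicCube (d := d) J] with x hx ⟨w, hw⟩
      exact hx w hw
    rw [eLpNorm_exponent_top]
    refine essSup_le_of_ae_le _ (Eventually.of_forall fun x => ?_)
    simp only [enorm_eq_self]
    refine (cv_mono _ k (v := fun _ => B) hall x).trans ?_
    simp only [cv]
    rw [lintegral_mul_const _ (by fun_prop)]
    refine mul_le_mul_left ((lintegral_ker_sub_le k x).trans ?_) _
    exact le_mul_of_one_le_right' (one_le_pow₀ one_le_two)
  · have hp' : 1 ≤ p.toReal := by
      rw [← ENNReal.toReal_one]; exact (ENNReal.toReal_le_toReal (by simp) h).2 hp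
    have hp'' : 0 < p.toReal := by linarith
    have hB' : ∀ w, ∫⁻ x in dyadicCube J w, u x ^ p.toReal ≤ B ^ p.toReal := by
      intro w
      have h1 := hB w
      rw [eLpNorm_eq_lintegral_rpow_enorm_toReal hp0 h] at h1
      simp only [enorm_eq_self] at h1
      rwa [one_div, ENNReal.rpow_inv_le_iff hp''] at h1
    have hm : Measurable fun x => u x ^ p.toReal := hu.pow_const _
    rw [eLpNorm_eq_lintegral_rpow_enorm_toReal hp0 h]
    simp only [enorm_eq_self]
    have hcv : ∀ x, cv (d + 2) k (fun z => u z ^ p.toReal) x =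
        ∫⁻ y, ker (d + 2) k y * u (x - y) ^ p.toReal := by
      intro x
      simp only [cv]
      rw [← lintegral_sub_left_eq_self _ x]
      simp
    have hm2 : Measurable fun q : Rn d × Rn d => ker (d + 2) k q.2 * u (q.1 - q.2) ^ p.toReal := by
      fun_prop
    have h1 : ∫⁻ x in dyadicCube J v, cv (d + 2) k u x ^ p.toReal ≤
        ((cvConst d * 2 ^ (d + 1)) * B) ^ p.toReal := by
      calc _ ≤ ∫⁻ x in dyadicCube J v, cvConst d ^ (p.toReal - 1) *
            cv (d + 2) k (fun z => u z ^ p.toReal) x :=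
            lintegral_mono fun x => cv_rpow_le k hu hp' x
        _ = cvConst d ^ (p.toReal - 1) * ∫⁻ y, ∫⁻ x in dyadicCube J v,
            ker (d + 2) k y * u (x - y) ^ p.toReal := by
            rw [lintegral_const_mul _ (measurable_cv _ k hm)]
            simp_rw [hcv]
            rw [lintegral_lintegral_swap hm2.aemeasurable]
        _ ≤ cvConst d ^ (p.toReal - 1) * ∫⁻ y, ker (d + 2) k y *
            (2 ^ (d + 1) * B ^ p.toReal) := by
            refine mul_le_mul_right (lintegral_mono fun y => ?_) _
            rw [lintegral_const_mul _ (by fun_prop)]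
            exact mul_le_mul_right (setLIntegral_dyadicCube_translate_le J v hm hB' y) _
        _ ≤ cvConst d ^ (p.toReal - 1) * (cvConst d * (2 ^ (d + 1) * B ^ p.toReal)) := by
            refine mul_le_mul_right ?_ _
            rw [lintegral_mul_const _ (by fun_prop)]
            refine mul_le_mul_left ?_ _
            simpa using lintegral_ker_sub_le' k (0 : Rn d)
        _ ≤ _ := by
            rw [ENNReal.mul_rpow_of_nonneg _ _ hp''.le, ENNReal.mul_rpow_of_nonneg _ _ hp''.le,
              ← mul_assoc, ← mul_assoc]
            refine mul_le_mul_left (mul_le_mul' (le_of_eq ?_) ?_) _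
            · conv_rhs => rw [show p.toReal = (p.toReal - 1) + 1 by ring]
              rw [ENNReal.rpow_add_of_nonneg _ _ (by linarith) zero_le_one, ENNReal.rpow_one]
            · conv_lhs => rw [← ENNReal.rpow_one (2 ^ (d + 1))]
              exact ENNReal.rpow_le_rpow_of_exponent_le (one_le_pow₀ one_le_two) hp'
    rw [one_div, ENNReal.rpow_inv_le_iff hp'']
    exact h1

theorem ConvNorm.baseN {d : ℕ} {p q : ℝ≥0∞} (τ : ℝ) (hp : 1 ≤ p) (hq : 1 ≤ q) :
    ConvNorm (baseN (d := d) p q τ) := by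
  have hq0 : q ≠ 0 := (zero_lt_one.trans_le hq).ne'
  have hfin : cvConst d * 2 ^ (d + 1) ≠ ∞ := by
    have := cvConst_ne_top d
    finiteness
  refine ⟨?_, ?_, ?_, ?_, ?_⟩
  · intro u v h
    refine lqNorm_mono q fun k => iSup_mono fun J => iSup_mono fun w => mul_le_mul_right ?_ _
    exact eLpNorm_mono_ennreal (ae_restrict_of_ae (h k)) p
  · intro ι _ u hu
    refine le_trans (lqNorm_mono q fun k => ?_) (lqNorm_tsum_le hq fun i k => morrey p τ (u i k))
    refine iSup_le fun J => iSup_le fun w => ?_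
    refine (mul_le_mul_right (eLpNorm_tsum_ennreal_le hp fun i => hu i k) _).trans ?_
    rw [← ENNReal.tsum_mul_left]
    refine ENNReal.tsum_le_tsum fun i => ?_
    exact le_iSup₂ (f := fun (J : ℤ) (w : Fin (d + 1) → ℤ) => cubeWeight d J τ *
      eLpNorm (u i k) p (volume.restrict (dyadicCube J w))) J w
  · intro c u hc
    refine le_trans (lqNorm_mono q fun k => ?_) (lqNorm_const_mul hq0 c _).le
    refine iSup_le fun J => iSup_le fun w => ?_
    rw [eLpNorm_const_mul_ennreal hc, mul_left_comm]
    refine mul_le_mul_right ?_ _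
    exact le_iSup₂ (f := fun (J : ℤ) (w : Fin (d + 1) → ℤ) => cubeWeight d J τ *
      eLpNorm (u k) p (volume.restrict (dyadicCube J w))) J w
  · refine ⟨d + 2, cvConst d * 2 ^ (d + 1), hfin, fun u hu => ?_⟩
    rw [LPDomain.baseN, LPDomain.baseN, ← lqNorm_const_mul hq0]
    refine lqNorm_mono q fun k => iSup_le fun J => iSup_le fun w => ?_
    have hc0 := (cubeWeight_pos d J τ).ne'
    have hct := cubeWeight_ne_top d J τ
    have h1 : ∀ w', eLpNorm (u k) p (volume.restrict (dyadicCube J w')) ≤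
        (cubeWeight d J τ)⁻¹ * morrey p τ (u k) := by
      intro w'
      rw [← ENNReal.mul_le_iff_le_inv hc0 hct]
      exact le_iSup₂ (f := fun (J : ℤ) (w : Fin (d + 1) → ℤ) => cubeWeight d J τ *
        eLpNorm (u k) p (volume.restrict (dyadicCube J w))) J w'
    refine (mul_le_mul_right (eLpNorm_cv_dyadicCube_le hp k (hu k) J w h1) _).trans (le_of_eq ?_)
    rw [mul_left_comm, ← mul_assoc (cubeWeight d J τ), ENNReal.mul_inv_cancel hc0 hct, one_mul]
  · refine ⟨0, fun m u => ?_⟩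
    rw [zero_mul, pow_zero, one_mul]
    refine le_trans (lqNorm_mono q fun k => ?_)
      (lqNorm_shift_le hq0 m fun k => morrey p τ (u k))
    by_cases hk : 0 ≤ (k : ℤ) + m
    · have : shift m u k = u ((k : ℤ) + m).toNat := funext fun x => if_pos hk
      rw [this, if_pos hk]
    · have : shift m u k = fun _ => 0 := funext fun x => if_neg hk
      rw [this]
      simp [morrey]

/-! ### Localization to dyadic cubes -/

/-- The truncation of `(u_k)` to the cube `Q_{J,v}` and the indices `k ≥ max(0, J)`. -/
def cutoff {d : ℕ} (J : ℤ) (v : Fin (d + 1) → ℤ) (u : ℕ → Rn d → ℝ≥0∞) (k : ℕ) (x : Rn d) :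
    ℝ≥0∞ :=
  if max 0 J ≤ (k : ℤ) then (dyadicCube J v).indicator (u k) x else 0

/-- The Morrey-type quasi-norm `sup_{J,v} 2^{nJτ} 𝒩((u_k 1_{Q_{J,v}})_{k ≥ max(0,J)})`. -/
def localized {d : ℕ} (τ : ℝ) (𝒩 : (ℕ → Rn d → ℝ≥0∞) → ℝ≥0∞) (u : ℕ → Rn d → ℝ≥0∞) : ℝ≥0∞ :=
  ⨆ (J : ℤ) (v : Fin (d + 1) → ℤ), cubeWeight d J τ * 𝒩 (cutoff J v u)

theorem measurable_cutoff {d : ℕ} (J : ℤ) (v : Fin (d + 1) → ℤ) {u : ℕ → Rn d → ℝ≥0∞}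
    (hu : ∀ k, Measurable (u k)) (k : ℕ) : Measurable (cutoff J v u k) := by
  unfold cutoff
  split_ifs
  · exact (hu k).indicator (measurableSet_dyadicCube J v)
  · exact measurable_const

theorem le_localized {d : ℕ} (τ : ℝ) (𝒩 : (ℕ → Rn d → ℝ≥0∞) → ℝ≥0∞) (u : ℕ → Rn d → ℝ≥0∞)
    (J : ℤ) (v : Fin (d + 1) → ℤ) : cubeWeight d J τ * 𝒩 (cutoff J v u) ≤ localized τ 𝒩 u :=
  le_iSup₂ (f := fun (J : ℤ) (v : Fin (d + 1) → ℤ) => cubeWeight d J τ * 𝒩 (cutoff J v u)) J v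

theorem le_inv_mul_localized {d : ℕ} (τ : ℝ) (𝒩 : (ℕ → Rn d → ℝ≥0∞) → ℝ≥0∞)
    (u : ℕ → Rn d → ℝ≥0∞) (J : ℤ) (v : Fin (d + 1) → ℤ) :
    𝒩 (cutoff J v u) ≤ (cubeWeight d J τ)⁻¹ * localized τ 𝒩 u := by
  rw [← ENNReal.mul_le_iff_le_inv (cubeWeight_pos d J τ).ne' (cubeWeight_ne_top d J τ)]
  exact le_localized τ 𝒩 u J v

/-- The decay of the interaction of the cubes `Q_{J,v}` and `Q_{J,v-t}`. As an integral of an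
integrable kernel over a unit cube it is obviously summable over `t`. -/
def cubeDecay {d : ℕ} (t : Fin (d + 1) → ℤ) : ℝ≥0∞ :=
  ∫⁻ y in (dyadicCube 0 t : Set (Rn d)), ker (d + 2) 0 y

theorem tsum_cubeDecay_le (d : ℕ) : ∑' t, cubeDecay (d := d) t ≤ cvConst d := by
  have hm : ∀ t, Measurable ((dyadicCube 0 t).indicator (ker (d := d) (d + 2) 0)) := fun t =>
    (measurable_ker _ _).indicator (measurableSet_dyadicCube 0 t)
  calc ∑' t, cubeDecay (d := d) t
      = ∑' t, ∫⁻ y, (dyadicCube 0 t).indicator (ker (d := d) (d + 2) 0) y := by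
        congr 1 with t
        rw [cubeDecay, lintegral_indicator (measurableSet_dyadicCube 0 t)]
    _ = ∫⁻ y, ker (d := d) (d + 2) 0 y := by
        rw [← lintegral_tsum fun t => (hm t).aemeasurable]
        exact lintegral_congr_ae (tsum_indicator_dyadicCube 0 _)
    _ ≤ cvConst d := by simpa using lintegral_ker_sub_le' 0 (0 : Rn d)

theorem norm_le_of_forall_abs_le {d : ℕ} {x : Rn d} {c : ℝ} (h : ∀ i, |x i| ≤ c) :
    ‖x‖ ≤ (d + 1) * c := by
  have hx : x = ∑ i, EuclideanSpace.single i (x i) := by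
    ext j
    simp [Finset.sum_apply]
  calc ‖x‖ = ‖∑ i, EuclideanSpace.single i (x i)‖ := by rw [← hx]
    _ ≤ ∑ i : Fin (d + 1), ‖EuclideanSpace.single i (x i)‖ := norm_sum_le _ _
    _ ≤ ∑ i : Fin (d + 1), c := by
        refine Finset.sum_le_sum fun i _ => ?_
        simpa using h i
    _ = (d + 1) * c := by simp

/-- Every `y ∈ Q_{0,v-w}` differs from `2^J (x - z)` by at most `2` in each coordinate. -/
theorem bump_pow_le_cubeDecay {d : ℕ} {J : ℤ} {k : ℕ} (hk : J ≤ k) {v w : Fin (d + 1) → ℤ}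
    {x z : Rn d} (hx : x ∈ dyadicCube J v) (hz : z ∈ dyadicCube J w) :
    (1 + 2 ^ k * ‖x - z‖ₑ)⁻¹ ^ (d + 2) ≤
      ((2 * d + 3 : ℕ) : ℝ≥0∞) ^ (d + 2) * cubeDecay (v - w) := by
  have hp : (0 : ℝ) < 2 ^ J := by positivity
  have key : ∀ y ∈ (dyadicCube 0 (v - w) : Set (Rn d)),
      (1 + 2 ^ k * ‖x - z‖ₑ)⁻¹ ^ (d + 2) ≤
        ((2 * d + 3 : ℕ) : ℝ≥0∞) ^ (d + 2) * ker (d + 2) 0 y := by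
    intro y hy
    have h1 : ‖y - (2 : ℝ) ^ J • (x - z)‖ ≤ (d + 1) * 2 := by
      refine norm_le_of_forall_abs_le fun i => ?_
      obtain ⟨a1, a2⟩ := hx i
      obtain ⟨b1, b2⟩ := hz i
      obtain ⟨c1, c2⟩ := hy i
      rw [zpow_neg] at a1 a2 b1 b2
      rw [inv_mul_lt_iff₀ hp] at a1 b1
      rw [← mul_add_one, lt_inv_mul_iff₀ hp] at a2 b2
      simp only [neg_zero, zpow_zero, one_mul, Pi.sub_apply, Int.cast_sub] at c1 c2
      simp only [PiLp.sub_apply, PiLp.smul_apply, smul_eq_mul, mul_sub]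
      rw [abs_le]
      constructor <;> linarith
    have h2 : ‖y‖ ≤ 2 ^ k * ‖x - z‖ + 2 * (d + 1) := by
      have h3 : ‖y‖ ≤ ‖y - (2 : ℝ) ^ J • (x - z)‖ + ‖(2 : ℝ) ^ J • (x - z)‖ := by
        simpa using norm_add_le (y - (2 : ℝ) ^ J • (x - z)) ((2 : ℝ) ^ J • (x - z))
      rw [norm_smul, Real.norm_of_nonneg hp.le] at h3
      have h4 : (2 : ℝ) ^ J ≤ 2 ^ k := by
        rw [← zpow_natCast]; exact zpow_le_zpow_right₀ one_le_two hk
      nlinarith [norm_nonneg (x - z)]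
    have h3 : 1 + ‖y‖ₑ ≤ ((2 * d + 3 : ℕ) : ℝ≥0∞) * (1 + 2 ^ k * ‖x - z‖ₑ) := by
      have h4 : 1 + ‖y‖ ≤ ((2 * d + 3 : ℕ) : ℝ) * (1 + 2 ^ k * ‖x - z‖) := by
        push_cast
        have : 0 ≤ 2 ^ k * ‖x - z‖ := by positivity
        nlinarith
      have h5 := ENNReal.ofReal_le_ofReal h4
      rw [ENNReal.ofReal_add (by norm_num) (norm_nonneg _), ENNReal.ofReal_mul (by positivity),
        ENNReal.ofReal_add (by norm_num) (by positivity), ENNReal.ofReal_mul (by positivity),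
        ENNReal.ofReal_pow (by norm_num), ofReal_norm, ofReal_norm, ENNReal.ofReal_natCast] at h5
      simpa using h5
    have h4 : (1 + 2 ^ k * ‖x - z‖ₑ)⁻¹ ≤ ((2 * d + 3 : ℕ) : ℝ≥0∞) * (1 + ‖y‖ₑ)⁻¹ := by
      rw [← ENNReal.inv_le_inv, ENNReal.mul_inv (by simp) (by simp)] at h3
      · have h5 := mul_le_mul_right h3 ((2 * d + 3 : ℕ) : ℝ≥0∞)
        rwa [← mul_assoc, ENNReal.mul_inv_cancel (by simp) (ENNReal.natCast_ne_top _),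
          one_mul] at h5
    calc _ ≤ (((2 * d + 3 : ℕ) : ℝ≥0∞) * (1 + ‖y‖ₑ)⁻¹) ^ (d + 2) := pow_le_pow_left' h4 _
      _ = _ := by rw [mul_pow, ker]; simp
  calc (1 + 2 ^ k * ‖x - z‖ₑ)⁻¹ ^ (d + 2)
      = ∫⁻ y in (dyadicCube 0 (v - w) : Set (Rn d)), (1 + 2 ^ k * ‖x - z‖ₑ)⁻¹ ^ (d + 2) := by
        rw [setLIntegral_const, volume_dyadicCube_zero, mul_one]
    _ ≤ ∫⁻ y in (dyadicCube 0 (v - w) : Set (Rn d)), ((2 * d + 3 : ℕ) : ℝ≥0∞) ^ (d + 2) *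
          ker (d + 2) 0 y := setLIntegral_mono' (measurableSet_dyadicCube _ _) key
    _ = _ := by rw [lintegral_const_mul _ (by fun_prop), cubeDecay]

/-- Off-diagonal decay of the convolution operators between dyadic cubes. -/
theorem cutoff_cv_le {d : ℕ} (N : ℕ) (J : ℤ) (v : Fin (d + 1) → ℤ) {u : ℕ → Rn d → ℝ≥0∞}
    (hu : ∀ k, Measurable (u k)) (k : ℕ) (x : Rn d) :
    cutoff J v (fun k => cv (N + (d + 2)) k (u k)) k x ≤
      ∑' w, ((2 * d + 3 : ℕ) : ℝ≥0∞) ^ (d + 2) * cubeDecay (v - w) *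
        cv N k (cutoff J w u k) x := by
  unfold cutoff
  split_ifs with hk
  swap
  · exact zero_le
  by_cases hx : x ∈ dyadicCube J v
  swap
  · rw [Set.indicator_of_notMem hx]
    exact zero_le
  rw [Set.indicator_of_mem hx]
  have hkJ : J ≤ k := (le_max_right _ _).trans hk
  have hm : ∀ w, Measurable ((dyadicCube J w).indicator (u k)) := fun w =>
    (hu k).indicator (measurableSet_dyadicCube J w)
  calc cv (N + (d + 2)) k (u k) x
      = ∫⁻ z, ∑' w, ker (N + (d + 2)) k (x - z) * (dyadicCube J w).indicator (u k) z := by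
        simp only [cv]
        refine lintegral_congr_ae ?_
        filter_upwards [tsum_indicator_dyadicCube J (u k)] with z hz
        rw [ENNReal.tsum_mul_left, hz]
    _ = ∑' w, ∫⁻ z, ker (N + (d + 2)) k (x - z) * (dyadicCube J w).indicator (u k) z := by
        refine lintegral_tsum fun w => ?_
        have := hm w
        exact Measurable.aemeasurable (by fun_prop)
    _ ≤ _ := by
        refine ENNReal.tsum_le_tsum fun w => ?_
        simp only [cv]
        have := hm w
        rw [← lintegral_const_mul _ (by fun_prop)]
        refine lintegral_mono fun z => ?_
        by_cases hz : z ∈ dyadicCube J w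
        · rw [Set.indicator_of_mem hz]
          have h1 := bump_pow_le_cubeDecay hkJ hx hz
          calc _ = (1 + 2 ^ k * ‖x - z‖ₑ)⁻¹ ^ (d + 2) * (ker N k (x - z) * u k z) := by
                simp only [ker]
                rw [pow_add]
                ring
            _ ≤ _ := mul_le_mul_left h1 _
        · rw [Set.indicator_of_notMem hz]
          simp

theorem cubeWeight_le_of_le {d : ℕ} {τ : ℝ} {A : ℕ} (hA : ((d : ℝ) + 1) * τ ≤ A) (J : ℤ) (l : ℕ) :
    cubeWeight d J τ ≤ 2 ^ (A * l) * cubeWeight d (J - l) τ := by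
  unfold cubeWeight
  rw [← ENNReal.rpow_natCast, ← ENNReal.rpow_add _ _ (by simp) (by simp)]
  refine ENNReal.rpow_le_rpow_of_exponent_le one_le_two ?_
  push_cast
  have hl : (0 : ℝ) ≤ l := by positivity
  nlinarith [mul_le_mul_of_nonneg_right hA hl]

/-- Localization to dyadic cubes preserves the class `ConvNorm`. Convolutions are controlled by
`cutoff_cv_le`, as the norms of the truncations to all cubes of side length `2^{-J}` have the same
bound. The condition `k ≥ max(0, J)` is not invariant under shifts, which costs a factor that is
exponential in the shift. -/
theorem ConvNorm.localized {d : ℕ} {𝒩 : (ℕ → Rn d → ℝ≥0∞) → ℝ≥0∞} (h𝒩 : ConvNorm 𝒩) (τ : ℝ) :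
    ConvNorm (localized τ 𝒩) := by
  refine ⟨?_, ?_, ?_, ?_, ?_⟩
  · intro u v h
    refine iSup_mono fun J => iSup_mono fun w => mul_le_mul_right (h𝒩.mono_ae _ _ fun k => ?_) _
    filter_upwards [h k] with x hx
    unfold cutoff
    split_ifs
    · exact Set.indicator_le_indicator hx
    · exact le_rfl
  · intro ι _ u hu
    refine iSup_le fun J => iSup_le fun w => ?_
    have h1 : cutoff J w (fun k x => ∑' i, u i k x) = fun k x => ∑' i, cutoff J w (u i) k x := by
      funext k x
      unfold cutoff
      split_ifs
      · by_cases hx : x ∈ dyadicCube J w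
        · simp only [Set.indicator_of_mem hx]
        · simp only [Set.indicator_of_notMem hx, tsum_zero]
      · simp
    rw [h1]
    refine (mul_le_mul_right (h𝒩.tsum_le _ fun i => measurable_cutoff J w (hu i)) _).trans ?_
    rw [← ENNReal.tsum_mul_left]
    exact ENNReal.tsum_le_tsum fun i => le_localized τ 𝒩 (u i) J w
  · intro c u hc
    refine iSup_le fun J => iSup_le fun w => ?_
    have h1 : cutoff J w (fun k x => c * u k x) = fun k x => c * cutoff J w u k x := by
      funext k x
      unfold cutoff
      split_ifs
      · by_cases hx : x ∈ dyadicCube J w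
        · simp only [Set.indicator_of_mem hx]
        · simp only [Set.indicator_of_notMem hx, mul_zero]
      · simp
    rw [h1]
    refine (mul_le_mul_right (h𝒩.smul_le c _ hc) _).trans ?_
    rw [mul_left_comm]
    exact mul_le_mul_right (le_localized τ 𝒩 u J w) _
  · obtain ⟨N, C, hC, hconv⟩ := h𝒩.conv_le
    have hK := cvConst_ne_top d
    refine ⟨N + (d + 2), ((2 * d + 3 : ℕ) : ℝ≥0∞) ^ (d + 2) * cvConst d * C, by finiteness,
      fun u hu => iSup_le fun J => iSup_le fun v => ?_⟩
    have hdec : ∀ t, cubeDecay (d := d) t ≠ ∞ := fun t =>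
      ((ENNReal.le_tsum t).trans (tsum_cubeDecay_le d)).trans_lt hK.lt_top |>.ne
    have hm := fun w => measurable_cutoff J w hu
    have h1 : 𝒩 (cutoff J v fun k => cv (N + (d + 2)) k (u k)) ≤
        ∑' w, ((2 * d + 3 : ℕ) : ℝ≥0∞) ^ (d + 2) * cubeDecay (v - w) *
          (C * ((cubeWeight d J τ)⁻¹ * LPDomain.localized τ 𝒩 u)) := by
      refine (h𝒩.mono_ae _ _ fun k => Eventually.of_forall (cutoff_cv_le N J v hu k)).trans ?_
      refine (h𝒩.tsum_le (ι := Fin (d + 1) → ℤ) (fun w k x =>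
        ((2 * d + 3 : ℕ) : ℝ≥0∞) ^ (d + 2) * cubeDecay (v - w) * cv N k (cutoff J w u k) x)
        fun w k => (measurable_cv N k (hm w k)).const_mul _).trans ?_
      refine ENNReal.tsum_le_tsum fun w => ?_
      have := hdec (v - w)
      refine (h𝒩.smul_le _ (fun k => cv N k (cutoff J w u k)) (by finiteness)).trans ?_
      refine mul_le_mul_right ((hconv _ (hm w)).trans (mul_le_mul_right ?_ _)) _
      exact le_inv_mul_localized τ 𝒩 u J w
    have hc0 := (cubeWeight_pos d J τ).ne'
    have hct := cubeWeight_ne_top d J τ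
    have h2 : ∑' w, cubeDecay (d := d) (v - w) ≤ cvConst d := by
      refine le_trans (le_of_eq ?_) (tsum_cubeDecay_le d)
      exact (Equiv.subLeft v).tsum_eq (cubeDecay (d := d))
    refine (mul_le_mul_right h1 _).trans ?_
    rw [ENNReal.tsum_mul_right, ENNReal.tsum_mul_left]
    set X := LPDomain.localized τ 𝒩 u
    calc _ = ((2 * d + 3 : ℕ) : ℝ≥0∞) ^ (d + 2) * (∑' w, cubeDecay (d := d) (v - w)) * C * X *
          (cubeWeight d J τ * (cubeWeight d J τ)⁻¹) := by ring
      _ ≤ ((2 * d + 3 : ℕ) : ℝ≥0∞) ^ (d + 2) * cvConst d * C * X * 1 := by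
          rw [ENNReal.mul_inv_cancel hc0 hct]
          gcongr
      _ = _ := by ring
  · obtain ⟨A, hA⟩ := h𝒩.shift_le
    obtain ⟨B, hB⟩ := exists_nat_ge (((d : ℝ) + 1) * τ)
    refine ⟨A + B, fun m u => iSup_le fun J => iSup_le fun v => ?_⟩
    -- for `m < 0` pass to the ancestor of the cube that is `|m|` generations older
    obtain ⟨l, J', v', hl, hJ', hsub, hJm⟩ : ∃ (l : ℕ) (J' : ℤ) (v' : Fin (d + 1) → ℤ),
        l ≤ m.natAbs ∧ J' = J - l ∧ (dyadicCube J v : Set (Rn d)) ⊆ dyadicCube J' v' ∧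
          J' ≤ J + m := by
      rcases le_total 0 m with hm | hm
      · exact ⟨0, J, v, by omega, by omega, subset_rfl, by omega⟩
      · exact ⟨m.natAbs, J - m.natAbs, _, le_rfl, rfl, dyadicCube_subset J _ v, by omega⟩
    have h1 : 𝒩 (cutoff J v (shift m u)) ≤ 𝒩 (shift m (cutoff J' v' u)) := by
      refine h𝒩.mono_ae _ _ fun k => Eventually.of_forall fun x => ?_
      unfold cutoff shift
      by_cases a : max 0 J ≤ (k : ℤ)
      swap
      · rw [if_neg a]
        exact zero_le
      rw [if_pos a]
      by_cases hx : x ∈ dyadicCube J v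
      swap
      · rw [Set.indicator_of_notMem hx]
        exact zero_le
      rw [Set.indicator_of_mem hx]
      by_cases b : 0 ≤ (k : ℤ) + m
      · have c : max 0 J' ≤ (((k : ℤ) + m).toNat : ℤ) := by
          rw [Int.toNat_of_nonneg b]
          omega
        simp only [if_pos b, if_pos c, Set.indicator_of_mem (hsub hx)]
        exact le_rfl
      · simp only [if_neg b]
        exact le_rfl
    calc cubeWeight d J τ * 𝒩 (cutoff J v (shift m u))
        ≤ (2 ^ (B * l) * cubeWeight d J' τ) * (2 ^ (A * m.natAbs) * 𝒩 (cutoff J' v' u)) := by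
          rw [hJ'] at h1 ⊢
          exact mul_le_mul' (cubeWeight_le_of_le hB J l) (h1.trans (hA m _))
      _ = 2 ^ (B * l) * 2 ^ (A * m.natAbs) * (cubeWeight d J' τ * 𝒩 (cutoff J' v' u)) := by ring
      _ ≤ 2 ^ ((A + B) * m.natAbs) * LPDomain.localized τ 𝒩 u := by
          refine mul_le_mul' ?_ (le_localized τ 𝒩 u J' v')
          rw [← pow_add]
          refine pow_le_pow_right₀ one_le_two ?_
          nlinarith

/-! ### Self-improvement of reproducing inequalities -/

/-- The decay factor between scale `2^{-j}` and scale `2^{-k}` at the displacement `y`. -/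
def wt {d : ℕ} (j k : ℕ) (y : Rn d) : ℝ≥0∞ :=
  (2 ^ ((k : ℤ) - j).natAbs * (1 + 2 ^ k * ‖y‖ₑ))⁻¹

/-- The integral over all scales and positions, `∑_k 2^{kn} ∫ f_k`. -/
def scaleInt {d : ℕ} (f : ℕ → Rn d → ℝ≥0∞) : ℝ≥0∞ :=
  ∑' k, ∫⁻ z, 2 ^ (k * (d + 1)) * f k z

theorem scaleInt_mono {d : ℕ} {f g : ℕ → Rn d → ℝ≥0∞} (h : ∀ k z, f k z ≤ g k z) :
    scaleInt f ≤ scaleInt g :=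
  ENNReal.tsum_le_tsum fun k => lintegral_mono fun z => mul_le_mul_right (h k z) _

theorem scaleInt_const_mul {d : ℕ} {c : ℝ≥0∞} (hc : c ≠ ∞) (f : ℕ → Rn d → ℝ≥0∞) :
    scaleInt (fun k z => c * f k z) = c * scaleInt f := by
  unfold scaleInt
  rw [← ENNReal.tsum_mul_left]
  congr 1 with k
  rw [← lintegral_const_mul' _ _ hc]
  congr 1 with z
  ring

theorem wt_le_one {d : ℕ} (j k : ℕ) (y : Rn d) : wt j k y ≤ 1 := by
  unfold wt
  rw [ENNReal.inv_le_one]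
  calc (1 : ℝ≥0∞) = 1 * 1 := (one_mul 1).symm
    _ ≤ _ := mul_le_mul' (one_le_pow₀ one_le_two) le_self_add

theorem wt_ne_top {d : ℕ} (j k : ℕ) (y : Rn d) : wt j k y ≠ ∞ :=
  ((wt_le_one j k y).trans_lt ENNReal.one_lt_top).ne

theorem two_pow_natAbs_mul_le (k l : ℕ) {t : ℝ≥0∞} :
    1 + 2 ^ l * t ≤ 2 ^ ((l : ℤ) - k).natAbs * (1 + 2 ^ k * t) := by
  rw [mul_add, mul_one, ← mul_assoc, ← pow_add]
  gcongr
  · exact one_le_pow₀ one_le_two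
  · exact one_le_two
  · omega

/-- Submultiplicativity of the decay factors. The second one is squared, because `1 + 2^k |x - y|`
has to be compared with `1 + 2^l |x - y|`. -/
theorem wt_mul_sq_le {d : ℕ} (j k l : ℕ) (x y z : Rn d) :
    wt j k (x - y) * wt k l (y - z) ^ 2 ≤ wt j l (x - z) := by
  unfold wt
  rw [← ENNReal.inv_pow, ← ENNReal.mul_inv (by left; simp) (by left; finiteness),
    ENNReal.inv_le_inv]
  have h1 : 1 + 2 ^ l * ‖x - z‖ₑ ≤ (1 + 2 ^ l * ‖x - y‖ₑ) * (1 + 2 ^ l * ‖y - z‖ₑ) := by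
    have : ‖x - z‖ₑ ≤ ‖x - y‖ₑ + ‖y - z‖ₑ := by
      simpa using enorm_add_le (x - y) (y - z)
    calc 1 + 2 ^ l * ‖x - z‖ₑ ≤ 1 + 2 ^ l * (‖x - y‖ₑ + ‖y - z‖ₑ) := by gcongr
      _ ≤ 1 + 2 ^ l * (‖x - y‖ₑ + ‖y - z‖ₑ) + 2 ^ l * ‖x - y‖ₑ * (2 ^ l * ‖y - z‖ₑ) := le_self_add
      _ = _ := by ring
  have h2 : (2 : ℝ≥0∞) ^ ((l : ℤ) - j).natAbs ≤
      2 ^ ((k : ℤ) - j).natAbs * 2 ^ ((l : ℤ) - k).natAbs := by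
    rw [← pow_add]
    exact pow_le_pow_right₀ one_le_two (by omega)
  calc 2 ^ ((l : ℤ) - j).natAbs * (1 + 2 ^ l * ‖x - z‖ₑ)
      ≤ (2 ^ ((k : ℤ) - j).natAbs * 2 ^ ((l : ℤ) - k).natAbs) *
        ((2 ^ ((l : ℤ) - k).natAbs * (1 + 2 ^ k * ‖x - y‖ₑ)) * (1 + 2 ^ l * ‖y - z‖ₑ)) := by
        gcongr
        exact h1.trans (mul_le_mul_left (two_pow_natAbs_mul_le k l) _)
    _ ≤ (2 ^ ((k : ℤ) - j).natAbs * 2 ^ ((l : ℤ) - k).natAbs) *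
        ((2 ^ ((l : ℤ) - k).natAbs * (1 + 2 ^ k * ‖x - y‖ₑ)) * (1 + 2 ^ l * ‖y - z‖ₑ)) *
          (1 + 2 ^ l * ‖y - z‖ₑ) := le_mul_of_one_le_right' le_self_add
    _ = _ := by ring

/-- If `γ^{m+1}` is reproduced, up to a constant, by averages with arbitrarily fast decay, then the
powers may be taken outside of the averages, as follows. Denote by `S` the supremum of
`γ_k(z) w^N`, by `I` the average of `γ^{m+1}` and by `R` that of `γ`. Then `I ≤ S^m R` is trivial,
the hypothesis implies `S^{m+1} ≤ K I`, and `S ≤ K R` follows if `S` is finite. By temperedness, `S`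
is finite for large `N`, and the estimate for large `N` shows that it is finite for all `N`. -/
theorem scaleInt_pow_le {d : ℕ} {m : ℕ} {K : ℕ → ℝ≥0∞} (hK : ∀ N, K N ≠ ∞)
    (hK1 : ∀ N, 1 ≤ K N) {γ : ℕ → Rn d → ℝ≥0∞}
    (hγ : ∀ N j x, γ j x ^ (m + 1) ≤
      K N * scaleInt fun k z => γ k z ^ (m + 1) * wt j k (x - z) ^ N)
    (hfin : ∃ M, ∀ j x, ∃ B, B ≠ ∞ ∧ ∀ k z, γ k z * wt j k (x - z) ^ M ≤ B) (N j : ℕ) (x : Rn d) :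
    (scaleInt fun k z => γ k z ^ (m + 1) * wt j k (x - z) ^ ((m + 1) * N)) ≤
      K (2 * ((m + 1) * N)) ^ m * (scaleInt fun k z => γ k z * wt j k (x - z) ^ N) ^ (m + 1) := by
  -- the estimate under the a priori assumption that the supremum is finite
  have main : ∀ N j x, (∃ B, B ≠ ∞ ∧ ∀ k z, γ k z * wt j k (x - z) ^ N ≤ B) →
      (scaleInt fun k z => γ k z ^ (m + 1) * wt j k (x - z) ^ ((m + 1) * N)) ≤
      K (2 * ((m + 1) * N)) ^ m *
        (scaleInt fun k z => γ k z * wt j k (x - z) ^ N) ^ (m + 1) := by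
    rintro N j x ⟨B, hB, hBle⟩
    set I := scaleInt fun k z => γ k z ^ (m + 1) * wt j k (x - z) ^ ((m + 1) * N)
    set R := scaleInt fun k z => γ k z * wt j k (x - z) ^ N
    set S := ⨆ (k : ℕ) (z : Rn d), γ k z * wt j k (x - z) ^ N with hS
    have hle : ∀ k z, γ k z * wt j k (x - z) ^ N ≤ S := fun k z =>
      le_iSup₂ (f := fun (k : ℕ) (z : Rn d) => γ k z * wt j k (x - z) ^ N) k z
    have hSfin : S ≠ ∞ := ((iSup₂_le hBle).trans_lt hB.lt_top).ne
    have h1 : I ≤ S ^ m * R := by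
      rw [← scaleInt_const_mul (by finiteness)]
      refine scaleInt_mono fun k z => ?_
      rw [mul_comm (m + 1) N, pow_mul, ← mul_pow, pow_succ]
      exact mul_le_mul_left (pow_le_pow_left' (hle k z) m) _
    have h2 : S ^ (m + 1) ≤ K (2 * ((m + 1) * N)) * I := by
      have : ∀ k z, (γ k z * wt j k (x - z) ^ N) ^ (m + 1) ≤ K (2 * ((m + 1) * N)) * I := by
        intro k z
        have hw : wt j k (x - z) ^ ((m + 1) * N) ≠ ∞ := ENNReal.pow_ne_top (wt_ne_top _ _ _)
        calc (γ k z * wt j k (x - z) ^ N) ^ (m + 1)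
            = γ k z ^ (m + 1) * wt j k (x - z) ^ ((m + 1) * N) := by
              rw [mul_pow, ← pow_mul, mul_comm N]
          _ ≤ _ := mul_le_mul_left (hγ (2 * ((m + 1) * N)) k z) _
          _ = K (2 * ((m + 1) * N)) * (wt j k (x - z) ^ ((m + 1) * N) * scaleInt fun l y =>
                γ l y ^ (m + 1) * wt k l (z - y) ^ (2 * ((m + 1) * N))) := by ring
          _ ≤ _ := by
              rw [← scaleInt_const_mul hw]
              refine mul_le_mul_right (scaleInt_mono fun l y => ?_) _
              calc _ = γ l y ^ (m + 1) *
                    (wt j k (x - z) * wt k l (z - y) ^ 2) ^ ((m + 1) * N) := by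
                    rw [mul_pow, ← pow_mul]; ring
                _ ≤ _ := mul_le_mul_right (pow_le_pow_left' (wt_mul_sq_le j k l x z y) _) _
      rw [hS, ENNReal.iSup_pow]
      refine iSup_le fun k => ?_
      rw [ENNReal.iSup_pow]
      exact iSup_le (this k)
    rcases eq_or_ne S 0 with h0 | h0
    · have : I = 0 := by
        have h3 : ∀ k z, γ k z ^ (m + 1) * wt j k (x - z) ^ ((m + 1) * N) ≤ 0 * 0 := by
          intro k z
          have := hle k z
          rw [h0, nonpos_iff_eq_zero] at this
          rw [mul_comm (m + 1) N, pow_mul, ← mul_pow, this]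
          simp
        have h4 := scaleInt_mono h3
        rw [scaleInt_const_mul (by simp) (fun _ _ => 0), zero_mul] at h4
        exact le_antisymm h4 zero_le
      rw [this]
      exact zero_le
    · have h3 : S ≤ K (2 * ((m + 1) * N)) * R := by
        have h4 : S ^ m * S ≤ S ^ m * (K (2 * ((m + 1) * N)) * R) := by
          rw [← pow_succ]
          refine h2.trans ((mul_le_mul_right h1 _).trans (le_of_eq ?_))
          ring
        rwa [ENNReal.mul_le_mul_iff_right (by positivity) (by finiteness)] at h4
      calc I ≤ S ^ m * R := h1
        _ ≤ (K (2 * ((m + 1) * N)) * R) ^ m * R := by gcongr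
        _ = _ := by ring
  by_cases hR : (scaleInt fun k z => γ k z * wt j k (x - z) ^ N) = ∞
  · have : K (2 * ((m + 1) * N)) ^ m ≠ 0 := by
      have := one_le_pow₀ (n := m) (hK1 (2 * ((m + 1) * N)))
      exact (zero_lt_one.trans_le this).ne'
    rw [hR, ENNReal.top_pow (by omega), ENNReal.mul_top this]
    exact le_top
  · -- the supremum is finite: use the a priori estimate for a faster decay
    obtain ⟨M, hM⟩ := hfin
    set N' := max M (2 * N)
    -- the supremum over `c` is the `(m + 1)`-st root of the bound for `(γ_k(z) w^N)^{m+1}`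
    refine main N j x ⟨(⨆ c : {c : ℝ≥0∞ // c ^ (m + 1) ≤ K ((m + 1) * N') *
      (K (2 * ((m + 1) * N')) ^ m *
      (scaleInt fun k z => γ k z * wt j k (x - z) ^ N) ^ (m + 1))}, (c : ℝ≥0∞)), ?_, ?_⟩
    · set B := K ((m + 1) * N') * (K (2 * ((m + 1) * N')) ^ m *
        (scaleInt fun k z => γ k z * wt j k (x - z) ^ N) ^ (m + 1))
      have hB : B ≠ ∞ :=
        ENNReal.mul_ne_top (hK _) (ENNReal.mul_ne_top (ENNReal.pow_ne_top (hK _))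
          (ENNReal.pow_ne_top hR))
      refine ((iSup_le fun c => ?_).trans_lt (show B + 1 < ∞ by finiteness)).ne
      rcases le_total c.1 1 with h | h
      · exact h.trans le_add_self
      · exact (le_self_pow₀ h (by omega)).trans (c.2.trans le_self_add)
    · intro k z
      refine le_iSup_of_le (f := fun c : {c : ℝ≥0∞ // c ^ (m + 1) ≤ _} => (c : ℝ≥0∞))
        ⟨_, ?_⟩ le_rfl
      have h1 : γ k z ^ (m + 1) ≤ K ((m + 1) * N') * (K (2 * ((m + 1) * N')) ^ m *
          (scaleInt fun l y => γ l y * wt k l (z - y) ^ N') ^ (m + 1)) := by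
        refine (hγ _ k z).trans (mul_le_mul_right (main N' k z ?_) _)
        obtain ⟨B, hB, hBle⟩ := hM k z
        refine ⟨B, hB, fun l y => (mul_le_mul_right ?_ _).trans (hBle l y)⟩
        exact pow_le_pow_right_of_le_one' (wt_le_one _ _ _) (le_max_left _ _)
      have h2 : wt j k (x - z) ^ N * (scaleInt fun l y => γ l y * wt k l (z - y) ^ N') ≤
          scaleInt fun k z => γ k z * wt j k (x - z) ^ N := by
        rw [← scaleInt_const_mul (ENNReal.pow_ne_top (wt_ne_top _ _ _))]
        refine scaleInt_mono fun l y => ?_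
        calc _ ≤ wt j k (x - z) ^ N * (γ l y * wt k l (z - y) ^ (2 * N)) := by
              refine mul_le_mul_right (mul_le_mul_right ?_ _) _
              exact pow_le_pow_right_of_le_one' (wt_le_one _ _ _) (le_max_right _ _)
          _ = γ l y * (wt j k (x - z) * wt k l (z - y) ^ 2) ^ N := by
              rw [mul_pow, ← pow_mul]; ring
          _ ≤ _ := mul_le_mul_right (pow_le_pow_left' (wt_mul_sq_le j k l x z y) _) _
      calc (γ k z * wt j k (x - z) ^ N) ^ (m + 1)
          = γ k z ^ (m + 1) * (wt j k (x - z) ^ N) ^ (m + 1) := mul_pow _ _ _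
        _ ≤ _ := mul_le_mul_left h1 _
        _ = K ((m + 1) * N') * (K (2 * ((m + 1) * N')) ^ m * (wt j k (x - z) ^ N *
              (scaleInt fun l y => γ l y * wt k l (z - y) ^ N')) ^ (m + 1)) := by ring
        _ ≤ _ := by gcongr

/-- The averages are almost diagonal families of convolution operators. -/
theorem scaleInt_wt_eq {d : ℕ} (γ : ℕ → Rn d → ℝ≥0∞) (N j : ℕ) (x : Rn d) :
    (scaleInt fun k z => γ k z * wt j k (x - z) ^ N) =
      ∑' k : ℕ, 2⁻¹ ^ (N * ((k : ℤ) - j).natAbs) * cv N k (γ k) x := by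
  unfold scaleInt cv
  congr 1 with k
  rw [← lintegral_const_mul' _ _ (by finiteness)]
  congr 1 with z
  simp only [wt, ker]
  rw [ENNReal.mul_inv (by left; simp) (by left; finiteness), mul_pow, ENNReal.inv_pow, ← pow_mul,
    mul_comm N]
  ring

/-! ### Quasi-norms with a convexification -/

/-- The quasi-norms `X` that have a convexification in the class `ConvNorm`: for some `m`,
`X(w^{m+1})` is the `(m + 1)`-st power of such a norm of `w`. -/
def PowNorm {d : ℕ} (X : (ℕ → Rn d → ℝ≥0∞) → ℝ≥0∞) : Prop :=
  ∃ (m : ℕ) (𝒩 : (ℕ → Rn d → ℝ≥0∞) → ℝ≥0∞), ConvNorm 𝒩 ∧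
    ∀ w : ℕ → Rn d → ℝ≥0∞, X (fun k x => w k x ^ (m + 1)) = 𝒩 w ^ (m + 1)

/-- `ℓ^q L^p_τ` for functions with values in `[0, ∞]`. -/
def lqLpE {d : ℕ} (p q : ℝ≥0∞) (τ : ℝ) (w : ℕ → Rn d → ℝ≥0∞) : ℝ≥0∞ :=
  ⨆ (J : ℤ) (v : Fin (d + 1) → ℤ), cubeWeight d J τ *
    lqNorm q (fun j : Tail J => eLpNorm (w j) p (volume.restrict (dyadicCube J v)))

/-- `L^p_τ ℓ^q` for functions with values in `[0, ∞]`. -/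
def LplqE {d : ℕ} (p q : ℝ≥0∞) (τ : ℝ) (w : ℕ → Rn d → ℝ≥0∞) : ℝ≥0∞ :=
  ⨆ (J : ℤ) (v : Fin (d + 1) → ℤ), cubeWeight d J τ *
    eLpNorm (fun x => lqNorm q (fun j : Tail J => w j x)) p (volume.restrict (dyadicCube J v))

theorem lqLpE_eq_localized {d : ℕ} {p q : ℝ≥0∞} (hq : q ≠ 0) (τ : ℝ)
    (w : ℕ → Rn d → ℝ≥0∞) : lqLpE p q τ w = localized τ (baseB p q) w := by
  unfold lqLpE localized baseB
  congr 1 with J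
  congr 1 with v
  congr 1
  rw [lqNorm_subtype hq (fun j : ℕ => max 0 J ≤ (j : ℤ))
    (fun j => eLpNorm (w j) p (volume.restrict (dyadicCube J v)))]
  congr 1 with j
  unfold cutoff
  split_ifs
  · rw [eLpNorm_indicator_eq_eLpNorm_restrict (measurableSet_dyadicCube J v)]
  · exact eLpNorm_zero.symm

theorem LplqE_eq_localized {d : ℕ} {p q : ℝ≥0∞} (hq : q ≠ 0) (τ : ℝ)
    (w : ℕ → Rn d → ℝ≥0∞) : LplqE p q τ w = localized τ (baseF p q) w := by
  unfold LplqE localized baseF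
  congr 1 with J
  congr 1 with v
  congr 1
  rw [← eLpNorm_indicator_eq_eLpNorm_restrict (measurableSet_dyadicCube J v)]
  congr 1 with x
  by_cases hx : x ∈ dyadicCube J v
  · rw [Set.indicator_of_mem hx,
      lqNorm_subtype hq (fun j : ℕ => max 0 J ≤ (j : ℤ)) (fun j => w j x)]
    congr 1 with j
    unfold cutoff
    rw [Set.indicator_of_mem hx]
  · rw [Set.indicator_of_notMem hx]
    unfold cutoff
    simp only [Set.indicator_of_notMem hx, ite_self]
    exact (lqNorm_zero hq).symm

theorem cubeWeight_pow {d : ℕ} (J : ℤ) (τ : ℝ) {m : ℕ} (hm : m ≠ 0) :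
    cubeWeight d J τ = cubeWeight d J (τ / m) ^ m := by
  have : (m : ℝ) ≠ 0 := by exact_mod_cast hm
  unfold cubeWeight
  rw [← ENNReal.rpow_natCast, ← ENNReal.rpow_mul]
  congr 1
  field_simp

theorem iSup_pow_succ {ι : Sort*} (f : ι → ℝ≥0∞) (m : ℕ) :
    ⨆ i, f i ^ (m + 1) = (⨆ i, f i) ^ (m + 1) := by
  rcases isEmpty_or_nonempty ι with h | h
  · simp
  · exact (ENNReal.iSup_pow f _).symm

theorem lqLpE_pow {d : ℕ} {p q : ℝ≥0∞} (hp : p ≠ 0) (hq : q ≠ 0) (τ : ℝ) (m : ℕ)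
    (w : ℕ → Rn d → ℝ≥0∞) : lqLpE p q τ (fun k x => w k x ^ (m + 1)) =
      lqLpE ((m + 1 : ℕ) * p) ((m + 1 : ℕ) * q) (τ / (m + 1 : ℕ)) w ^ (m + 1) := by
  unfold lqLpE
  rw [← iSup_pow_succ]
  congr 1 with J
  rw [← iSup_pow_succ]
  congr 1 with v
  rw [mul_pow, cubeWeight_pow J τ (Nat.succ_ne_zero m), ← lqNorm_pow hq (Nat.succ_ne_zero m)]
  congr 1
  congr 1 with j
  exact eLpNorm_pow hp (Nat.succ_ne_zero m) _

theorem LplqE_pow {d : ℕ} {p q : ℝ≥0∞} (hp : p ≠ 0) (hq : q ≠ 0) (τ : ℝ) (m : ℕ)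
    (w : ℕ → Rn d → ℝ≥0∞) : LplqE p q τ (fun k x => w k x ^ (m + 1)) =
      LplqE ((m + 1 : ℕ) * p) ((m + 1 : ℕ) * q) (τ / (m + 1 : ℕ)) w ^ (m + 1) := by
  unfold LplqE
  rw [← iSup_pow_succ]
  congr 1 with J
  rw [← iSup_pow_succ]
  congr 1 with v
  rw [mul_pow, cubeWeight_pow J τ (Nat.succ_ne_zero m), ← eLpNorm_pow hp (Nat.succ_ne_zero m)]
  congr 1
  congr 1 with x
  exact lqNorm_pow hq (Nat.succ_ne_zero m) _

theorem baseN_pow {d : ℕ} {p q : ℝ≥0∞} (hp : p ≠ 0) (hq : q ≠ 0) (τ : ℝ) (m : ℕ)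
    (w : ℕ → Rn d → ℝ≥0∞) : baseN p q τ (fun k x => w k x ^ (m + 1)) =
      baseN ((m + 1 : ℕ) * p) ((m + 1 : ℕ) * q) (τ / (m + 1 : ℕ)) w ^ (m + 1) := by
  unfold baseN
  rw [← lqNorm_pow hq (Nat.succ_ne_zero m)]
  congr 1 with j
  unfold morrey
  rw [← iSup_pow_succ]
  congr 1 with J
  rw [← iSup_pow_succ]
  congr 1 with v
  rw [mul_pow, cubeWeight_pow J τ (Nat.succ_ne_zero m), eLpNorm_pow hp (Nat.succ_ne_zero m)]

theorem exists_nat_one_lt_mul {p q : ℝ≥0∞} (hp : p ≠ 0) (hq : q ≠ 0) :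
    ∃ m : ℕ, 1 < ((m + 1 : ℕ) : ℝ≥0∞) * p ∧ 1 < ((m + 1 : ℕ) : ℝ≥0∞) * q := by
  obtain ⟨a, ha⟩ := ENNReal.exists_nat_mul_gt hp ENNReal.one_ne_top
  obtain ⟨b, hb⟩ := ENNReal.exists_nat_mul_gt hq ENNReal.one_ne_top
  refine ⟨max a b, ha.trans_le ?_, hb.trans_le ?_⟩ <;> refine mul_le_mul_left ?_ _
  · exact_mod_cast (le_max_left a b).trans (Nat.le_succ _)
  · exact_mod_cast (le_max_right a b).trans (Nat.le_succ _)

theorem PowNorm.lqLpE {d : ℕ} {p q : ℝ≥0∞} (hp : p ≠ 0) (hq : q ≠ 0) (τ : ℝ) :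
    PowNorm (lqLpE (d := d) p q τ) := by
  obtain ⟨m, h1, h2⟩ := exists_nat_one_lt_mul hp hq
  refine ⟨m, _, (ConvNorm.baseB h1.le h2.le).localized (τ / (m + 1 : ℕ)), fun w => ?_⟩
  rw [lqLpE_pow hp hq, lqLpE_eq_localized (zero_lt_one.trans h2).ne']

theorem PowNorm.LplqE {d : ℕ} {p q : ℝ≥0∞} (hp : p ≠ 0) (hp' : p ≠ ∞) (hq : q ≠ 0) (τ : ℝ) :
    PowNorm (LplqE (d := d) p q τ) := by
  obtain ⟨m, h1, h2⟩ := exists_nat_one_lt_mul hp hq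
  refine ⟨m, _, (ConvNorm.baseF h1 (ENNReal.mul_ne_top (by simp) hp') h2).localized
    (τ / (m + 1 : ℕ)), fun w => ?_⟩
  rw [LplqE_pow hp hq, LplqE_eq_localized (zero_lt_one.trans h2).ne']

theorem PowNorm.baseN {d : ℕ} {p q : ℝ≥0∞} (hp : p ≠ 0) (hq : q ≠ 0) (τ : ℝ) :
    PowNorm (baseN (d := d) p q τ) := by
  obtain ⟨m, h1, h2⟩ := exists_nat_one_lt_mul hp hq
  exact ⟨m, _, ConvNorm.baseN (τ / (m + 1 : ℕ)) h1.le h2.le, fun w => baseN_pow hp hq τ m w⟩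

/-- `2^{jσ}` grows at most exponentially in the difference of the indices. -/
theorem two_rpow_mul_le {σ : ℝ} {S : ℕ} (hS : |σ| ≤ S) (j k : ℕ) :
    (2 : ℝ≥0∞) ^ ((j : ℝ) * σ) * 2⁻¹ ^ (S * ((k : ℤ) - j).natAbs) ≤ 2 ^ ((k : ℝ) * σ) := by
  rw [← ENNReal.inv_pow, ← ENNReal.rpow_natCast, ← ENNReal.rpow_neg,
    ← ENNReal.rpow_add _ _ (by simp) (by simp)]
  refine ENNReal.rpow_le_rpow_of_exponent_le one_le_two ?_
  have h1 : (((k : ℤ) - j).natAbs : ℝ) = |(k : ℝ) - j| := by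
    rw [← Int.cast_natCast, Int.natCast_natAbs]
    push_cast
    rfl
  push_cast
  rw [h1]
  have h2 : ((j : ℝ) - k) * σ ≤ |(k : ℝ) - j| * |σ| := by
    rw [← abs_mul]
    refine (le_abs_self _).trans (le_of_eq ?_)
    rw [abs_mul, abs_mul, abs_sub_comm]
  nlinarith [mul_le_mul_of_nonneg_left hS (abs_nonneg ((k : ℝ) - j))]

/-- If `g` reproduces itself and `h` by averages with arbitrarily fast decay, then the quasi-norm of
`h` is bounded by that of `g`. After `scaleInt_pow_le`, which needs the qualitative temperedness of
`g`, the averages involve the `(m + 1)`-st root of `g`, to which `ConvNorm.exists_le` applies. The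
constant depends only on `X`, `s` and `K`. -/
theorem PowNorm.exists_le {d : ℕ} {X : (ℕ → Rn d → ℝ≥0∞) → ℝ≥0∞} (hX : PowNorm X) (s : ℝ)
    {K : ℕ → ℝ≥0∞} (hK : ∀ N, K N ≠ ∞) (hK1 : ∀ N, 1 ≤ K N) :
    ∃ C : ℝ≥0∞, C ≠ ∞ ∧ ∀ g h : ℕ → Rn d → ℝ≥0∞, (∀ k, Measurable (g k)) →
      (∀ N j x, g j x ≤ K N * scaleInt fun k z => g k z * wt j k (x - z) ^ N) →
      (∃ M, ∀ j x, ∃ B, B ≠ ∞ ∧ ∀ k z, g k z * wt j k (x - z) ^ M ≤ B) →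
      (∀ N j x, h j x ≤ K N * scaleInt fun k z => g k z * wt j k (x - z) ^ N) →
      X (fun j x => 2 ^ ((j : ℝ) * s) * h j x) ≤ C * X (fun j x => 2 ^ ((j : ℝ) * s) * g j x) := by
  obtain ⟨m, 𝒩, h𝒩, hX⟩ := hX
  obtain ⟨N₀, C₀, hC₀, hmain⟩ := h𝒩.exists_le
  set σ := s / (m + 1 : ℕ) with hσ
  obtain ⟨S, hS⟩ := exists_nat_ge |σ|
  -- the additional decay of order `S` absorbs the weights `2^{jσ}`
  set N := N₀ + S
  set c := K ((m + 1) * N) * K (2 * ((m + 1) * N)) ^ m with hc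
  have hcfin : c ≠ ∞ := ENNReal.mul_ne_top (hK _) (ENNReal.pow_ne_top (hK _))
  have hc1 : 1 ≤ c := one_le_mul (hK1 _) (one_le_pow₀ (hK1 _))
  refine ⟨(c * C₀) ^ (m + 1), by finiteness, fun g h hg hgg hfin hh => ?_⟩
  have hroot : ∀ t : ℝ≥0∞, (t ^ (1 / ((m + 1 : ℕ) : ℝ))) ^ (m + 1) = t := by
    intro t
    rw [← ENNReal.rpow_natCast, ← ENNReal.rpow_mul, one_div_mul_cancel (by positivity),
      ENNReal.rpow_one]
  obtain ⟨γ, hγ⟩ : ∃ γ : ℕ → Rn d → ℝ≥0∞,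
      γ = fun k x => g k x ^ (1 / ((m + 1 : ℕ) : ℝ)) := ⟨_, rfl⟩
  obtain ⟨η, hη⟩ : ∃ γ : ℕ → Rn d → ℝ≥0∞,
      γ = fun k x => h k x ^ (1 / ((m + 1 : ℕ) : ℝ)) := ⟨_, rfl⟩
  have hγg : ∀ k x, γ k x ^ (m + 1) = g k x := fun k x => by rw [hγ]; exact hroot _
  have hηh : ∀ k x, η k x ^ (m + 1) = h k x := fun k x => by rw [hη]; exact hroot _
  have hγm : ∀ k, Measurable (γ k) := fun k => by rw [hγ]; exact (hg k).pow_const _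
  have hweight : ∀ j : ℕ, (2 : ℝ≥0∞) ^ ((j : ℝ) * s) = (2 ^ ((j : ℝ) * σ)) ^ (m + 1) := by
    intro j
    rw [← ENNReal.rpow_natCast, ← ENNReal.rpow_mul, hσ]
    congr 1
    field_simp
  have hfin' : ∃ M, ∀ j x, ∃ B, B ≠ ∞ ∧ ∀ k z, γ k z * wt j k (x - z) ^ M ≤ B := by
    obtain ⟨M, hM⟩ := hfin
    refine ⟨M, fun j x => ?_⟩
    obtain ⟨B, hB, hle⟩ := hM j x
    refine ⟨B + 1, by finiteness, fun k z => ?_⟩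
    rcases le_total (γ k z * wt j k (x - z) ^ M) 1 with h | h
    · exact h.trans le_add_self
    · calc _ ≤ (γ k z * wt j k (x - z) ^ M) ^ (m + 1) := le_self_pow₀ h (by omega)
        _ = g k z * (wt j k (x - z) ^ M) ^ (m + 1) := by rw [mul_pow, hγg]
        _ ≤ g k z * wt j k (x - z) ^ M := by
          refine mul_le_mul_right ?_ _
          have := pow_le_pow_right_of_le_one' (pow_le_one' (wt_le_one j k (x - z)) M)
            (show 1 ≤ m + 1 by omega)
          rwa [pow_one] at this
        _ ≤ _ := (hle k z).trans le_self_add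
  have hpeetre := scaleInt_pow_le hK hK1 (m := m) (γ := γ)
    (fun N j x => by simpa only [hγg] using hgg N j x) hfin'
  simp only [hγg] at hpeetre
  have hle : ∀ j x, η j x ≤ c * scaleInt fun k z => γ k z * wt j k (x - z) ^ N := by
    intro j x
    set R := scaleInt fun k z => γ k z * wt j k (x - z) ^ N
    have h1 : η j x ^ (m + 1) ≤ (c * R) ^ (m + 1) := by
      calc η j x ^ (m + 1) = h j x := hηh j x
        _ ≤ _ := hh ((m + 1) * N) j x
        _ ≤ _ := mul_le_mul_right (hpeetre N j x) _
        _ = c * R ^ (m + 1) := by rw [hc]; ring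
        _ ≤ c ^ (m + 1) * R ^ (m + 1) := mul_le_mul_left (le_self_pow₀ hc1 (by omega)) _
        _ = _ := (mul_pow _ _ _).symm
    exact (ENNReal.pow_right_strictMono (by omega : m + 1 ≠ 0)).le_iff_le.1 h1
  have hH : 𝒩 (fun j x => 2 ^ ((j : ℝ) * σ) * η j x) ≤
      c * (C₀ * 𝒩 fun k x => 2 ^ ((k : ℝ) * σ) * γ k x) := by
    have hm : ∀ k : ℕ, Measurable fun x => (2 : ℝ≥0∞) ^ ((k : ℝ) * σ) * γ k x := fun k =>
      (hγm k).const_mul _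
    refine le_trans ?_ ((h𝒩.smul_le c (fun j x => ∑' k : ℕ, 2⁻¹ ^ (N₀ * ((k : ℤ) - j).natAbs) *
      cv N₀ k (fun x => 2 ^ ((k : ℝ) * σ) * γ k x) x) hcfin).trans
      (mul_le_mul_right (hmain _ _ hm fun j x => le_rfl) _))
    refine h𝒩.mono_ae _ _ fun j => Eventually.of_forall fun x => ?_
    calc 2 ^ ((j : ℝ) * σ) * η j x
        ≤ 2 ^ ((j : ℝ) * σ) * (c * scaleInt fun k z => γ k z * wt j k (x - z) ^ N) :=
          mul_le_mul_right (hle j x) _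
      _ = c * ∑' k : ℕ, 2 ^ ((j : ℝ) * σ) * (2⁻¹ ^ (N * ((k : ℤ) - j).natAbs) *
            cv N k (γ k) x) := by rw [scaleInt_wt_eq, ENNReal.tsum_mul_left]; ring
      _ ≤ _ := by
          refine mul_le_mul_right (ENNReal.tsum_le_tsum fun k => ?_) _
          calc _ ≤ 2 ^ ((j : ℝ) * σ) * (2⁻¹ ^ (N * ((k : ℤ) - j).natAbs) * cv N₀ k (γ k) x) := by
                gcongr
                exact cv_anti (by omega) _ _ _
            _ = (2 ^ ((j : ℝ) * σ) * 2⁻¹ ^ (S * ((k : ℤ) - j).natAbs)) *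
                  (2⁻¹ ^ (N₀ * ((k : ℤ) - j).natAbs) * cv N₀ k (γ k) x) := by
                rw [add_mul, pow_add]; ring
            _ ≤ 2 ^ ((k : ℝ) * σ) * (2⁻¹ ^ (N₀ * ((k : ℤ) - j).natAbs) * cv N₀ k (γ k) x) :=
                mul_le_mul_left (two_rpow_mul_le hS j k) _
            _ = _ := by
                have : cv N₀ k (fun x => 2 ^ ((k : ℝ) * σ) * γ k x) x =
                    2 ^ ((k : ℝ) * σ) * cv N₀ k (γ k) x := by
                  unfold cv
                  rw [← lintegral_const_mul _ (by have := measurable_ker (d := d) N₀ k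
                                                  have := hγm k
                                                  fun_prop)]
                  congr 1 with z
                  ring
                rw [this]; ring
  have e1 : (fun (j : ℕ) x => (2 : ℝ≥0∞) ^ ((j : ℝ) * s) * h j x) =
      fun (j : ℕ) x => (2 ^ ((j : ℝ) * σ) * η j x) ^ (m + 1) := by
    funext j x
    rw [mul_pow, ← hweight, hηh]
  have e2 : (fun (j : ℕ) x => (2 : ℝ≥0∞) ^ ((j : ℝ) * s) * g j x) =
      fun (j : ℕ) x => (2 ^ ((j : ℝ) * σ) * γ j x) ^ (m + 1) := by
    funext j x
    rw [mul_pow, ← hweight, hγg]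
  rw [e1, e2, hX, hX, ← mul_pow, mul_assoc]
  exact pow_le_pow_left' hH _

/-! ### Dilations, reflections and convolutions of Schwartz functions -/

/-- The `L¹`-normalized dilation `x ↦ 2^{jn} a(2^j x)`. -/
def dil {d : ℕ} (j : ℤ) (a : 𝓢(Rn d, ℂ)) : 𝓢(Rn d, ℂ) :=
  (((2 : ℝ) ^ j) ^ (d + 1)) • SchwartzMap.compCLMOfContinuousLinearEquiv ℂ
    (ContinuousLinearEquiv.smulLeft (Units.mk0 ((2 : ℝ) ^ j) (by positivity))) a

theorem dil_apply {d : ℕ} (j : ℤ) (a : 𝓢(Rn d, ℂ)) (x : Rn d) :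
    dil j a x = (((2 : ℝ) ^ j) ^ (d + 1)) • a ((2 : ℝ) ^ j • x) := rfl

theorem dil_dil {d : ℕ} (j k : ℤ) (a : 𝓢(Rn d, ℂ)) : dil j (dil k a) = dil (j + k) a := by
  ext x
  simp only [dil_apply, smul_smul]
  rw [← mul_pow, ← zpow_add₀ two_ne_zero, ← zpow_add₀ two_ne_zero, add_comm k j]

theorem dil_zero {d : ℕ} (a : 𝓢(Rn d, ℂ)) : dil 0 a = a := by
  ext x
  simp [dil_apply]

theorem dil_sub {d : ℕ} (j : ℤ) (a b : 𝓢(Rn d, ℂ)) : dil j (a - b) = dil j a - dil j b := by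
  ext x
  simp [dil_apply, mul_sub]

theorem integral_dil_mul {d : ℕ} (j : ℤ) (a : 𝓢(Rn d, ℂ)) (g : Rn d → ℂ) :
    ∫ x, dil j a x * g x = ∫ x, a x * g ((2 : ℝ) ^ (-j) • x) := by
  have h := Measure.integral_comp_smul_of_nonneg (volume : Measure (Rn d))
    (fun x => a x * g ((2 : ℝ) ^ (-j) • x)) ((2 : ℝ) ^ j) (hR := by positivity)
  have e : ∀ x : Rn d, (2 : ℝ) ^ (-j) • (2 : ℝ) ^ j • x = x := by
    intro x
    rw [smul_smul, ← zpow_add₀ two_ne_zero]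
    simp
  simp only [e, finrank_euclideanSpace, Fintype.card_fin] at h
  have h2 : ∀ x, dil j a x * g x = (((2 : ℝ) ^ j) ^ (d + 1)) • (a ((2 : ℝ) ^ j • x) * g x) := by
    intro x
    rw [dil_apply, smul_mul_assoc]
  simp only [h2]
  rw [integral_smul, h, smul_smul, mul_inv_cancel₀ (by positivity), one_smul]

/-- The reflection `x ↦ a(-x)`. -/
def refl {d : ℕ} (a : 𝓢(Rn d, ℂ)) : 𝓢(Rn d, ℂ) :=
  SchwartzMap.compCLMOfContinuousLinearEquiv ℂ (ContinuousLinearEquiv.neg ℝ) a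

theorem refl_apply {d : ℕ} (a : 𝓢(Rn d, ℂ)) (x : Rn d) : refl a x = a (-x) := rfl

/-- The convolution of two Schwartz functions. -/
def sconv {d : ℕ} (a b : 𝓢(Rn d, ℂ)) : 𝓢(Rn d, ℂ) :=
  SchwartzMap.convolution (ContinuousLinearMap.mul ℂ ℂ) a b

theorem sconv_apply {d : ℕ} (a b : 𝓢(Rn d, ℂ)) (x : Rn d) :
    sconv a b x = ∫ t, a t * b (x - t) := by
  rw [sconv, SchwartzMap.convolution_apply]
  rfl

theorem fourier_sconv {d : ℕ} (a b : 𝓢(Rn d, ℂ)) (ξ : Rn d) :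
    𝓕 (sconv a b) ξ = 𝓕 a ξ * 𝓕 b ξ := by
  rw [sconv, SchwartzMap.fourier_convolution, SchwartzMap.pairing_apply_apply]
  rfl

theorem fourier_apply {d : ℕ} (a : 𝓢(Rn d, ℂ)) (ξ : Rn d) :
    𝓕 a ξ = ∫ x, a x * Complex.exp (-(2 * Real.pi * inner ℝ x ξ : ℝ) * Complex.I) := by
  rw [SchwartzMap.fourier_coe, Real.fourier_eq]
  congr 1 with x
  rw [Circle.smul_def, Real.fourierChar_apply, smul_eq_mul, mul_comm]
  push_cast
  ring_nf

theorem fourier_dil {d : ℕ} (j : ℤ) (a : 𝓢(Rn d, ℂ)) (ξ : Rn d) :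
    𝓕 (dil j a) ξ = 𝓕 a ((2 : ℝ) ^ (-j) • ξ) := by
  rw [fourier_apply, fourier_apply, integral_dil_mul]
  simp [inner_smul_left, inner_smul_right]

theorem fourier_refl {d : ℕ} (a : 𝓢(Rn d, ℂ)) (ξ : Rn d) : 𝓕 (refl a) ξ = 𝓕 a (-ξ) := by
  rw [fourier_apply, fourier_apply, ← integral_neg_eq_self]
  simp [refl_apply]

theorem fourier_zero {d : ℕ} (a : 𝓢(Rn d, ℂ)) : 𝓕 a 0 = ∫ x, a x := by
  rw [fourier_apply]
  simp

theorem ext_of_fourier {d : ℕ} {a b : 𝓢(Rn d, ℂ)} (h : ∀ ξ, 𝓕 a ξ = 𝓕 b ξ) : a = b := by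
  have h1 : 𝓕 a = 𝓕 b := SchwartzMap.ext h
  have h2 := congrArg (fun u : 𝓢(Rn d, ℂ) => 𝓕⁻ u) h1
  simpa using h2

theorem fourier_add_apply {d : ℕ} (a b : 𝓢(Rn d, ℂ)) (ξ : Rn d) :
    𝓕 (a + b) ξ = 𝓕 a ξ + 𝓕 b ξ := by
  rw [FourierTransform.fourier_add]; rfl

theorem fourier_sub_apply {d : ℕ} (a b : 𝓢(Rn d, ℂ)) (ξ : Rn d) :
    𝓕 (a - b) ξ = 𝓕 a ξ - 𝓕 b ξ := by
  rw [sub_eq_add_neg, FourierTransform.fourier_add, FourierTransform.fourier_neg]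
  exact (sub_eq_add_neg _ _).symm

theorem fourier_smul_apply {d : ℕ} (c : ℂ) (a : 𝓢(Rn d, ℂ)) (ξ : Rn d) :
    𝓕 (c • a) ξ = c * 𝓕 a ξ := by
  rw [FourierTransform.fourier_smul]; rfl

/-! ### Vanishing moments

The moments of a Schwartz function are, up to constants, the derivatives of its Fourier transform at
the origin. Vanishing of all moments is expressed in terms of the latter. -/

/-- The smooth function `g` vanishes to infinite order at the origin. -/
def FlatAtZero {d : ℕ} (g : Rn d → ℂ) : Prop :=
  ContDiff ℝ (⊤ : ℕ∞) g ∧ ∀ n : ℕ, iteratedFDeriv ℝ n g 0 = 0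

/-- All moments of `a` vanish. -/
def Flat {d : ℕ} (a : 𝓢(Rn d, ℂ)) : Prop := FlatAtZero (𝓕 a : 𝓢(Rn d, ℂ))

/-- The moments of `a` are those of `δ₀`. -/
def DeltaLike {d : ℕ} (a : 𝓢(Rn d, ℂ)) : Prop := FlatAtZero fun ξ => 𝓕 a ξ - 1

theorem FlatAtZero.add {d : ℕ} {f g : Rn d → ℂ} (hf : FlatAtZero f) (hg : FlatAtZero g) :
    FlatAtZero fun x => f x + g x := by
  refine ⟨hf.1.add hg.1, fun n => ?_⟩
  have hn : ((n : ℕ∞) : WithTop ℕ∞) ≤ ((⊤ : ℕ∞) : WithTop ℕ∞) := by exact_mod_cast le_top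
  have := iteratedFDeriv_add_apply (i := n) (hf.1.of_le hn).contDiffAt
    (hg.1.of_le hn).contDiffAt (x := (0 : Rn d))
  rw [hf.2, hg.2, add_zero] at this
  exact this

theorem FlatAtZero.mul {d : ℕ} {f g : Rn d → ℂ} (hf : FlatAtZero f)
    (hg : ContDiff ℝ (⊤ : ℕ∞) g) : FlatAtZero fun x => f x * g x := by
  refine ⟨hf.1.mul hg, fun n => ?_⟩
  rw [← norm_le_zero_iff]
  refine (norm_iteratedFDeriv_mul_le hf.1 hg 0 (n := n) (by exact_mod_cast le_top)).trans ?_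
  refine le_of_eq (Finset.sum_eq_zero fun i _ => ?_)
  rw [hf.2]
  simp

theorem FlatAtZero.comp_smul {d : ℕ} {f : Rn d → ℂ} (hf : FlatAtZero f) (c : ℝ) :
    FlatAtZero fun x => f (c • x) := by
  refine ⟨hf.1.comp (contDiff_const_smul c), fun n => ?_⟩
  have hn : ((n : ℕ∞) : WithTop ℕ∞) ≤ ((⊤ : ℕ∞) : WithTop ℕ∞) := by exact_mod_cast le_top
  have := congrFun (iteratedFDeriv_comp_const_smul (i := n) c (hf.1.of_le hn)) 0
  rw [this]
  simp [hf.2]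

theorem FlatAtZero.lineDeriv {d : ℕ} {f : Rn d → ℂ} (hf : FlatAtZero f) (v : Rn d) :
    FlatAtZero fun x => fderiv ℝ f x v := by
  have h1 : ContDiff ℝ (⊤ : ℕ∞) (fderiv ℝ f) := hf.1.fderiv_right (by exact_mod_cast le_top)
  refine ⟨h1.clm_apply contDiff_const, fun n => ?_⟩
  have := (ContinuousLinearMap.apply ℝ ℂ v).iteratedFDeriv_comp_left (i := n) (x := (0 : Rn d))
    h1.contDiffAt (by exact_mod_cast le_top)
  have h2 : iteratedFDeriv ℝ n (fderiv ℝ f) 0 = 0 := by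
    rw [← norm_eq_zero, norm_iteratedFDeriv_fderiv, hf.2, norm_zero]
  rw [h2] at this
  refine Eq.trans this ?_
  ext
  simp

theorem contDiff_fourier {d : ℕ} (a : 𝓢(Rn d, ℂ)) :
    ContDiff ℝ (⊤ : ℕ∞) (𝓕 a : 𝓢(Rn d, ℂ)) := (𝓕 a : 𝓢(Rn d, ℂ)).smooth _

theorem Flat.integral_eq_zero {d : ℕ} {a : 𝓢(Rn d, ℂ)} (ha : Flat a) : ∫ x, a x = 0 := by
  rw [← fourier_zero]
  have := congrArg (fun m => m (0 : Fin 0 → Rn d)) (ha.2 0)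
  simpa using this

theorem DeltaLike.integral_eq_one {d : ℕ} {a : 𝓢(Rn d, ℂ)} (ha : DeltaLike a) :
    ∫ x, a x = 1 := by
  rw [← fourier_zero]
  have := congrArg (fun m => m (0 : Fin 0 → Rn d)) (ha.2 0)
  simpa [sub_eq_zero] using this

/-- Multiplication by the `i`-th coordinate. -/
def mulCoord {d : ℕ} (i : Fin (d + 1)) (a : 𝓢(Rn d, ℂ)) : 𝓢(Rn d, ℂ) :=
  SchwartzMap.smulLeftCLM ℂ (fun x : Rn d => inner ℝ x (EuclideanSpace.single i (1 : ℝ))) a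

theorem mulCoord_apply {d : ℕ} (i : Fin (d + 1)) (a : 𝓢(Rn d, ℂ)) (x : Rn d) :
    mulCoord i a x = (x i : ℂ) * a x := by
  have : (fun x : Rn d => inner ℝ x (EuclideanSpace.single i (1 : ℝ))).HasTemperateGrowth :=
    ((innerSL ℝ).flip (EuclideanSpace.single i (1 : ℝ))).hasTemperateGrowth
  rw [mulCoord, SchwartzMap.smulLeftCLM_apply_apply this]
  simp [EuclideanSpace.inner_single_right]

theorem Flat.mulCoord {d : ℕ} {a : 𝓢(Rn d, ℂ)} (ha : Flat a) (i : Fin (d + 1)) :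
    Flat (mulCoord i a) := by
  set e : Rn d := EuclideanSpace.single i (1 : ℝ)
  have h1 := SchwartzMap.lineDerivOp_fourier_eq a e
  have h2 : FlatAtZero fun ξ =>
      (-(2 * Real.pi * Complex.I))⁻¹ * fderiv ℝ (𝓕 a : 𝓢(Rn d, ℂ)) ξ e := by
    have := (FlatAtZero.lineDeriv ha e).mul (g := fun _ => (-(2 * Real.pi * Complex.I))⁻¹)
      contDiff_const
    simpa only [mul_comm] using this
  have h3 : ∀ ξ, 𝓕 (LPDomain.mulCoord i a) ξ =
      (-(2 * Real.pi * Complex.I))⁻¹ * fderiv ℝ (𝓕 a : 𝓢(Rn d, ℂ)) ξ e := by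
    intro ξ
    rw [← SchwartzMap.lineDerivOp_apply_eq_fderiv, h1]
    rw [fourier_smul_apply, ← mul_assoc, inv_mul_cancel₀, one_mul]
    · rfl
    · simp [Real.pi_ne_zero]
  unfold Flat
  rw [show ((𝓕 (LPDomain.mulCoord i a) : 𝓢(Rn d, ℂ)) : Rn d → ℂ) = _ from funext h3]
  exact h2

theorem DeltaLike.dil {d : ℕ} {a : 𝓢(Rn d, ℂ)} (ha : DeltaLike a) (j : ℤ) :
    DeltaLike (dil j a) := by
  unfold DeltaLike
  simp only [fourier_dil]
  exact FlatAtZero.comp_smul ha _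

theorem DeltaLike.sub {d : ℕ} {a b : 𝓢(Rn d, ℂ)} (ha : DeltaLike a) (hb : DeltaLike b) :
    Flat (a - b) := by
  have h := FlatAtZero.add ha (FlatAtZero.mul hb (g := fun _ => -1) contDiff_const)
  unfold Flat
  convert h using 2 with ξ
  rw [fourier_sub_apply]
  ring

/-! ### Decay of convolutions of dilated Schwartz functions -/

theorem one_add_pow_le (M : ℕ) {t : ℝ} (ht : 0 ≤ t) : (1 + t) ^ M ≤ 2 ^ M * (1 + t ^ M) := by
  have h := add_pow_le zero_le_one ht M
  rw [one_pow] at h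
  refine h.trans ?_
  gcongr
  · exact one_le_two
  · omega

/-- The weighted norms of the derivatives are bounded by continuous seminorms. -/
theorem exists_seminorm_bound (d M n : ℕ) : ∃ q : Seminorm ℂ 𝓢(Rn d, ℂ), Continuous q ∧
    ∀ (b : 𝓢(Rn d, ℂ)) (x : Rn d), (1 + ‖x‖) ^ M * ‖iteratedFDeriv ℝ n b x‖ ≤ q b := by
  have hc := fun i : ℕ × ℕ => (schwartz_withSeminorms ℂ (Rn d) ℂ).continuous_seminorm i
  refine ⟨(2 ^ M : ℝ≥0) • (SchwartzMap.seminorm ℂ 0 n + SchwartzMap.seminorm ℂ M n), ?_, ?_⟩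
  · have h : Continuous fun b : 𝓢(Rn d, ℂ) => (2 : ℝ) ^ M *
        (SchwartzMap.seminorm ℂ 0 n b + SchwartzMap.seminorm ℂ M n b) :=
      continuous_const.mul ((hc (0, n)).add (hc (M, n)))
    exact h
  · intro b x
    have h1 := SchwartzMap.le_seminorm ℂ 0 n b x
    have h2 := SchwartzMap.le_seminorm ℂ M n b x
    rw [pow_zero, one_mul] at h1
    calc (1 + ‖x‖) ^ M * ‖iteratedFDeriv ℝ n b x‖
        ≤ (2 ^ M * (1 + ‖x‖ ^ M)) * ‖iteratedFDeriv ℝ n b x‖ := by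
          gcongr
          exact one_add_pow_le M (norm_nonneg x)
      _ = 2 ^ M * (‖iteratedFDeriv ℝ n b x‖ + ‖x‖ ^ M * ‖iteratedFDeriv ℝ n b x‖) := by ring
      _ ≤ 2 ^ M * (SchwartzMap.seminorm ℂ 0 n b + SchwartzMap.seminorm ℂ M n b) := by gcongr
      _ = _ := rfl

theorem integrable_one_add_pow_mul {d : ℕ} (a : 𝓢(Rn d, ℂ)) (M : ℕ) :
    Integrable fun w => (1 + ‖w‖) ^ M * ‖a w‖ := by
  refine Integrable.mono' (g := fun w => 2 ^ M * (‖a w‖ + ‖w‖ ^ M * ‖a w‖)) ?_ ?_ ?_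
  · exact (a.integrable.norm.add (a.integrable_pow_mul volume M)).const_mul _
  · have := a.continuous
    exact Continuous.aestronglyMeasurable (by fun_prop)
  · refine Eventually.of_forall fun w => ?_
    rw [Real.norm_of_nonneg (by positivity)]
    calc _ ≤ (2 ^ M * (1 + ‖w‖ ^ M)) * ‖a w‖ := by
          gcongr
          exact one_add_pow_le M (norm_nonneg w)
      _ = _ := by ring

theorem one_add_norm_le_mul {d : ℕ} (x w : Rn d) {ε : ℝ} (h0 : 0 ≤ ε) (h1 : ε ≤ 1) :
    1 + ‖x‖ ≤ (1 + ‖x + ε • w‖) * (1 + ‖w‖) := by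
  have h2 : ‖x‖ ≤ ‖x + ε • w‖ + ‖w‖ := by
    calc ‖x‖ = ‖(x + ε • w) - ε • w‖ := by simp
      _ ≤ ‖x + ε • w‖ + ‖ε • w‖ := norm_sub_le _ _
      _ ≤ ‖x + ε • w‖ + 1 * ‖w‖ := by
        rw [norm_smul, Real.norm_of_nonneg h0]
        gcongr
      _ = _ := by ring
  nlinarith [norm_nonneg (x + ε • w), norm_nonneg w]

theorem integrable_mul_comp {d : ℕ} (a b : 𝓢(Rn d, ℂ)) (x : Rn d) (ε : ℝ) :
    Integrable fun w => a w * b (x + ε • w) := by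
  obtain ⟨C, hC⟩ : ∃ C : ℝ, ∀ y, ‖b y‖ ≤ C := ⟨_, fun y => SchwartzMap.norm_le_seminorm ℂ b y⟩
  refine a.integrable.mul_bdd (c := C) ?_ (Eventually.of_forall fun w => hC _)
  have := b.continuous
  exact Continuous.aestronglyMeasurable (by fun_prop)

/-- The basic decay estimate, without cancellation. -/
theorem exists_integral_mul_bound {d : ℕ} (a : 𝓢(Rn d, ℂ)) (M : ℕ) :
    ∃ q : Seminorm ℂ 𝓢(Rn d, ℂ), Continuous q ∧ ∀ (b : 𝓢(Rn d, ℂ)) (x : Rn d) (ε : ℝ), 0 ≤ ε →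
      ε ≤ 1 → ‖∫ w, a w * b (x + ε • w)‖ ≤ ((1 + ‖x‖) ^ M)⁻¹ * q b := by
  obtain ⟨q, hq, hqb⟩ := exists_seminorm_bound d M 0
  have hI := integrable_one_add_pow_mul a M
  set I := ∫ w, (1 + ‖w‖) ^ M * ‖a w‖
  have hI0 : 0 ≤ I := integral_nonneg fun w => by positivity
  refine ⟨(I.toNNReal) • q, ?_, fun b x ε h0 h1 => ?_⟩
  · have h : Continuous fun b : 𝓢(Rn d, ℂ) => (I.toNNReal : ℝ) * q b := continuous_const.mul hq
    exact h
  · have hle : ∀ w, ‖a w * b (x + ε • w)‖ ≤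
        ((1 + ‖w‖) ^ M * ‖a w‖) * (((1 + ‖x‖) ^ M)⁻¹ * q b) := by
      intro w
      have h2 := hqb b (x + ε • w)
      rw [norm_iteratedFDeriv_zero] at h2
      have h3 := pow_le_pow_left₀ (by positivity) (one_add_norm_le_mul x w h0 h1) M
      rw [mul_pow] at h3
      have h4 : ‖b (x + ε • w)‖ ≤ (1 + ‖w‖) ^ M * (((1 + ‖x‖) ^ M)⁻¹ * q b) := by
        rw [mul_left_comm, le_inv_mul_iff₀ (by positivity)]
        calc (1 + ‖x‖) ^ M * ‖b (x + ε • w)‖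
            ≤ ((1 + ‖x + ε • w‖) ^ M * (1 + ‖w‖) ^ M) * ‖b (x + ε • w)‖ := by gcongr
          _ = (1 + ‖w‖) ^ M * ((1 + ‖x + ε • w‖) ^ M * ‖b (x + ε • w)‖) := by ring
          _ ≤ _ := by gcongr
      rw [norm_mul]
      calc ‖a w‖ * ‖b (x + ε • w)‖ ≤ ‖a w‖ * ((1 + ‖w‖) ^ M * (((1 + ‖x‖) ^ M)⁻¹ * q b)) := by
            gcongr
        _ = _ := by ring
    refine (norm_integral_le_of_norm_le (hI.mul_const _) (Eventually.of_forall hle)).trans ?_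
    rw [integral_mul_const]
    have h : (I.toNNReal • q) b = I * q b := by
      rw [← Real.coe_toNNReal I hI0]
      simp [NNReal.smul_def]
    rw [h]
    exact le_of_eq (by ring)

/-- Differentiation in `ε` replaces `a` by `x_i a`, whose moments vanish if those of `a` do, and `b`
by its partial derivatives. Integration in `ε` from `0` thus gains one power of `ε`. -/
theorem hasDerivAt_integral_mul_comp {d : ℕ} (a b : 𝓢(Rn d, ℂ)) (x : Rn d) (ε : ℝ) :
    HasDerivAt (fun ε : ℝ => ∫ w, a w * b (x + ε • w))
      (∑ i, ∫ w, mulCoord i a w *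
        (LineDeriv.lineDerivOp (EuclideanSpace.single i (1 : ℝ)) b : 𝓢(Rn d, ℂ)) (x + ε • w)) ε := by
  obtain ⟨q, -, hqb⟩ := exists_seminorm_bound d 0 1
  have hfd : ∀ y, ‖fderiv ℝ b y‖ ≤ q b := by
    intro y
    have := hqb b y
    rwa [pow_zero, one_mul, norm_iteratedFDeriv_one] at this
  have hcont : Continuous fun y => fderiv ℝ b y :=
    (b.smooth 1).continuous_fderiv (by norm_num)
  have hac := a.continuous
  have hbc := b.continuous
  have key := hasDerivAt_integral_of_dominated_loc_of_deriv_le (μ := (volume : Measure (Rn d)))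
    (F := fun (ε : ℝ) w => a w * b (x + ε • w)) (x₀ := ε) (s := Set.univ)
    (F' := fun ε w => a w * fderiv ℝ b (x + ε • w) w)
    (bound := fun w => ((1 + ‖w‖) ^ 1 * ‖a w‖) * q b) univ_mem
    (Eventually.of_forall fun ε => Continuous.aestronglyMeasurable (by fun_prop))
    (integrable_mul_comp a b x ε)
    (Continuous.aestronglyMeasurable (by fun_prop))
    (Eventually.of_forall fun w t _ => by
      rw [norm_mul]
      have h1 : ‖fderiv ℝ b (x + t • w) w‖ ≤ q b * ‖w‖ :=
        (ContinuousLinearMap.le_opNorm _ _).trans (by gcongr; exact hfd _)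
      calc _ ≤ ‖a w‖ * (q b * (1 + ‖w‖)) := by
            gcongr
            refine h1.trans ?_
            gcongr
            linarith
        _ = _ := by ring)
    ((integrable_one_add_pow_mul a 1).mul_const _)
    (Eventually.of_forall fun w t _ => by
      have h1 : HasDerivAt (fun t : ℝ => x + t • w) w t := by
        simpa using ((hasDerivAt_id t).smul_const w).const_add x
      have h2 := (b.differentiableAt (x := x + t • w)).hasFDerivAt.comp_hasDerivAt t h1
      exact h2.const_mul (a w))
  refine key.2.congr_deriv ?_
  rw [← integral_finsetSum _ fun i _ => integrable_mul_comp _ _ _ _]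
  congr 1 with w
  have hw : w = ∑ i, w i • EuclideanSpace.single i (1 : ℝ) := by
    ext j
    simp [Pi.single_apply]
  have h1 : fderiv ℝ b (x + ε • w) w =
      ∑ i, fderiv ℝ b (x + ε • w) (w i • EuclideanSpace.single i (1 : ℝ)) := by
    rw [← map_sum, ← hw]
  rw [h1, Finset.mul_sum]
  refine Finset.sum_congr rfl fun i _ => ?_
  rw [mulCoord_apply, SchwartzMap.lineDerivOp_apply_eq_fderiv, map_smul, Complex.real_smul]
  ring

/-- Vanishing moments of `a` produce decay in the dilation parameter. -/
theorem exists_integral_mul_bound_of_flat {d : ℕ} (N M : ℕ) : ∀ a : 𝓢(Rn d, ℂ), Flat a →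
    ∃ q : Seminorm ℂ 𝓢(Rn d, ℂ), Continuous q ∧ ∀ (b : 𝓢(Rn d, ℂ)) (x : Rn d) (ε : ℝ), 0 ≤ ε →
      ε ≤ 1 → ‖∫ w, a w * b (x + ε • w)‖ ≤ ε ^ N * (((1 + ‖x‖) ^ M)⁻¹ * q b) := by
  induction N with
  | zero =>
    intro a _
    simpa using exists_integral_mul_bound a M
  | succ N ih =>
    intro a ha
    choose q hq hqb using fun i => ih (mulCoord i a) (ha.mulCoord i)
    set D : Fin (d + 1) → 𝓢(Rn d, ℂ) →L[ℂ] 𝓢(Rn d, ℂ) := fun i =>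
      LineDeriv.lineDerivOpCLM ℂ 𝓢(Rn d, ℂ) (EuclideanSpace.single i (1 : ℝ) : Rn d)
    have hsum : ∀ b, (∑ i, (q i).comp (D i).toLinearMap) b = ∑ i, q i (D i b) := by
      intro b
      rw [← FunLike.coeAddMonoidHom_apply, map_sum, Finset.sum_apply]
      rfl
    refine ⟨∑ i, (q i).comp (D i).toLinearMap, ?_, fun b x ε h0 h1 => ?_⟩
    · have h : Continuous fun b => ∑ i, q i (D i b) :=
        continuous_finsetSum _ fun i _ => (hq i).comp (D i).continuous
      exact h.congr fun b => (hsum b).symm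
    · rw [hsum]
      set f : ℝ → ℂ := fun ε => ∫ w, a w * b (x + ε • w)
      have hf0 : f 0 = 0 := by
        simp only [f, zero_smul, add_zero]
        rw [integral_mul_const, ha.integral_eq_zero, zero_mul]
      have hbound : ∀ t ∈ Set.Icc 0 ε, ‖∑ i, ∫ w, mulCoord i a w *
          (LineDeriv.lineDerivOp (EuclideanSpace.single i (1 : ℝ)) b : 𝓢(Rn d, ℂ)) (x + t • w)‖ ≤
          ε ^ N * (((1 + ‖x‖) ^ M)⁻¹ * ∑ i, q i (D i b)) := by
        intro t ht
        rw [Finset.mul_sum, Finset.mul_sum]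
        refine (norm_sum_le _ _).trans (Finset.sum_le_sum fun i _ => ?_)
        refine (hqb i (D i b) x t ht.1 (ht.2.trans h1)).trans ?_
        have := apply_nonneg (q i) (D i b)
        have := ht.1
        gcongr
        exact ht.2
      have h2 := (convex_Icc 0 ε).norm_image_sub_le_of_norm_hasDerivWithin_le
        (fun t _ => (hasDerivAt_integral_mul_comp a b x t).hasDerivWithinAt) hbound
        (Set.left_mem_Icc.2 h0) (Set.right_mem_Icc.2 h0)
      have h3 : ‖f ε - f 0‖ ≤ _ := h2
      rw [hf0, sub_zero, sub_zero, Real.norm_of_nonneg h0] at h3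
      refine h3.trans (le_of_eq ?_)
      ring

theorem sconv_comm {d : ℕ} (a b : 𝓢(Rn d, ℂ)) : sconv a b = sconv b a :=
  ext_of_fourier fun ξ => by rw [fourier_sconv, fourier_sconv, mul_comm]

/-- Almost orthogonality: `a` at the scale `2^{-L}` against `b` at the coarser scale `2^{-l}`. -/
theorem exists_sconv_dil_bound {d : ℕ} (a b : 𝓢(Rn d, ℂ)) (N M : ℕ) :
    ∃ C : ℝ, 0 ≤ C ∧ ∀ l L : ℕ, l ≤ L → (l < L → Flat a) → ∀ x,
      ‖sconv (dil L a) (dil l b) x‖ ≤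
        C * (2 ^ (l * (d + 1)) * ((2 ^ (L - l)) ^ N * (1 + 2 ^ l * ‖x‖) ^ M)⁻¹) := by
  obtain ⟨q₀, -, hq₀⟩ := exists_integral_mul_bound a M
  obtain ⟨q₁, hq₁⟩ : ∃ q₁ : Seminorm ℂ 𝓢(Rn d, ℂ), Flat a → ∀ (b : 𝓢(Rn d, ℂ)) (x : Rn d) (ε : ℝ),
      0 ≤ ε → ε ≤ 1 → ‖∫ w, a w * b (x + ε • w)‖ ≤ ε ^ N * (((1 + ‖x‖) ^ M)⁻¹ * q₁ b) := by
    by_cases ha : Flat a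
    · obtain ⟨q, -, hq⟩ := exists_integral_mul_bound_of_flat N M a ha
      exact ⟨q, fun _ => hq⟩
    · exact ⟨0, fun h => absurd h ha⟩
  refine ⟨q₀ (refl b) + q₁ (refl b), by positivity, fun l L hlL hflat x => ?_⟩
  have hn0 := apply_nonneg q₀ (refl b)
  have hn1 := apply_nonneg q₁ (refl b)
  set ε : ℝ := ((2 : ℝ) ^ (L - l))⁻¹ with hε
  have hε0 : 0 ≤ ε := by positivity
  have hε1 : ε ≤ 1 := inv_le_one_of_one_le₀ (one_le_pow₀ one_le_two)
  have h1 : sconv (dil L a) (dil l b) x =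
      ((2 : ℝ) ^ (l * (d + 1))) • ∫ w, a w * refl b (-((2 : ℝ) ^ l • x) + ε • w) := by
    rw [sconv_apply, integral_dil_mul, ← integral_smul]
    congr 1 with w
    rw [dil_apply, refl_apply, mul_smul_comm, zpow_natCast, ← pow_mul]
    congr 3
    rw [neg_add, neg_neg, smul_sub, smul_smul, sub_eq_add_neg, hε]
    congr 3
    rw [zpow_neg, zpow_natCast, ← div_eq_mul_inv, div_eq_iff (by positivity), inv_mul_eq_div,
      eq_div_iff (by positivity), ← pow_add]
    congr 1
    omega
  have h2 : ‖-((2 : ℝ) ^ l • x)‖ = 2 ^ l * ‖x‖ := by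
    rw [norm_neg, norm_smul]
    simp
  have h3 : ‖∫ w, a w * refl b (-((2 : ℝ) ^ l • x) + ε • w)‖ ≤
      ε ^ N * (((1 + 2 ^ l * ‖x‖) ^ M)⁻¹ * (q₀ (refl b) + q₁ (refl b))) := by
    rcases hlL.eq_or_lt with h | h
    · have hε' : ε = 1 := by simp [hε, h]
      have := hq₀ (refl b) (-((2 : ℝ) ^ l • x)) ε hε0 hε1
      rw [h2] at this
      refine this.trans ?_
      rw [hε', one_pow, one_mul]
      gcongr
      linarith
    · have := hq₁ (hflat h) (refl b) (-((2 : ℝ) ^ l • x)) ε hε0 hε1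
      rw [h2] at this
      refine this.trans ?_
      gcongr
      linarith
  rw [h1, norm_smul, Real.norm_of_nonneg (by positivity)]
  calc _ ≤ 2 ^ (l * (d + 1)) *
        (ε ^ N * (((1 + 2 ^ l * ‖x‖) ^ M)⁻¹ * (q₀ (refl b) + q₁ (refl b)))) := by gcongr
    _ = _ := by
      rw [hε, inv_pow, mul_inv]
      ring

/-- The shape of a Littlewood-Paley sequence: from the second member on it consists of the
dilates of a function with vanishing moments. -/
def IsDyadicFamily {d : ℕ} (θ : ℕ → 𝓢(Rn d, ℂ)) : Prop :=
  ∃ b : 𝓢(Rn d, ℂ), Flat b ∧ ∀ j : ℕ, 1 ≤ j → θ j = dil j b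

theorem ofReal_one_add_two_pow_mul {d : ℕ} (k : ℕ) (x : Rn d) :
    ENNReal.ofReal (1 + 2 ^ k * ‖x‖) = 1 + 2 ^ k * ‖x‖ₑ := by
  rw [ENNReal.ofReal_add (by norm_num) (by positivity), ENNReal.ofReal_mul (by positivity),
    ENNReal.ofReal_pow (by norm_num), ofReal_norm]
  simp

/-- Almost orthogonality of two dyadic families. The decay in `|j - k|` comes from the vanishing
moments of the member at the finer scale, which are available because its index is positive. -/
theorem IsDyadicFamily.exists_sconv_bound {d : ℕ} {θ ψ : ℕ → 𝓢(Rn d, ℂ)} (hθ : IsDyadicFamily θ)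
    (hψ : IsDyadicFamily ψ) (N : ℕ) : ∃ C : ℝ≥0∞, C ≠ ∞ ∧ ∀ (j k : ℕ) (x : Rn d),
      ‖sconv (ψ k) (θ j) x‖ₑ ≤ C * (2 ^ (k * (d + 1)) * wt j k x ^ N) := by
  obtain ⟨b, hb, hθb⟩ := hθ
  obtain ⟨a, ha, hψa⟩ := hψ
  -- each pair of members is a pair of dilates of two of the four functions `ψ₀, a` and `θ₀, b`
  have core : ∀ u v : 𝓢(Rn d, ℂ), ∃ C : ℝ≥0∞, C ≠ ∞ ∧ ∀ (j k : ℕ), (k < j → Flat v) →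
      (j < k → Flat u) → ∀ x : Rn d,
      ‖sconv (dil k u) (dil j v) x‖ₑ ≤ C * (2 ^ (k * (d + 1)) * wt j k x ^ N) := by
    intro u v
    obtain ⟨C₁, hC₁, h₁⟩ := exists_sconv_dil_bound u v (2 * N) N
    obtain ⟨C₂, hC₂, h₂⟩ := exists_sconv_dil_bound v u N N
    refine ⟨ENNReal.ofReal (C₁ + C₂), by finiteness, fun j k hj hk x => ?_⟩
    have hwt : wt j k x = ENNReal.ofReal ((2 ^ ((k : ℤ) - j).natAbs * (1 + 2 ^ k * ‖x‖))⁻¹) := by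
      rw [wt, ENNReal.ofReal_inv_of_pos (by positivity), ENNReal.ofReal_mul (by positivity),
        ofReal_one_add_two_pow_mul, ENNReal.ofReal_pow (by norm_num)]
      simp
    have e2 : (2 : ℝ≥0∞) ^ (k * (d + 1)) = ENNReal.ofReal (2 ^ (k * (d + 1))) := by
      rw [ENNReal.ofReal_pow (by norm_num)]
      simp
    rw [hwt, e2, ← ENNReal.ofReal_pow (by positivity), ← ENNReal.ofReal_mul (by positivity),
      ← ENNReal.ofReal_mul (by positivity), ← ofReal_norm]
    refine ENNReal.ofReal_le_ofReal ?_
    rcases le_or_gt j k with hjk | hjk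
    · refine (h₁ j k hjk hk x).trans ?_
      gcongr ?_ * (?_ * ?_)
      · linarith
      · exact pow_le_pow_right₀ one_le_two (Nat.mul_le_mul_right _ hjk)
      · rw [pow_mul, ← mul_pow, inv_pow]
        refine inv_anti₀ (by positivity) (pow_le_pow_left₀ (by positivity) ?_ N)
        rw [show ((k : ℤ) - j).natAbs = k - j by omega]
        have e : (2 : ℝ) ^ k = 2 ^ (k - j) * 2 ^ j := by
          rw [← pow_add]; congr 1; omega
        have h1 : (1 : ℝ) ≤ 2 ^ (k - j) := one_le_pow₀ one_le_two
        have h2 : 0 ≤ 2 ^ j * ‖x‖ := by positivity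
        rw [e, sq, mul_assoc, mul_assoc]
        gcongr
        nlinarith
    · rw [sconv_comm]
      refine (h₂ k j hjk.le hj x).trans ?_
      gcongr ?_ * (?_ * ?_)
      · linarith
      · rw [inv_pow, mul_pow, show ((k : ℤ) - j).natAbs = j - k by omega]
  choose C hC h using core
  refine ⟨C (ψ 0) (θ 0) + C (ψ 0) b + C a (θ 0) + C a b, by simp [hC], fun j k x => ?_⟩
  rcases Nat.eq_zero_or_pos j with hj | hj <;> rcases Nat.eq_zero_or_pos k with hk | hk
  · have := h (ψ 0) (θ 0) j k (by omega) (by omega) x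
    subst hj hk
    rw [Nat.cast_zero, dil_zero, dil_zero] at this
    refine this.trans (mul_le_mul_left ?_ _)
    exact le_self_add.trans (le_self_add.trans le_self_add)
  · have := h a (θ 0) j k (by omega) (fun _ => ha) x
    subst hj
    rw [Nat.cast_zero, dil_zero, ← hψa k hk] at this
    exact this.trans (mul_le_mul_left (le_add_self.trans le_self_add) _)
  · have := h (ψ 0) b j k (fun _ => hb) (by omega) x
    subst hk
    rw [Nat.cast_zero, dil_zero, ← hθb j hj] at this
    refine this.trans (mul_le_mul_left ?_ _)
    exact le_add_self.trans (le_self_add.trans le_self_add)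
  · have := h a b j k (fun _ => hb) (fun _ => ha) x
    rw [← hψa k hk, ← hθb j hj] at this
    exact this.trans (mul_le_mul_left le_add_self _)

theorem sconv_refl_apply {d : ℕ} (a u : 𝓢(Rn d, ℂ)) (z : Rn d) :
    sconv (refl a) u z = ∫ w, a w * u (z + w) := by
  rw [sconv_apply, ← integral_neg_eq_self]
  simp [refl_apply]

/-- The convolution of `ψ_k` with a fixed Schwartz function decays rapidly in `k`, uniformly in
the seminorms of that function. -/
theorem IsDyadicFamily.exists_sconv_refl_bound {d : ℕ} {ψ : ℕ → 𝓢(Rn d, ℂ)}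
    (hψ : IsDyadicFamily ψ) (N M : ℕ) : ∃ q : Seminorm ℂ 𝓢(Rn d, ℂ), Continuous q ∧
      ∀ (k : ℕ) (u : 𝓢(Rn d, ℂ)) (z : Rn d),
        ‖sconv (refl (ψ k)) u z‖ ≤ ((2 : ℝ) ^ (k * N))⁻¹ * (((1 + ‖z‖) ^ M)⁻¹ * q u) := by
  obtain ⟨a, ha, hψa⟩ := hψ
  obtain ⟨q₀, hq₀, h₀⟩ := exists_integral_mul_bound (ψ 0) M
  obtain ⟨q₁, hq₁, h₁⟩ := exists_integral_mul_bound_of_flat N M a ha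
  refine ⟨q₀ + q₁, hq₀.add hq₁, fun k u z => ?_⟩
  have hn0 := apply_nonneg q₀ u
  have hn1 := apply_nonneg q₁ u
  have hadd : (q₀ + q₁) u = q₀ u + q₁ u := rfl
  rw [sconv_refl_apply, hadd]
  rcases Nat.eq_zero_or_pos k with rfl | hk
  · have := h₀ u z 1 zero_le_one le_rfl
    simp only [one_smul] at this
    refine this.trans ?_
    rw [zero_mul, pow_zero, inv_one, one_mul]
    gcongr
    linarith
  · rw [hψa k hk, integral_dil_mul]
    refine (h₁ u z _ (by positivity) ?_).trans ?_
    · rw [zpow_neg, zpow_natCast]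
      exact inv_le_one_of_one_le₀ (one_le_pow₀ one_le_two)
    · rw [zpow_neg, zpow_natCast, inv_pow, ← pow_mul]
      gcongr
      linarith

/-! ### Tempered distributions and convolutions -/

/-- `u` and its derivatives of order at most `M` are bounded by `B (1 + |x|)^{-M}`. -/
def WeightedBound {d : ℕ} (M : ℕ) (u : 𝓢(Rn d, ℂ)) (B : ℝ) : Prop :=
  ∀ n ≤ M, ∀ x : Rn d, (1 + ‖x‖) ^ M * ‖iteratedFDeriv ℝ n u x‖ ≤ B

theorem exists_weightedBound {d : ℕ} (M : ℕ) (u : 𝓢(Rn d, ℂ)) :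
    ∃ B, 0 ≤ B ∧ WeightedBound M u B := by
  choose q _ hq using fun n => exists_seminorm_bound d M n
  refine ⟨∑ n ∈ Finset.range (M + 1), q n u, Finset.sum_nonneg fun n _ => apply_nonneg _ _,
    fun n hn x => (hq n u x).trans ?_⟩
  exact Finset.single_le_sum (f := fun n => q n u) (fun n _ => apply_nonneg _ _)
    (Finset.mem_range.2 (by omega))

theorem WeightedBound.nonneg {d M : ℕ} {u : 𝓢(Rn d, ℂ)} {B : ℝ} (h : WeightedBound M u B) :
    0 ≤ B :=
  le_trans (by positivity) (h 0 (Nat.zero_le M) 0)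

theorem exists_seminorm_le_normComp {d : ℕ} (q : Seminorm ℂ 𝓢(Rn d, ℂ)) (hq : Continuous q) :
    ∃ (s : Finset (ℕ × ℕ)) (C : ℝ), 0 ≤ C ∧ ∀ u, q u ≤
      C * s.sup (schwartzSeminormFamily ℂ (Rn d) ℂ) u := by
  obtain ⟨s, C, -, hle⟩ := Seminorm.bound_of_continuous (schwartz_withSeminorms ℂ (Rn d) ℂ) q hq
  exact ⟨s, C, C.2, fun u => hle u⟩

theorem exists_weightedBound_le {d : ℕ} (F : 𝓢'(Rn d, ℂ)) :
    ∃ (M : ℕ) (C : ℝ), 0 ≤ C ∧ ∀ u B, WeightedBound M u B → ‖F u‖ ≤ C * B := by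
  obtain ⟨s, C, hC, hle⟩ := exists_seminorm_le_normComp
    ((normSeminorm ℂ ℂ).comp (F : 𝓢(Rn d, ℂ) →ₗ[ℂ] ℂ)) (continuous_norm.comp (map_continuous F))
  refine ⟨s.sup fun i => i.1 + i.2, C, hC, fun u B hB => (hle u).trans ?_⟩
  have hB0 := hB.nonneg
  gcongr
  refine Seminorm.finset_sup_apply_le hB0 fun i hi => ?_
  have hi' : i.1 + i.2 ≤ s.sup fun i => i.1 + i.2 :=
    Finset.le_sup (f := fun i : ℕ × ℕ => i.1 + i.2) hi
  refine SchwartzMap.seminorm_le_bound ℂ _ _ u hB0 fun x => ?_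
  refine le_trans ?_ (hB i.2 (by omega) x)
  gcongr
  calc ‖x‖ ^ i.1 ≤ (1 + ‖x‖) ^ i.1 := by gcongr; linarith
    _ ≤ _ := pow_le_pow_right₀ (by linarith [norm_nonneg x]) (by omega)

/-- The index set of the scalar quantities `(1 + |x|)^M |m|⁻¹ D^n u(x)[m]`, `n ≤ M`. -/
structure JetIndex (d M : ℕ) where
  /-- the order of the derivative -/
  order : Fin (M + 1)
  /-- the point -/
  pt : Rn d
  /-- the directions -/
  dir : Fin order → Rn d

instance (d M : ℕ) : TopologicalSpace (JetIndex d M) := ⊥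

instance (d M : ℕ) : DiscreteTopology (JetIndex d M) := ⟨rfl⟩

/-- The scalar quantities by which the weighted norms of `u` are tested. -/
def jetCoord {d M : ℕ} (i : JetIndex d M) (u : 𝓢(Rn d, ℂ)) : ℂ :=
  ((1 + ‖i.pt‖) ^ M * (∏ l, ‖i.dir l‖)⁻¹) • iteratedFDeriv ℝ i.order u i.pt i.dir

theorem norm_jetCoord_le {d M : ℕ} (i : JetIndex d M) (u : 𝓢(Rn d, ℂ)) :
    ‖jetCoord i u‖ ≤ (1 + ‖i.pt‖) ^ M * ‖iteratedFDeriv ℝ i.order u i.pt‖ := by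
  rw [jetCoord, norm_smul, Real.norm_of_nonneg (by positivity), mul_assoc]
  gcongr
  have h := (iteratedFDeriv ℝ i.order u i.pt).le_opNorm i.dir
  rcases eq_or_ne (∏ l, ‖i.dir l‖) 0 with h0 | h0
  · rw [h0, inv_zero, zero_mul]
    exact norm_nonneg _
  · rw [inv_mul_le_iff₀ (by positivity), mul_comm]
    exact h

/-- The map that records the weighted derivatives of a Schwartz function. -/
def jet (d M : ℕ) : 𝓢(Rn d, ℂ) →ₗ[ℂ] BoundedContinuousFunction (JetIndex d M) ℂ where
  toFun u := BoundedContinuousFunction.ofNormedAddCommGroupDiscrete (fun i => jetCoord i u)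
    (exists_weightedBound M u).choose fun i => (norm_jetCoord_le i u).trans
      ((exists_weightedBound M u).choose_spec.2 _ (by omega) _)
  map_add' u v := by
    ext i
    have hu := (u.smooth i.order).contDiffAt (x := i.pt)
    have hv := (v.smooth i.order).contDiffAt (x := i.pt)
    have h := iteratedFDeriv_add_apply hu hv
    simp only [BoundedContinuousFunction.coe_ofNormedAddCommGroupDiscrete,
      BoundedContinuousFunction.coe_add, Pi.add_apply, jetCoord]
    rw [show ((u + v : 𝓢(Rn d, ℂ)) : Rn d → ℂ) = u + v from rfl, h,
      _root_.add_apply, smul_add]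
  map_smul' c u := by
    ext i
    have hu := (u.smooth i.order).contDiffAt (x := i.pt)
    have h := iteratedFDeriv_const_smul_apply (a := c) hu
    simp only [BoundedContinuousFunction.coe_ofNormedAddCommGroupDiscrete,
      BoundedContinuousFunction.coe_smul, RingHom.id_apply, jetCoord]
    rw [show ((c • u : 𝓢(Rn d, ℂ)) : Rn d → ℂ) = c • (u : Rn d → ℂ) from rfl, h,
      _root_.smul_apply, smul_comm]

theorem jet_apply {d M : ℕ} (u : 𝓢(Rn d, ℂ)) (i : JetIndex d M) : jet d M u i = jetCoord i u := rfl

theorem norm_jet_le {d M : ℕ} {u : 𝓢(Rn d, ℂ)} {B : ℝ} (h : WeightedBound M u B) :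
    ‖jet d M u‖ ≤ B := by
  rw [BoundedContinuousFunction.norm_le h.nonneg]
  exact fun i => (norm_jetCoord_le i u).trans (h _ (by omega) _)

theorem weightedBound_norm_jet {d M : ℕ} (u : 𝓢(Rn d, ℂ)) : WeightedBound M u ‖jet d M u‖ := by
  intro n hn x
  rw [← le_inv_mul_iff₀ (by positivity)]
  refine ContinuousMultilinearMap.opNorm_le_bound (by positivity) fun m => ?_
  rw [← mul_comm, ← mul_assoc, mul_comm _ (((1 + ‖x‖) ^ M)⁻¹), mul_assoc,
    le_inv_mul_iff₀ (by positivity)]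
  rcases eq_or_ne (∏ l, ‖m l‖) 0 with h0 | h0
  · obtain ⟨l, -, hl⟩ := Finset.prod_eq_zero_iff.1 h0
    rw [ContinuousMultilinearMap.map_coord_zero _ l (norm_eq_zero.1 hl), h0]
    simp
  · have h := (jet d M u).norm_coe_le_norm ⟨⟨n, by omega⟩, x, m⟩
    rw [jet_apply, jetCoord, norm_smul, Real.norm_of_nonneg (by positivity), mul_assoc,
      mul_left_comm, inv_mul_le_iff₀ (by positivity)] at h
    exact h

/-- A tempered distribution depends continuously on finitely many weighted derivatives: by the
Hahn-Banach theorem it extends to the space of bounded families. -/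
theorem exists_jet_extension {d : ℕ} (F : 𝓢'(Rn d, ℂ)) :
    ∃ (M : ℕ) (L : BoundedContinuousFunction (JetIndex d M) ℂ →L[ℂ] ℂ),
      ∀ u, L (jet d M u) = F u := by
  obtain ⟨M, C, hC, hF⟩ := exists_weightedBound_le F
  have hbound : ∀ u, ‖F u‖ ≤ C * ‖jet d M u‖ := fun u => hF u _ (weightedBound_norm_jet u)
  have hinj : Function.Injective (jet d M) := by
    rw [← LinearMap.ker_eq_bot, LinearMap.ker_eq_bot']
    intro u hu
    ext x
    have h := weightedBound_norm_jet (M := M) u 0 (Nat.zero_le _) x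
    rw [hu, norm_zero, norm_iteratedFDeriv_zero] at h
    have h1 : 0 < (1 + ‖x‖) ^ M := by positivity
    have h2 : ‖u x‖ ≤ 0 := by
      by_contra h3
      push Not at h3
      exact absurd h (not_le.2 (mul_pos h1 h3))
    simpa using h2
  let e := LinearEquiv.ofInjective (jet d M) hinj
  let f : StrongDual ℂ (LinearMap.range (jet d M)) :=
    ((F : 𝓢(Rn d, ℂ) →ₗ[ℂ] ℂ).comp e.symm.toLinearMap).mkContinuous C fun y => by
      have h := hbound (e.symm y)
      have h2 : jet d M (e.symm y) = y := congrArg Subtype.val (e.apply_symm_apply y)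
      rw [h2] at h
      exact h
  obtain ⟨L, hL, -⟩ := exists_extension_norm_eq (LinearMap.range (jet d M)) f
  refine ⟨M, L, fun u => ?_⟩
  have h := hL (e u)
  have h2 : f (e u) = F u := congrArg F (e.symm_apply_apply u)
  rw [h2] at h
  exact h

/-- The translate `x ↦ u(x - w)`. -/
abbrev trans {d : ℕ} (w : Rn d) (u : 𝓢(Rn d, ℂ)) : 𝓢(Rn d, ℂ) := SchwartzMap.compSubConstCLM ℂ w u

theorem iteratedFDeriv_trans {d : ℕ} (w : Rn d) (u : 𝓢(Rn d, ℂ)) (n : ℕ) (x : Rn d) :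
    iteratedFDeriv ℝ n (trans w u) x = iteratedFDeriv ℝ n u (x - w) :=
  iteratedFDeriv_comp_sub n w x

theorem one_add_norm_pow_le {d : ℕ} (x w : Rn d) (M : ℕ) :
    (1 + ‖x‖) ^ M ≤ (1 + ‖w‖) ^ M * (1 + ‖x - w‖) ^ M := by
  rw [← mul_pow]
  gcongr
  have h : ‖x‖ ≤ ‖x - w‖ + ‖w‖ := by simpa using norm_add_le (x - w) w
  nlinarith [norm_nonneg (x - w), norm_nonneg w]

theorem WeightedBound.trans {d M : ℕ} {u : 𝓢(Rn d, ℂ)} {B : ℝ} (h : WeightedBound M u B)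
    (w : Rn d) : WeightedBound M (trans w u) ((1 + ‖w‖) ^ M * B) := by
  intro n hn x
  rw [iteratedFDeriv_trans]
  calc _ ≤ ((1 + ‖w‖) ^ M * (1 + ‖x - w‖) ^ M) * ‖iteratedFDeriv ℝ n u (x - w)‖ := by
        gcongr
        exact one_add_norm_pow_le x w M
    _ = (1 + ‖w‖) ^ M * ((1 + ‖x - w‖) ^ M * ‖iteratedFDeriv ℝ n u (x - w)‖) := by ring
    _ ≤ _ := by
        gcongr
        exact h n hn _

theorem WeightedBound.dil {d M : ℕ} {u : 𝓢(Rn d, ℂ)} {B : ℝ} (h : WeightedBound M u B) (k : ℕ) :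
    WeightedBound M (dil k u) ((2 ^ k) ^ (M + (d + 1)) * B) := by
  intro n hn x
  have h1 : (1 : ℝ) ≤ 2 ^ k := one_le_pow₀ one_le_two
  have hu : ContDiff ℝ n u := u.smooth n
  have e : iteratedFDeriv ℝ n (LPDomain.dil k u) x =
      ((2 : ℝ) ^ k) ^ (d + 1) • ((2 : ℝ) ^ k) ^ n • iteratedFDeriv ℝ n u ((2 : ℝ) ^ k • x) := by
    have e0 : (LPDomain.dil k u : Rn d → ℂ) =
        fun x => ((2 : ℝ) ^ k) ^ (d + 1) • u ((2 : ℝ) ^ k • x) := by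
      funext x
      rw [dil_apply, zpow_natCast]
    have hu' : ContDiff ℝ n fun x => u ((2 : ℝ) ^ k • x) := hu.comp (contDiff_const_smul _)
    rw [e0, iteratedFDeriv_const_smul_apply' hu'.contDiffAt,
      congrFun (iteratedFDeriv_comp_const_smul ((2 : ℝ) ^ k) hu) x]
  rw [e, norm_smul, norm_smul, Real.norm_of_nonneg (by positivity),
    Real.norm_of_nonneg (by positivity)]
  have h2 : ‖x‖ ≤ ‖(2 : ℝ) ^ k • x‖ := by
    rw [norm_smul, Real.norm_of_nonneg (by positivity)]
    exact le_mul_of_one_le_left (norm_nonneg x) h1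
  calc _ ≤ (1 + ‖(2 : ℝ) ^ k • x‖) ^ M * ((2 ^ k) ^ (d + 1) * ((2 ^ k) ^ M *
          ‖iteratedFDeriv ℝ n u ((2 : ℝ) ^ k • x)‖)) := by
        gcongr
    _ = (2 ^ k) ^ (M + (d + 1)) * ((1 + ‖(2 : ℝ) ^ k • x‖) ^ M *
          ‖iteratedFDeriv ℝ n u ((2 : ℝ) ^ k • x)‖) := by ring
    _ ≤ _ := by
        gcongr
        exact h n hn _

/-- Mean value inequality in the weighted norms. -/
theorem weightedBound_trans_sub {d M : ℕ} {u : 𝓢(Rn d, ℂ)} {B : ℝ} (h : WeightedBound (M + 1) u B)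
    (w v : Rn d) (hv : ‖v - w‖ ≤ 1) :
    WeightedBound M (trans v u - trans w u) (‖v - w‖ * ((2 + ‖w‖) ^ M * B)) := by
  intro n hn x
  have hB := h.nonneg
  have hc : ∀ z, ContDiffAt ℝ n (trans z u) x := fun z => ((trans z u).smooth n).contDiffAt
  rw [show ((trans v u - trans w u : 𝓢(Rn d, ℂ)) : Rn d → ℂ) = trans v u - trans w u from rfl,
    iteratedFDeriv_sub_apply (hc v) (hc w), iteratedFDeriv_trans, iteratedFDeriv_trans]
  have hd : ∀ y, DifferentiableAt ℝ (iteratedFDeriv ℝ n u) y := fun y =>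
    (u.smooth ⊤).differentiable_iteratedFDeriv (mod_cast ENat.natCast_lt_top n) y
  have hbound : ∀ y ∈ segment ℝ (x - w) (x - v), ‖fderiv ℝ (iteratedFDeriv ℝ n u) y‖ ≤
      ((1 + ‖x‖) ^ M)⁻¹ * ((2 + ‖w‖) ^ M * B) := by
    intro y hy
    have hy2 : ‖x - y‖ ≤ ‖w‖ + 1 := by
      obtain ⟨t, ht, rfl⟩ := segment_eq_image' ℝ (x - w) (x - v) ▸ hy
      have e : x - (x - w + t • (x - v - (x - w))) = w + t • (v - w) := by
        module
      rw [e]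
      refine (norm_add_le _ _).trans ?_
      rw [norm_smul, Real.norm_of_nonneg ht.1]
      have := norm_nonneg (v - w)
      have := ht.2
      have := ht.1
      gcongr
      nlinarith
    rw [norm_fderiv_iteratedFDeriv, le_inv_mul_iff₀ (by positivity)]
    have h3 := h (n + 1) (by omega) y
    have h4 : (1 + ‖x‖) ^ M ≤ (2 + ‖w‖) ^ M * (1 + ‖y‖) ^ M := by
      refine (one_add_norm_pow_le x (x - y) M).trans ?_
      rw [sub_sub_cancel]
      gcongr ?_ ^ M * _
      linarith
    calc _ ≤ ((2 + ‖w‖) ^ M * (1 + ‖y‖) ^ M) * ‖iteratedFDeriv ℝ (n + 1) u y‖ := by gcongr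
      _ = (2 + ‖w‖) ^ M * ((1 + ‖y‖) ^ M * ‖iteratedFDeriv ℝ (n + 1) u y‖) := by ring
      _ ≤ _ := by
        gcongr
        refine le_trans ?_ h3
        gcongr
        · linarith [norm_nonneg y]
        · omega
  have key := (convex_segment (𝕜 := ℝ) (x - w) (x - v)).norm_image_sub_le_of_norm_fderiv_le
    (fun y _ => hd y) hbound (left_mem_segment ℝ _ _) (right_mem_segment ℝ _ _)
  have e : ‖x - v - (x - w)‖ = ‖v - w‖ := by
    rw [← norm_neg]
    congr 1
    abel
  rw [e] at key
  calc _ ≤ (1 + ‖x‖) ^ M * (((1 + ‖x‖) ^ M)⁻¹ * ((2 + ‖w‖) ^ M * B) * ‖v - w‖) := by gcongr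
    _ = ‖v - w‖ * ((2 + ‖w‖) ^ M * B) * ((1 + ‖x‖) ^ M * ((1 + ‖x‖) ^ M)⁻¹) := by ring
    _ = _ := by rw [mul_inv_cancel₀ (by positivity), mul_one]

theorem continuous_jet_trans {d : ℕ} (M : ℕ) (u : 𝓢(Rn d, ℂ)) :
    Continuous fun w => jet d M (trans w u) := by
  obtain ⟨B, -, hB⟩ := exists_weightedBound (M + 1) u
  rw [continuous_iff_continuousAt]
  intro w
  rw [ContinuousAt, tendsto_iff_norm_sub_tendsto_zero]
  have h1 : Tendsto (fun v => ‖v - w‖ * ((2 + ‖w‖) ^ M * B)) (𝓝 w) (𝓝 0) := by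
    have : Continuous fun v => ‖v - w‖ * ((2 + ‖w‖) ^ M * B) := by fun_prop
    simpa using this.tendsto w
  refine squeeze_zero' (Eventually.of_forall fun v => norm_nonneg _) ?_ h1
  filter_upwards [Metric.closedBall_mem_nhds w one_pos] with v hv
  rw [mem_closedBall_iff_norm] at hv
  rw [← map_sub]
  exact norm_jet_le (weightedBound_trans_sub hB w v hv)

theorem lineDerivOp_sconv {d : ℕ} (a b : 𝓢(Rn d, ℂ)) (v : Rn d) :
    LineDeriv.lineDerivOp v (sconv a b) = sconv a (LineDeriv.lineDerivOp v b) := by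
  have hg : (fun x : Rn d => inner ℝ x v).HasTemperateGrowth :=
    ((innerSL ℝ).flip v).hasTemperateGrowth
  refine ext_of_fourier fun ξ => ?_
  rw [fourier_sconv, SchwartzMap.fourier_lineDerivOp_eq, SchwartzMap.fourier_lineDerivOp_eq,
    _root_.smul_apply, _root_.smul_apply, SchwartzMap.smulLeftCLM_apply_apply hg,
    SchwartzMap.smulLeftCLM_apply_apply hg, fourier_sconv]
  simp only [smul_eq_mul, Complex.real_smul]
  ring

theorem iteratedFDeriv_sconv_apply {d : ℕ} (a b : 𝓢(Rn d, ℂ)) {n : ℕ} (m : Fin n → Rn d)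
    (x : Rn d) : iteratedFDeriv ℝ n (sconv a b) x m =
      ∫ w, a w * iteratedFDeriv ℝ n b (x - w) m := by
  have h : ∀ (n : ℕ) (m : Fin n → Rn d),
      LineDeriv.iteratedLineDerivOp m (sconv a b) =
        sconv a (LineDeriv.iteratedLineDerivOp m b) := by
    intro n
    induction n with
    | zero => intro m; rfl
    | succ n ih =>
      intro m
      rw [LineDeriv.iteratedLineDerivOp_succ_left, ih, lineDerivOp_sconv]
      rfl
  rw [← SchwartzMap.iteratedLineDerivOp_eq_iteratedFDeriv, h, sconv_apply]
  simp only [SchwartzMap.iteratedLineDerivOp_eq_iteratedFDeriv]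

theorem continuous_apply_trans {d : ℕ} (F : 𝓢'(Rn d, ℂ)) (u : 𝓢(Rn d, ℂ)) :
    Continuous fun w => F (trans w u) := by
  obtain ⟨M, L, hL⟩ := exists_jet_extension F
  exact (L.continuous.comp (continuous_jet_trans M u)).congr fun w => hL _

/-- A tempered distribution may be applied to a convolution under the integral sign. -/
theorem apply_sconv {d : ℕ} (F : 𝓢'(Rn d, ℂ)) (a b : 𝓢(Rn d, ℂ)) :
    F (sconv a b) = ∫ w, a w * F (trans w b) := by
  obtain ⟨M, L, hL⟩ := exists_jet_extension F
  obtain ⟨B, hB0, hB⟩ := exists_weightedBound M b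
  have hac := a.continuous
  have hcont : Continuous fun w => a w • jet d M (trans w b) :=
    hac.smul (continuous_jet_trans M b)
  have hint : Integrable fun w => a w • jet d M (trans w b) := by
    refine Integrable.mono' ((integrable_one_add_pow_mul a M).mul_const B)
      hcont.aestronglyMeasurable (Eventually.of_forall fun w => ?_)
    rw [norm_smul]
    calc _ ≤ ‖a w‖ * ((1 + ‖w‖) ^ M * B) := by
          gcongr
          exact norm_jet_le (hB.trans w)
      _ = _ := by ring
  have hval : ∫ w, a w • jet d M (trans w b) = jet d M (sconv a b) := by
    ext i
    have h := (BoundedContinuousFunction.evalCLM ℂ i).integral_comp_comm hint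
    change _ = (∫ w, a w • jet d M (trans w b)) i at h
    rw [← h, jet_apply, jetCoord, iteratedFDeriv_sconv_apply, ← integral_smul]
    congr 1 with w
    change a w • jetCoord i (trans w b) = _
    rw [jetCoord, iteratedFDeriv_trans, smul_eq_mul, mul_smul_comm]
  rw [← hL, ← hval, ← L.integral_comp_comm hint]
  congr 1 with w
  rw [map_smul, hL, smul_eq_mul]

theorem reflectAt_eq {d : ℕ} (φ : 𝓢(Rn d, ℂ)) (x : Rn d) : reflectAt φ x = trans x (refl φ) := rfl

theorem continuous_conv {d : ℕ} (φ : 𝓢(Rn d, ℂ)) (F : 𝓢'(Rn d, ℂ)) : Continuous (conv φ F) :=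
  continuous_apply_trans F (refl φ)

theorem refl_dil {d : ℕ} (j : ℤ) (a : 𝓢(Rn d, ℂ)) : refl (dil j a) = dil j (refl a) := by
  ext x
  simp [refl_apply, dil_apply]

/-- Polynomial growth of `φ_k ∗ F`, uniformly in the scale. -/
theorem IsDyadicFamily.exists_conv_growth {d : ℕ} {φ : ℕ → 𝓢(Rn d, ℂ)} (hφ : IsDyadicFamily φ)
    (F : 𝓢'(Rn d, ℂ)) : ∃ (M : ℕ) (C : ℝ), 0 ≤ C ∧ ∀ (k : ℕ) (z : Rn d),
      ‖conv (φ k) F z‖ ≤ C * (2 ^ (k * M) * (1 + ‖z‖) ^ M) := by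
  obtain ⟨b, -, hb⟩ := hφ
  obtain ⟨M, C, hC, hF⟩ := exists_weightedBound_le F
  obtain ⟨B₀, hB₀, h₀⟩ := exists_weightedBound M (refl (φ 0))
  obtain ⟨B₁, hB₁, h₁⟩ := exists_weightedBound M (refl b)
  refine ⟨M + (d + 1), C * (B₀ + B₁), by positivity, fun k z => ?_⟩
  have hz : (1 + ‖z‖) ^ M ≤ (1 + ‖z‖) ^ (M + (d + 1)) :=
    pow_le_pow_right₀ (by linarith [norm_nonneg z]) (by omega)
  rw [conv, reflectAt_eq]
  rcases Nat.eq_zero_or_pos k with rfl | hk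
  · refine (hF _ _ (h₀.trans z)).trans ?_
    rw [zero_mul, pow_zero, one_mul, mul_assoc]
    refine mul_le_mul_of_nonneg_left ?_ hC
    rw [mul_comm]
    exact mul_le_mul (by linarith) hz (by positivity) (by positivity)
  · rw [hb k hk, refl_dil]
    refine (hF _ _ ((h₁.dil k).trans z)).trans ?_
    rw [← pow_mul, mul_assoc]
    refine mul_le_mul_of_nonneg_left ?_ hC
    calc (1 + ‖z‖) ^ M * (2 ^ (k * (M + (d + 1))) * B₁)
        = B₁ * (2 ^ (k * (M + (d + 1))) * (1 + ‖z‖) ^ M) := by ring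
      _ ≤ _ := by
        refine mul_le_mul (by linarith) ?_ (by positivity) (by positivity)
        gcongr

/-- Approximate identities: `F(T_K ∗ u) → F(u)` if `T_K = 2^{Kn} T(2^K ·)` and `∫ T = 1`. -/
theorem tendsto_apply_sconv_dil {d : ℕ} (F : 𝓢'(Rn d, ℂ)) {T : 𝓢(Rn d, ℂ)} (hT : ∫ x, T x = 1)
    (u : 𝓢(Rn d, ℂ)) : Tendsto (fun K : ℕ => F (sconv (dil K T) u)) atTop (𝓝 (F u)) := by
  obtain ⟨M, C, hC, hF⟩ := exists_weightedBound_le F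
  obtain ⟨B, hB0, hB⟩ := exists_weightedBound M u
  have hTc := T.continuous
  have hFc := continuous_apply_trans F u
  have h1 : ∀ K : ℕ, F (sconv (dil K T) u) = ∫ w, T w * F (trans ((2 : ℝ) ^ (-(K : ℤ)) • w) u) :=
    fun K => by rw [apply_sconv, integral_dil_mul]
  have h2 : F u = ∫ w, T w * F (trans 0 u) := by
    rw [integral_mul_const, hT, one_mul]
    congr 1
    ext x
    simp
  simp only [h1]
  rw [h2]
  refine tendsto_integral_of_dominated_convergence (fun w => ((1 + ‖w‖) ^ M * ‖T w‖) * (C * B))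
    (fun K => (hTc.mul (hFc.comp (continuous_const_smul _))).aestronglyMeasurable)
    ((integrable_one_add_pow_mul T M).mul_const _)
    (fun K => Eventually.of_forall fun w => ?_) (Eventually.of_forall fun w => ?_)
  · have h3 : ‖(2 : ℝ) ^ (-(K : ℤ)) • w‖ ≤ ‖w‖ := by
      rw [norm_smul, Real.norm_of_nonneg (by positivity), zpow_neg, zpow_natCast]
      exact mul_le_of_le_one_left (norm_nonneg w)
        (inv_le_one_of_one_le₀ (one_le_pow₀ one_le_two))
    rw [norm_mul]
    calc _ ≤ ‖T w‖ * (C * ((1 + ‖w‖) ^ M * B)) := by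
          gcongr
          refine (hF _ _ (hB.trans _)).trans ?_
          gcongr
      _ = _ := by ring
  · refine Tendsto.const_mul _ ?_
    have h4 : Tendsto (fun K : ℕ => (2 : ℝ) ^ (-(K : ℤ)) • w) atTop (𝓝 0) := by
      have h5 : Tendsto (fun K : ℕ => (2⁻¹ : ℝ) ^ K) atTop (𝓝 0) :=
        tendsto_pow_atTop_nhds_zero_of_lt_one (by norm_num) (by norm_num)
      have h6 := h5.smul_const w
      rw [zero_smul] at h6
      refine h6.congr fun K => ?_
      rw [zpow_neg, zpow_natCast, inv_pow]
    exact (hFc.tendsto 0).comp h4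

/-! ### The extension operator -/

/-- The Littlewood-Paley sequence generated by `S`: `φ₀ = S` and `φ_j = S_j - S_{j-1}` with
`S_j = 2^{jn} S(2^j ·)`. -/
def lpFam {d : ℕ} (S : 𝓢(Rn d, ℂ)) (j : ℕ) : 𝓢(Rn d, ℂ) :=
  if j = 0 then S else dil j (S - dil (-1) S)

/-- The member `ψ₁(· / 2)` of the dual sequence. It comes from the factorization
`3a² - 2a³ - (3b² - 2b³) = (a - b) (3 (a + b) - 2 (a² + a b + b²))`. -/
def dualBase {d : ℕ} (S : 𝓢(Rn d, ℂ)) : 𝓢(Rn d, ℂ) :=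
  (3 : ℂ) • (S + dil (-1) S) -
    (2 : ℂ) • (sconv S S + sconv S (dil (-1) S) + sconv (dil (-1) S) (dil (-1) S))

/-- The sequence `(ψ_k)` with `∑_k φ_k ∗ ψ_k = δ₀`. -/
def dualFam {d : ℕ} (S : 𝓢(Rn d, ℂ)) (k : ℕ) : 𝓢(Rn d, ℂ) :=
  if k = 0 then (3 : ℂ) • S - (2 : ℂ) • sconv S S else dil k (dualBase S)

/-- The partial sums of `∑_k φ_k ∗ ψ_k` are the dilates of this function. -/
def reproducer {d : ℕ} (S : 𝓢(Rn d, ℂ)) : 𝓢(Rn d, ℂ) :=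
  (3 : ℂ) • sconv S S - (2 : ℂ) • sconv S (sconv S S)

theorem isDyadicFamily_lpFam {d : ℕ} {S : 𝓢(Rn d, ℂ)} (hS : DeltaLike S) :
    IsDyadicFamily (lpFam S) :=
  ⟨S - dil (-1) S, hS.sub (hS.dil _), fun j hj => if_neg (by omega)⟩

theorem DeltaLike.flat_dualBase {d : ℕ} {S : 𝓢(Rn d, ℂ)} (hS : DeltaLike S) :
    Flat (dualBase S) := by
  have hc := contDiff_fourier S
  have hc' := contDiff_fourier (LPDomain.dil (-1) S)
  have h1 := FlatAtZero.mul hS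
    (g := fun ξ => -3 - 2 * (𝓕 S ξ - 1) - 2 * (𝓕 (LPDomain.dil (-1) S) ξ - 1)) (by fun_prop)
  have h2 := FlatAtZero.mul (hS.dil (-1))
    (g := fun ξ => -3 - 2 * (𝓕 (LPDomain.dil (-1) S) ξ - 1)) (by fun_prop)
  have h3 := h1.add h2
  unfold Flat
  convert h3 using 2 with ξ
  simp only [dualBase, fourier_sub_apply, fourier_add_apply, fourier_smul_apply, fourier_sconv]
  ring

theorem isDyadicFamily_dualFam {d : ℕ} {S : 𝓢(Rn d, ℂ)} (hS : DeltaLike S) :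
    IsDyadicFamily (dualFam S) :=
  ⟨dualBase S, hS.flat_dualBase, fun k hk => if_neg (by omega)⟩

theorem DeltaLike.integral_reproducer {d : ℕ} {S : 𝓢(Rn d, ℂ)} (hS : DeltaLike S) :
    ∫ x, reproducer S x = 1 := by
  rw [← fourier_zero]
  simp only [reproducer, fourier_sub_apply, fourier_smul_apply, fourier_sconv]
  rw [fourier_zero, hS.integral_eq_one]
  norm_num

theorem fourier_lpFam_zero {d : ℕ} (S : 𝓢(Rn d, ℂ)) (ξ : Rn d) : 𝓕 (lpFam S 0) ξ = 𝓕 S ξ := by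
  rw [lpFam, if_pos rfl]

theorem fourier_lpFam_succ {d : ℕ} (S : 𝓢(Rn d, ℂ)) (k : ℕ) (ξ : Rn d) :
    𝓕 (lpFam S (k + 1)) ξ = 𝓕 (dil (k + 1 : ℕ) S) ξ - 𝓕 (dil k S) ξ := by
  rw [lpFam, if_neg (Nat.succ_ne_zero k), dil_sub, fourier_sub_apply, dil_dil]
  congr 4
  push_cast
  ring

theorem fourier_dualFam_succ {d : ℕ} (S : 𝓢(Rn d, ℂ)) (k : ℕ) (ξ : Rn d) :
    𝓕 (dualFam S (k + 1)) ξ = 3 * (𝓕 (dil (k + 1 : ℕ) S) ξ + 𝓕 (dil k S) ξ) -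
      2 * (𝓕 (dil (k + 1 : ℕ) S) ξ ^ 2 + 𝓕 (dil (k + 1 : ℕ) S) ξ * 𝓕 (dil k S) ξ +
        𝓕 (dil k S) ξ ^ 2) := by
  have e : 𝓕 (dil k S) ξ = 𝓕 (dil (-1) S) ((2 : ℝ) ^ (-((k + 1 : ℕ) : ℤ)) • ξ) := by
    rw [← fourier_dil, dil_dil]
    congr 3
    push_cast
    ring
  rw [dualFam, if_neg (Nat.succ_ne_zero k), fourier_dil, fourier_dil, e]
  simp only [dualBase, fourier_sub_apply, fourier_add_apply, fourier_smul_apply, fourier_sconv]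
  ring

/-- The sum telescopes, since `𝓕 φ_k 𝓕 ψ_k` is the difference of the values of `3t² - 2t³` at the
Fourier transforms of the dilates of `S` by `2^k` and `2^{k-1}`. -/
theorem sum_fourier_lpFam_mul_dualFam {d : ℕ} (S : 𝓢(Rn d, ℂ)) (ξ : Rn d) (K : ℕ) :
    ∑ k ∈ Finset.range (K + 1), 𝓕 (lpFam S k) ξ * 𝓕 (dualFam S k) ξ =
      𝓕 (dil K (reproducer S)) ξ := by
  have hrep : ∀ K : ℕ, 𝓕 (dil K (reproducer S)) ξ =
      3 * 𝓕 (dil K S) ξ ^ 2 - 2 * 𝓕 (dil K S) ξ ^ 3 := by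
    intro K
    rw [fourier_dil, fourier_dil]
    simp only [reproducer, fourier_sub_apply, fourier_smul_apply, fourier_sconv]
    ring
  induction K with
  | zero =>
    rw [hrep, Nat.cast_zero, dil_zero, zero_add, Finset.sum_range_one, fourier_lpFam_zero, dualFam,
      if_pos rfl]
    simp only [fourier_sub_apply, fourier_smul_apply, fourier_sconv]
    ring
  | succ K ih =>
    rw [Finset.sum_range_succ, ih, hrep, hrep, fourier_lpFam_succ, fourier_dualFam_succ]
    ring

theorem sum_apply_sconv_refl {d : ℕ} (S : 𝓢(Rn d, ℂ)) (F : 𝓢'(Rn d, ℂ)) (u : 𝓢(Rn d, ℂ)) (K : ℕ) :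
    ∑ k ∈ Finset.range (K + 1), F (sconv (sconv (refl (dualFam S k)) u) (refl (lpFam S k))) =
      F (sconv (dil K (refl (reproducer S))) u) := by
  rw [← map_sum]
  congr 1
  refine ext_of_fourier fun ξ => ?_
  have h : ∀ (s : Finset ℕ) (v : ℕ → 𝓢(Rn d, ℂ)), 𝓕 (∑ k ∈ s, v k) ξ = ∑ k ∈ s, 𝓕 (v k) ξ := by
    intro s v
    induction s using Finset.cons_induction with
    | empty =>
      rw [Finset.sum_empty, Finset.sum_empty, FourierTransform.fourier_zero]
      rfl
    | cons a s ha ih => rw [Finset.sum_cons, Finset.sum_cons, fourier_add_apply, ih]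
  rw [h, fourier_sconv, ← refl_dil, fourier_refl, ← sum_fourier_lpFam_mul_dualFam, Finset.sum_mul]
  refine Finset.sum_congr rfl fun k _ => ?_
  rw [fourier_sconv, fourier_sconv, fourier_refl, fourier_refl]
  ring

theorem integrable_inv_one_add_norm_pow (d : ℕ) :
    Integrable fun z : Rn d => ((1 + ‖z‖) ^ (d + 2))⁻¹ := by
  have h := integrable_one_add_norm (E := Rn d) (μ := volume) (r := (d + 2 : ℕ)) (by
    rw [finrank_euclideanSpace, Fintype.card_fin]
    exact_mod_cast Nat.lt_succ_self _)
  refine h.congr (Eventually.of_forall fun z => ?_)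
  simp only
  rw [Real.rpow_neg (by positivity), Real.rpow_natCast]

/-- The integrands that define the extension operator decay geometrically in the scale. -/
theorem exists_ext_integrand_bound {d : ℕ} {S : 𝓢(Rn d, ℂ)} (hS : DeltaLike S)
    (F : 𝓢'(Rn d, ℂ)) : ∃ q : Seminorm ℂ 𝓢(Rn d, ℂ), Continuous q ∧ ∃ C : ℝ, 0 ≤ C ∧
      ∀ (k : ℕ) (u : 𝓢(Rn d, ℂ)) (z : Rn d),
        ‖conv (lpFam S k) F z * sconv (refl (dualFam S k)) u z‖ ≤
          ((1 + ‖z‖) ^ (d + 2))⁻¹ * ((1 / 2) ^ k * (C * q u)) := by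
  obtain ⟨M, C, hC, h1⟩ := (isDyadicFamily_lpFam hS).exists_conv_growth F
  obtain ⟨q, hq, h2⟩ := (isDyadicFamily_dualFam hS).exists_sconv_refl_bound (M + 1) (M + (d + 2))
  refine ⟨q, hq, C, hC, fun k u z => ?_⟩
  have hq0 := apply_nonneg q u
  rw [norm_mul]
  calc _ ≤ (C * (2 ^ (k * M) * (1 + ‖z‖) ^ M)) *
        (((2 : ℝ) ^ (k * (M + 1)))⁻¹ * (((1 + ‖z‖) ^ (M + (d + 2)))⁻¹ * q u)) :=
        mul_le_mul (h1 k z) (h2 k u z) (norm_nonneg _) (by positivity)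
    _ = _ := by
      rw [mul_add, pow_add, pow_add, mul_one, one_div, inv_pow]
      field_simp

/-- The extension operator `f ↦ ∑_k ψ_k ∗ (1_U (φ_k ∗ f))` in weak form. -/
def extSum {d : ℕ} (S : 𝓢(Rn d, ℂ)) (U : Set (Rn d)) (F : 𝓢'(Rn d, ℂ)) (u : 𝓢(Rn d, ℂ)) : ℂ :=
  ∑' k, ∫ z in U, conv (lpFam S k) F z * sconv (refl (dualFam S k)) u z

theorem integrable_ext_integrand {d : ℕ} {S : 𝓢(Rn d, ℂ)} (hS : DeltaLike S)
    (F : 𝓢'(Rn d, ℂ)) (k : ℕ) (u : 𝓢(Rn d, ℂ)) :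
    Integrable fun z => conv (lpFam S k) F z * sconv (refl (dualFam S k)) u z := by
  obtain ⟨q, -, C, -, h⟩ := exists_ext_integrand_bound hS F
  exact ((integrable_inv_one_add_norm_pow d).mul_const _).mono'
    ((continuous_conv _ F).mul (sconv (refl (dualFam S k)) u).continuous).aestronglyMeasurable
    (Eventually.of_forall (h k u))

theorem exists_norm_ext_term_le {d : ℕ} {S : 𝓢(Rn d, ℂ)} (hS : DeltaLike S) (U : Set (Rn d))
    (F : 𝓢'(Rn d, ℂ)) : ∃ q : Seminorm ℂ 𝓢(Rn d, ℂ), Continuous q ∧ ∃ C : ℝ, 0 ≤ C ∧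
      ∀ (u : 𝓢(Rn d, ℂ)) (k : ℕ),
        ‖∫ z in U, conv (lpFam S k) F z * sconv (refl (dualFam S k)) u z‖ ≤
          (1 / 2) ^ k * (C * q u) := by
  obtain ⟨q, hq, C, hC, h⟩ := exists_ext_integrand_bound hS F
  have hI := integrable_inv_one_add_norm_pow d
  set I := ∫ z : Rn d, ((1 + ‖z‖) ^ (d + 2))⁻¹
  have hI0 : 0 ≤ I := integral_nonneg fun z => by positivity
  refine ⟨q, hq, I * C, by positivity, fun u k => ?_⟩
  have hq0 := apply_nonneg q u
  refine (norm_integral_le_of_norm_le (hI.mul_const _).integrableOn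
    (Eventually.of_forall (h k u))).trans ?_
  calc _ ≤ ∫ z : Rn d, ((1 + ‖z‖) ^ (d + 2))⁻¹ * ((1 / 2) ^ k * (C * q u)) :=
        setIntegral_le_integral (hI.mul_const _) (Eventually.of_forall fun z => by positivity)
    _ = _ := by rw [integral_mul_const]; ring

theorem summable_ext {d : ℕ} {S : 𝓢(Rn d, ℂ)} (hS : DeltaLike S) (U : Set (Rn d))
    (F : 𝓢'(Rn d, ℂ)) (u : 𝓢(Rn d, ℂ)) :
    Summable fun k => ∫ z in U, conv (lpFam S k) F z * sconv (refl (dualFam S k)) u z := by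
  obtain ⟨q, -, C, -, h⟩ := exists_norm_ext_term_le hS U F
  exact Summable.of_norm_bounded (summable_geometric_two.mul_right _) (h u)

theorem sconv_add {d : ℕ} (a u v : 𝓢(Rn d, ℂ)) : sconv a (u + v) = sconv a u + sconv a v := by
  unfold sconv
  exact map_add _ _ _

theorem sconv_smul {d : ℕ} (a u : 𝓢(Rn d, ℂ)) (c : ℂ) : sconv a (c • u) = c • sconv a u := by
  unfold sconv
  exact map_smul _ _ _

/-- The extension operator produces a tempered distribution. -/
theorem exists_extension {d : ℕ} {S : 𝓢(Rn d, ℂ)} (hS : DeltaLike S) (U : Set (Rn d))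
    (F : 𝓢'(Rn d, ℂ)) : ∃ G : 𝓢'(Rn d, ℂ), ∀ u, G u = extSum S U F u := by
  obtain ⟨q, hq, C, hC, h⟩ := exists_norm_ext_term_le hS U F
  obtain ⟨s, C', hC', hle⟩ := exists_seminorm_le_normComp q hq
  refine ⟨ContinuousLinearMap.toPointwiseConvergenceCLM _ _ _ _
    (SchwartzMap.mkCLMtoNormedSpace (extSum S U F)
    (fun u v => ?_) (fun c u => ?_) ⟨s, 2 * (C * C'), by positivity, fun u => ?_⟩), fun u => rfl⟩
  · unfold extSum
    rw [← (summable_ext hS U F u).tsum_add (summable_ext hS U F v)]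
    congr 1 with k
    rw [← integral_add (integrable_ext_integrand hS F k u).integrableOn
      (integrable_ext_integrand hS F k v).integrableOn, sconv_add]
    congr 1 with z
    exact mul_add _ _ _
  · unfold extSum
    rw [RingHom.id_apply, smul_eq_mul, ← tsum_mul_left]
    congr 1 with k
    rw [← integral_const_mul, sconv_smul]
    congr 1 with z
    exact mul_left_comm _ _ _
  · unfold extSum
    refine (tsum_of_norm_bounded (summable_geometric_two.mul_right (C * q u)).hasSum (h u)).trans ?_
    rw [tsum_mul_right, tsum_geometric_two]
    calc _ ≤ 2 * (C * (C' * s.sup (schwartzSeminormFamily ℂ (Rn d) ℂ) u)) := by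
          gcongr
          exact hle u
      _ = _ := by ring

/-- `Γ` is stable under sums and dilations, and `U` under subtraction of elements of `Γ`. Then for a
kernel supported in `Γ` the convolution on `U` depends only on the values on `U`. The main example is
a special Lipschitz domain `U` with its cone `Γ`. -/
structure IsAdmissible {d : ℕ} (Γ U : Set (Rn d)) : Prop where
  add_mem : ∀ x ∈ Γ, ∀ y ∈ Γ, x + y ∈ Γ
  smul_mem : ∀ c : ℝ, 0 < c → ∀ x ∈ Γ, c • x ∈ Γ
  sub_mem : ∀ x ∈ U, ∀ y ∈ Γ, x - y ∈ U

theorem support_dil_subset {d : ℕ} {Γ U : Set (Rn d)} (hΓ : IsAdmissible Γ U) {a : 𝓢(Rn d, ℂ)}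
    (ha : ∀ x, a x ≠ 0 → x ∈ Γ) (j : ℤ) (x : Rn d) (hx : dil j a x ≠ 0) : x ∈ Γ := by
  have h1 : a ((2 : ℝ) ^ j • x) ≠ 0 := fun h => hx (by rw [dil_apply, h, smul_zero])
  have h2 := hΓ.smul_mem ((2 : ℝ) ^ (-j)) (by positivity) _ (ha _ h1)
  rwa [smul_smul, ← zpow_add₀ two_ne_zero, neg_add_cancel, zpow_zero, one_smul] at h2

theorem support_sconv_subset {d : ℕ} {Γ U : Set (Rn d)} (hΓ : IsAdmissible Γ U)
    {a b : 𝓢(Rn d, ℂ)} (ha : ∀ x, a x ≠ 0 → x ∈ Γ) (hb : ∀ x, b x ≠ 0 → x ∈ Γ) (x : Rn d)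
    (hx : sconv a b x ≠ 0) : x ∈ Γ := by
  by_contra hxΓ
  refine hx ?_
  rw [sconv_apply]
  refine integral_eq_zero_of_ae (Eventually.of_forall fun t => ?_)
  by_contra h
  have h1 := hΓ.add_mem _ (ha t (left_ne_zero_of_mul h)) _ (hb _ (right_ne_zero_of_mul h))
  rw [add_sub_cancel] at h1
  exact hxΓ h1

theorem support_dualFam_subset {d : ℕ} {Γ U : Set (Rn d)} (hΓ : IsAdmissible Γ U)
    {S : 𝓢(Rn d, ℂ)} (hS : ∀ x, S x ≠ 0 → x ∈ Γ) (k : ℕ) (x : Rn d) (hx : dualFam S k x ≠ 0) :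
    x ∈ Γ := by
  have hS' := support_dil_subset hΓ hS (-1)
  have h1 := support_sconv_subset hΓ hS hS
  have h2 := support_sconv_subset hΓ hS hS'
  have h3 := support_sconv_subset hΓ hS' hS'
  unfold dualFam at hx
  split_ifs at hx
  · by_contra h
    have e1 : S x = 0 := not_not.1 fun h' => h (hS x h')
    have e2 : sconv S S x = 0 := not_not.1 fun h' => h (h1 x h')
    exact hx (by simp [e1, e2])
  · refine support_dil_subset hΓ (fun y hy => ?_) k x hx
    by_contra h
    have e1 : S y = 0 := not_not.1 fun h' => h (hS y h')
    have e2 : dil (-1) S y = 0 := not_not.1 fun h' => h (hS' y h')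
    have e3 : sconv S S y = 0 := not_not.1 fun h' => h (h1 y h')
    have e4 : sconv S (dil (-1) S) y = 0 := not_not.1 fun h' => h (h2 y h')
    have e5 : sconv (dil (-1) S) (dil (-1) S) y = 0 := not_not.1 fun h' => h (h3 y h')
    exact hy (by simp [dualBase, e1, e2, e3, e4, e5])

/-- On test functions supported in `U` the extension agrees with the given distribution. -/
theorem extSum_eq_of_support_subset {d : ℕ} {Γ U : Set (Rn d)} (hΓ : IsAdmissible Γ U)
    {S : 𝓢(Rn d, ℂ)} (hS : DeltaLike S) (hSΓ : ∀ x, S x ≠ 0 → x ∈ Γ) (F : 𝓢'(Rn d, ℂ))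
    {u : 𝓢(Rn d, ℂ)} (hu : ∀ x, u x ≠ 0 → x ∈ U) : extSum S U F u = F u := by
  have h1 : ∀ k, ∫ z in U, conv (lpFam S k) F z * sconv (refl (dualFam S k)) u z =
      F (sconv (sconv (refl (dualFam S k)) u) (refl (lpFam S k))) := by
    intro k
    rw [setIntegral_eq_integral_of_forall_compl_eq_zero fun z hz => ?_, apply_sconv]
    · congr 1 with z
      exact mul_comm _ _
    · have : sconv (refl (dualFam S k)) u z = 0 := by
        rw [sconv_refl_apply]
        refine integral_eq_zero_of_ae (Eventually.of_forall fun w => ?_)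
        by_contra h
        have h2 := hΓ.sub_mem _ (hu _ (right_ne_zero_of_mul h)) _
          (support_dualFam_subset hΓ hSΓ k w (left_ne_zero_of_mul h))
        rw [add_sub_cancel_right] at h2
        exact hz h2
      rw [this, mul_zero]
  have h2 := ((summable_ext hS U F u).hasSum.tendsto_sum_nat).comp (tendsto_add_atTop_nat 1)
  have h3 : ∫ x, refl (reproducer S) x = 1 := by
    rw [← hS.integral_reproducer, ← integral_neg_eq_self]
    simp [refl_apply]
  refine tendsto_nhds_unique h2 ((tendsto_apply_sconv_dil F h3 u).congr fun K => ?_)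
  simp only [Function.comp_apply, h1]
  exact (sum_apply_sconv_refl S F u K).symm

theorem sconv_refl_reflectAt {d : ℕ} (a b : 𝓢(Rn d, ℂ)) (x z : Rn d) :
    sconv (refl a) (reflectAt b x) z = sconv a b (x - z) := by
  rw [sconv_refl_apply, sconv_apply]
  congr 1 with w
  rw [reflectAt_apply]
  congr 2
  abel

/-- The Littlewood-Paley pieces of the extension are controlled by averages of the pieces of the
given distribution over `U`. The constants depend only on `S` and `θ`. -/
theorem IsDyadicFamily.exists_conv_extSum_le {d : ℕ} {θ : ℕ → 𝓢(Rn d, ℂ)} (hθ : IsDyadicFamily θ)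
    {S : 𝓢(Rn d, ℂ)} (hS : DeltaLike S) (N : ℕ) : ∃ C : ℝ≥0∞, C ≠ ∞ ∧
      ∀ (U : Set (Rn d)), MeasurableSet U → ∀ (F : 𝓢'(Rn d, ℂ)) (j : ℕ) (x : Rn d),
        ‖extSum S U F (reflectAt (θ j) x)‖ₑ ≤ C * scaleInt fun k z =>
          U.indicator (fun z => ‖conv (lpFam S k) F z‖ₑ) z * wt j k (x - z) ^ N := by
  obtain ⟨C, hC, h⟩ := hθ.exists_sconv_bound (isDyadicFamily_dualFam hS) N
  refine ⟨C, hC, fun U hU F j x => ?_⟩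
  unfold extSum
  rw [← scaleInt_const_mul hC]
  refine (enorm_tsum_le_tsum_enorm).trans (ENNReal.tsum_le_tsum fun k => ?_)
  refine (enorm_integral_le_lintegral_enorm _).trans ?_
  rw [← lintegral_indicator hU]
  refine lintegral_mono fun z => ?_
  by_cases hz : z ∈ U
  · simp only [Set.indicator_of_mem hz]
    rw [enorm_mul, sconv_refl_reflectAt]
    calc _ ≤ ‖conv (lpFam S k) F z‖ₑ * (C * (2 ^ (k * (d + 1)) * wt j k (x - z) ^ N)) :=
          mul_le_mul_right (h j k _) _
      _ = _ := by ring
  · simp only [Set.indicator_of_notMem hz]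
    exact zero_le

/-! ### Comparison of Littlewood-Paley sequences -/

theorem PowNorm.mono {d : ℕ} {X : (ℕ → Rn d → ℝ≥0∞) → ℝ≥0∞} (hX : PowNorm X)
    {g h : ℕ → Rn d → ℝ≥0∞} (hgh : ∀ k x, g k x ≤ h k x) : X g ≤ X h := by
  obtain ⟨m, 𝒩, h𝒩, hX⟩ := hX
  have hroot : ∀ g : ℕ → Rn d → ℝ≥0∞,
      g = fun k x => (g k x ^ (1 / ((m + 1 : ℕ) : ℝ))) ^ (m + 1) := by
    intro g
    funext k x
    rw [← ENNReal.rpow_natCast, ← ENNReal.rpow_mul, one_div_mul_cancel (by positivity),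
      ENNReal.rpow_one]
  rw [hroot g, hroot h, hX, hX]
  refine pow_le_pow_left' (h𝒩.mono_ae _ _ fun k => Eventually.of_forall fun x => ?_) _
  exact ENNReal.rpow_le_rpow (hgh k x) (by positivity)

/-- The sequence `1_U |φ_k ∗ F|`. -/
def absConvOn {d : ℕ} (U : Set (Rn d)) (φ : ℕ → 𝓢(Rn d, ℂ)) (F : 𝓢'(Rn d, ℂ)) (k : ℕ)
    (z : Rn d) : ℝ≥0∞ :=
  U.indicator (fun z => ‖conv (φ k) F z‖ₑ) z

theorem measurable_absConvOn {d : ℕ} {U : Set (Rn d)} (hU : MeasurableSet U)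
    (φ : ℕ → 𝓢(Rn d, ℂ)) (F : 𝓢'(Rn d, ℂ)) (k : ℕ) : Measurable (absConvOn U φ F k) :=
  (continuous_conv (φ k) F).measurable.enorm.indicator hU

/-- Temperedness in the form in which it enters the self-improvement argument. -/
theorem IsDyadicFamily.exists_absConvOn_mul_wt_le {d : ℕ} {φ : ℕ → 𝓢(Rn d, ℂ)}
    (hφ : IsDyadicFamily φ) (U : Set (Rn d)) (F : 𝓢'(Rn d, ℂ)) :
    ∃ M : ℕ, ∀ (j : ℕ) (x : Rn d), ∃ B : ℝ≥0∞, B ≠ ∞ ∧ ∀ (k : ℕ) (z : Rn d),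
      absConvOn U φ F k z * wt j k (x - z) ^ M ≤ B := by
  obtain ⟨M, C, hC, h⟩ := hφ.exists_conv_growth F
  refine ⟨M, fun j x => ⟨ENNReal.ofReal C * (2 ^ j * (1 + ‖x‖ₑ)) ^ M, by finiteness, fun k z => ?_⟩⟩
  have h1 : absConvOn U φ F k z ≤ ENNReal.ofReal C * (2 ^ k * (1 + ‖z‖ₑ)) ^ M := by
    refine (Set.indicator_le_self U _ z).trans ?_
    have h2 := ENNReal.ofReal_le_ofReal (h k z)
    rw [ofReal_norm] at h2
    refine h2.trans (le_of_eq ?_)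
    have e := ofReal_one_add_two_pow_mul 0 z
    rw [pow_zero, one_mul, pow_zero, one_mul] at e
    rw [ENNReal.ofReal_mul hC, mul_pow, ← pow_mul, ENNReal.ofReal_mul (by positivity),
      ENNReal.ofReal_pow (by norm_num), ENNReal.ofReal_pow (by positivity), e]
    simp
  have h2 : 2 ^ k * (1 + ‖z‖ₑ) * wt j k (x - z) ≤ 2 ^ j * (1 + ‖x‖ₑ) := by
    unfold wt
    rw [← div_eq_mul_inv]
    refine ENNReal.div_le_of_le_mul ?_
    have h3 : (2 : ℝ≥0∞) ^ k ≤ 2 ^ j * 2 ^ ((k : ℤ) - j).natAbs := by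
      rw [← pow_add]
      exact pow_le_pow_right₀ one_le_two (by omega)
    have h4 : 1 + ‖z‖ₑ ≤ (1 + ‖x‖ₑ) * (1 + 2 ^ k * ‖x - z‖ₑ) := by
      have h5 : ‖z‖ₑ ≤ ‖x‖ₑ + ‖x - z‖ₑ := by
        have := enorm_sub_le (a := x) (b := x - z)
        rwa [sub_sub_cancel] at this
      calc 1 + ‖z‖ₑ ≤ 1 + (‖x‖ₑ + 1 * ‖x - z‖ₑ) := by rw [one_mul]; gcongr
        _ ≤ 1 + (‖x‖ₑ + 2 ^ k * ‖x - z‖ₑ) := by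
          gcongr
          exact one_le_pow₀ one_le_two
        _ ≤ 1 + (‖x‖ₑ + 2 ^ k * ‖x - z‖ₑ) + ‖x‖ₑ * (2 ^ k * ‖x - z‖ₑ) := le_self_add
        _ = _ := by ring
    calc _ ≤ 2 ^ j * 2 ^ ((k : ℤ) - j).natAbs * ((1 + ‖x‖ₑ) * (1 + 2 ^ k * ‖x - z‖ₑ)) :=
          mul_le_mul' h3 h4
      _ = _ := by ring
  calc _ ≤ ENNReal.ofReal C * (2 ^ k * (1 + ‖z‖ₑ)) ^ M * wt j k (x - z) ^ M :=
        mul_le_mul_left h1 _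
    _ = ENNReal.ofReal C * (2 ^ k * (1 + ‖z‖ₑ) * wt j k (x - z)) ^ M := by
        rw [mul_pow _ (wt _ _ _)]
        ring
    _ ≤ _ := by gcongr

/-- The main estimate: the extension is bounded, uniformly in the set `U` and the distribution. -/
theorem PowNorm.exists_extension_bound {d : ℕ} {X : (ℕ → Rn d → ℝ≥0∞) → ℝ≥0∞} (hX : PowNorm X)
    (s : ℝ) {S : 𝓢(Rn d, ℂ)} (hS : DeltaLike S) {θ : ℕ → 𝓢(Rn d, ℂ)} (hθ : IsDyadicFamily θ) :
    ∃ C : ℝ≥0∞, C ≠ ∞ ∧ ∀ (Γ U : Set (Rn d)), IsAdmissible Γ U → MeasurableSet U →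
      (∀ x, S x ≠ 0 → x ∈ Γ) → ∀ F G : 𝓢'(Rn d, ℂ), (∀ u, G u = extSum S U F u) →
      X (fun j x => 2 ^ ((j : ℝ) * s) * ‖conv (θ j) G x‖ₑ) ≤
        C * X (fun j x => 2 ^ ((j : ℝ) * s) * absConvOn U (lpFam S) F j x) := by
  choose C₁ hC₁ h₁ using fun N => (isDyadicFamily_lpFam hS).exists_conv_extSum_le hS N
  choose C₂ hC₂ h₂ using fun N => hθ.exists_conv_extSum_le hS N
  obtain ⟨C, hC, hmain⟩ := hX.exists_le s (K := fun N => 1 + C₁ N + C₂ N)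
    (fun N => by simp [hC₁, hC₂]) (fun N => by rw [add_assoc]; exact le_self_add)
  refine ⟨C, hC, fun Γ U hΓ hU hSΓ F G hG => hmain _ (fun j x => ‖conv (θ j) G x‖ₑ)
    (measurable_absConvOn hU _ F) (fun N j x => ?_)
    ((isDyadicFamily_lpFam hS).exists_absConvOn_mul_wt_le U F) fun N j x => ?_⟩
  · by_cases hx : x ∈ U
    swap
    · rw [absConvOn, Set.indicator_of_notMem hx]
      exact zero_le
    rw [absConvOn, Set.indicator_of_mem hx]
    have hsupp : ∀ y, reflectAt (lpFam S j) x y ≠ 0 → y ∈ U := by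
      intro y hy
      rw [reflectAt_apply] at hy
      have h3 : x - y ∈ Γ := by
        unfold lpFam at hy
        split_ifs at hy
        · exact hSΓ _ hy
        · refine support_dil_subset hΓ (fun w hw => ?_) j _ hy
          by_contra h
          have e1 : S w = 0 := not_not.1 fun h' => h (hSΓ w h')
          have e2 : dil (-1) S w = 0 := not_not.1 fun h' => h (support_dil_subset hΓ hSΓ _ w h')
          exact hw (by simp [e1, e2])
      have h4 := hΓ.sub_mem x hx _ h3
      rwa [sub_sub_cancel] at h4
    rw [conv, ← extSum_eq_of_support_subset hΓ hS hSΓ F hsupp]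
    refine (h₁ N U hU F j x).trans (mul_le_mul_left ?_ _)
    exact le_add_self.trans le_self_add
  · rw [conv, hG]
    exact (h₂ N U hU F j x).trans (mul_le_mul_left le_add_self _)

theorem isAdmissible_univ (d : ℕ) : IsAdmissible (Set.univ : Set (Rn d)) Set.univ :=
  ⟨fun _ _ _ _ => trivial, fun _ _ _ _ => trivial, fun _ _ _ _ => trivial⟩

/-- Independence of the quasi-norm on the whole space of the Littlewood-Paley sequence. -/
theorem PowNorm.exists_change_bound {d : ℕ} {X : (ℕ → Rn d → ℝ≥0∞) → ℝ≥0∞} (hX : PowNorm X)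
    (s : ℝ) {S : 𝓢(Rn d, ℂ)} (hS : DeltaLike S) {θ : ℕ → 𝓢(Rn d, ℂ)} (hθ : IsDyadicFamily θ) :
    ∃ C : ℝ≥0∞, C ≠ ∞ ∧ ∀ F : 𝓢'(Rn d, ℂ),
      X (fun j x => 2 ^ ((j : ℝ) * s) * ‖conv (θ j) F x‖ₑ) ≤
        C * X (fun j x => 2 ^ ((j : ℝ) * s) * ‖conv (lpFam S j) F x‖ₑ) := by
  obtain ⟨C, hC, h⟩ := hX.exists_extension_bound s hS hθ
  refine ⟨C, hC, fun F => ?_⟩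
  have h1 := h Set.univ Set.univ (isAdmissible_univ d) MeasurableSet.univ (fun _ _ => trivial) F F
    fun u => (extSum_eq_of_support_subset (isAdmissible_univ d) hS (fun _ _ => trivial) F
      fun _ _ => trivial).symm
  simpa only [absConvOn, Set.indicator_univ] using h1

/-! ### Restriction of distributions and supports of test functions -/

/-- Truncation of a Schwartz function, with control of the error in the weighted norms. -/
theorem exists_truncation {d : ℕ} (u : 𝓢(Rn d, ℂ)) (M : ℕ) :
    ∃ B : ℝ, ∀ ε : ℝ, 0 < ε → ε ≤ 1 → ∃ v : 𝓢(Rn d, ℂ),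
      HasCompactSupport v ∧ tsupport v ⊆ tsupport u ∧ WeightedBound M (v - u) (ε * B) := by
  obtain ⟨B, hB0, hB⟩ := exists_weightedBound (M + 1) u
  let b : ContDiffBump (0 : Rn d) := ⟨1, 2, one_pos, one_lt_two⟩
  have hbc : HasCompactSupport fun x => (b x : ℂ) :=
    b.hasCompactSupport.comp_left Complex.ofReal_zero
  have hbs : ContDiff ℝ (⊤ : ℕ∞) fun x => (b x : ℂ) := Complex.ofRealCLM.contDiff.comp b.contDiff
  let S : 𝓢(Rn d, ℂ) := hbc.toSchwartzMap hbs
  have hSb : ∀ x, S x = b x := fun x => rfl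
  obtain ⟨A, hA0, hA⟩ := exists_weightedBound (M + 1) S
  refine ⟨2 ^ M * (A + 1) * B, fun ε hε hε1 => ?_⟩
  have hSs : ContDiff ℝ (⊤ : ℕ∞) S := S.smooth ⊤
  let g : Rn d → ℂ := fun x => S (ε • x)
  have hgs : ContDiff ℝ (⊤ : ℕ∞) g := hSs.comp (contDiff_const_smul ε)
  have hgc : HasCompactSupport g := by
    have h : HasCompactSupport S := hbc
    exact h.comp_smul hε.ne'
  have hgt : g.HasTemperateGrowth := hgc.hasTemperateGrowth hgs
  have hval : ∀ x, SchwartzMap.smulLeftCLM ℂ g u x = g x * u x := fun x => by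
    rw [SchwartzMap.smulLeftCLM_apply_apply hgt, smul_eq_mul]
  have hsub := SchwartzMap.tsupport_smulLeftCLM_subset (F := ℂ) g u
  refine ⟨SchwartzMap.smulLeftCLM ℂ g u, ?_, fun x hx => (hsub hx).1, fun n hn x => ?_⟩
  · exact hgc.of_isClosed_subset (isClosed_tsupport _) fun x hx => (hsub hx).2
  have hfun : ((SchwartzMap.smulLeftCLM ℂ g u - u : 𝓢(Rn d, ℂ)) : Rn d → ℂ) =
      fun x => (g x - 1) * u x := by
    funext x
    rw [_root_.sub_apply, hval]
    ring
  rw [hfun]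
  rcases lt_or_ge ‖ε • x‖ 1 with hx | hx
  · -- the error vanishes near `x`
    have h0 : (fun x => (g x - 1) * u x) =ᶠ[𝓝 x] fun _ => 0 := by
      have ho : IsOpen {y : Rn d | ‖ε • y‖ < 1} :=
        isOpen_lt (continuous_const_smul ε).norm continuous_const
      filter_upwards [ho.mem_nhds hx] with y hy
      have : b (ε • y) = 1 := b.one_of_mem_closedBall (by simpa using le_of_lt hy)
      simp [g, hSb, this]
    rw [(h0.iteratedFDeriv ℝ n).eq_of_nhds]
    have : iteratedFDeriv ℝ n (fun _ : Rn d => (0 : ℂ)) x = 0 := by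
      simp
    rw [this, norm_zero, mul_zero]
    positivity
  · have h1 : 1 ≤ ε * (1 + ‖x‖) := by
      rw [norm_smul, Real.norm_of_nonneg hε.le] at hx
      nlinarith
    have hg1 : ContDiff ℝ (⊤ : ℕ∞) fun x => g x - 1 := hgs.sub contDiff_const
    have hgb : ∀ i ≤ M, ‖iteratedFDeriv ℝ i (fun x => g x - 1) x‖ ≤ A + 1 := by
      intro i hi
      have e : iteratedFDeriv ℝ i (fun x => g x - 1) x =
          iteratedFDeriv ℝ i g x - iteratedFDeriv ℝ i (fun _ => (1 : ℂ)) x :=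
        iteratedFDeriv_sub_apply (hgs.of_le (mod_cast le_top)).contDiffAt contDiffAt_const
      rw [e]
      refine (norm_sub_le _ _).trans (add_le_add ?_ ?_)
      · have e2 := congrFun (iteratedFDeriv_comp_const_smul (i := i) ε
          (hSs.of_le (mod_cast le_top))) x
        rw [show g = fun x => S (ε • x) from rfl, e2, norm_smul, norm_pow,
          Real.norm_of_nonneg hε.le]
        have h2 := hA i (by omega) (ε • x)
        have h3 : ‖iteratedFDeriv ℝ i S (ε • x)‖ ≤ A :=
          le_trans (le_mul_of_one_le_left (norm_nonneg _)
            (one_le_pow₀ (by linarith [norm_nonneg (ε • x)]))) h2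
        exact (mul_le_of_le_one_left (norm_nonneg _) (pow_le_one₀ hε.le hε1)).trans h3
      · rcases i with _ | i
        · simp
        · rw [iteratedFDeriv_const_of_ne (Nat.succ_ne_zero i)]
          simp
    have hmul := norm_iteratedFDeriv_mul_le (N := (⊤ : ℕ∞)) hg1 (u.smooth ⊤) x (n := n)
      (mod_cast le_top)
    have hX : 0 ≤ 1 + ‖x‖ := by positivity
    calc (1 + ‖x‖) ^ M * ‖iteratedFDeriv ℝ n (fun x => (g x - 1) * u x) x‖
        ≤ (1 + ‖x‖) ^ M * ∑ i ∈ Finset.range (n + 1), (n.choose i : ℝ) *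
            ‖iteratedFDeriv ℝ i (fun x => g x - 1) x‖ * ‖iteratedFDeriv ℝ (n - i) u x‖ := by
          gcongr
      _ = ∑ i ∈ Finset.range (n + 1), (n.choose i : ℝ) *
            ‖iteratedFDeriv ℝ i (fun x => g x - 1) x‖ *
            ((1 + ‖x‖) ^ M * ‖iteratedFDeriv ℝ (n - i) u x‖) := by
          rw [Finset.mul_sum]
          exact Finset.sum_congr rfl fun i _ => by ring
      _ ≤ ∑ i ∈ Finset.range (n + 1), (n.choose i : ℝ) * (A + 1) * (ε * B) := by
          refine Finset.sum_le_sum fun i hi => ?_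
          rw [Finset.mem_range] at hi
          refine mul_le_mul ?_ ?_ (by positivity) (by positivity)
          · gcongr
            exact hgb i (by omega)
          · calc _ ≤ ε * (1 + ‖x‖) * ((1 + ‖x‖) ^ M * ‖iteratedFDeriv ℝ (n - i) u x‖) :=
                  le_mul_of_one_le_left (by positivity) h1
              _ = ε * ((1 + ‖x‖) ^ (M + 1) * ‖iteratedFDeriv ℝ (n - i) u x‖) := by ring
              _ ≤ _ := by gcongr; exact hB _ (by omega) x
      _ = 2 ^ n * (A + 1) * (ε * B) := by
          rw [← Finset.sum_mul, ← Finset.sum_mul, ← Nat.cast_sum, Nat.sum_range_choose]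
          push_cast
          rfl
      _ ≤ 2 ^ M * (A + 1) * (ε * B) := by
          gcongr
          norm_num
      _ = _ := by ring

/-- Two distributions that agree on `U` agree on all Schwartz functions with support in `U`. -/
theorem apply_eq_of_restr_eq {d : ℕ} {U : Set (Rn d)} {F G : 𝓢'(Rn d, ℂ)}
    (h : restr U F = restr U G) {u : 𝓢(Rn d, ℂ)} (hu : tsupport u ⊆ U) : F u = G u := by
  obtain ⟨M₁, C₁, hC₁, h₁⟩ := exists_weightedBound_le F
  obtain ⟨M₂, C₂, hC₂, h₂⟩ := exists_weightedBound_le G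
  obtain ⟨B₁, hB₁⟩ := exists_truncation u (max M₁ M₂)
  have hmono : ∀ {M N : ℕ} {v : 𝓢(Rn d, ℂ)} {B : ℝ}, M ≤ N → WeightedBound N v B →
      WeightedBound M v B := fun {M N v B} hMN hv n hn x => by
    refine le_trans ?_ (hv n (hn.trans hMN) x)
    gcongr
    linarith [norm_nonneg x]
  have key : ∀ ε : ℝ, 0 < ε → ε ≤ 1 → ‖F u - G u‖ ≤ ε * ((C₁ + C₂) * B₁) := by
    intro ε hε hε1
    obtain ⟨v, hvc, hvs, hv⟩ := hB₁ ε hε hε1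
    have e : F v = G v := congrFun h ⟨v, hvc, hvs.trans hu⟩
    have e2 : F u - G u = G (v - u) - F (v - u) := by
      rw [map_sub, map_sub, e]
      ring
    rw [e2]
    refine (norm_sub_le _ _).trans ?_
    have h3 := h₁ _ _ (hmono (le_max_left _ _) hv)
    have h4 := h₂ _ _ (hmono (le_max_right _ _) hv)
    linarith
  have hlim : Tendsto (fun k : ℕ => (1 / ((k : ℝ) + 1)) * ((C₁ + C₂) * B₁)) atTop (𝓝 0) := by
    have := (tendsto_one_div_add_atTop_nhds_zero_nat (𝕜 := ℝ)).mul_const ((C₁ + C₂) * B₁)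
    rwa [zero_mul] at this
  have h5 : ‖F u - G u‖ ≤ 0 := ge_of_tendsto' hlim fun k => key _ (by positivity)
    (by rw [div_le_one (by positivity)]; linarith [k.cast_nonneg (α := ℝ)])
  exact sub_eq_zero.1 (norm_le_zero_iff.1 h5)

theorem tsupport_reflectAt_subset {d : ℕ} {Γ U : Set (Rn d)} (hΓ : IsAdmissible Γ U)
    {φ : 𝓢(Rn d, ℂ)} (hφ : tsupport φ ⊆ Γ) {x : Rn d} (hx : x ∈ U) :
    tsupport (reflectAt φ x) ⊆ U := by
  have h : tsupport (reflectAt φ x) ⊆ (fun y => x - y) ⁻¹' tsupport φ := by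
    refine closure_minimal (fun y hy => ?_)
      ((isClosed_tsupport φ).preimage (continuous_const.sub continuous_id))
    rw [Function.mem_support, reflectAt_apply] at hy
    exact subset_tsupport _ hy
  intro y hy
  have h2 := hΓ.sub_mem x hx _ (hφ (h hy))
  rwa [sub_sub_cancel] at h2

theorem absConvOn_congr {d : ℕ} {Γ U : Set (Rn d)} (hΓ : IsAdmissible Γ U)
    {φ : ℕ → 𝓢(Rn d, ℂ)} (hφ : ∀ j, tsupport (φ j) ⊆ Γ) {F G : 𝓢'(Rn d, ℂ)}
    (h : restr U F = restr U G) : absConvOn U φ F = absConvOn U φ G := by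
  funext j x
  by_cases hx : x ∈ U
  · rw [absConvOn, absConvOn, Set.indicator_of_mem hx, Set.indicator_of_mem hx, conv, conv,
      apply_eq_of_restr_eq h (tsupport_reflectAt_subset hΓ (hφ j) hx)]
  · rw [absConvOn, absConvOn, Set.indicator_of_notMem hx, Set.indicator_of_notMem hx]

/-! ### Special Lipschitz domains and their cones -/

theorem continuous_head (d : ℕ) : Continuous (head : Rn d → EuclideanSpace ℝ (Fin d)) := by
  unfold head
  fun_prop

theorem continuous_last (d : ℕ) : Continuous (last : Rn d → ℝ) := by
  unfold last
  fun_prop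

/-- The essential supremum of the gradient is a Lipschitz constant. Almost every line parallel to
a given direction meets the exceptional set of Rademacher's theorem in a null set, and along such
a line `ρ` is the integral of its derivative. -/
theorem abs_sub_le_gradSup_mul {d : ℕ} {ρ : EuclideanSpace ℝ (Fin d) → ℝ} {K : ℝ≥0}
    (hρ : LipschitzWith K ρ) (x h : EuclideanSpace ℝ (Fin d)) :
    |ρ (x + h) - ρ x| ≤ gradSup ρ * ‖h‖ := by
  have hnorm : ∀ z, ‖gradient ρ z‖ = ‖fderiv ℝ ρ z‖ := fun z => by simp [gradient]
  have hfin : eLpNorm (gradient ρ) ∞ volume ≠ ∞ := by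
    rw [eLpNorm_exponent_top]
    refine ne_top_of_le_ne_top (b := (K : ℝ≥0∞)) (by finiteness) ?_
    refine eLpNormEssSup_le_of_ae_nnnorm_bound (Eventually.of_forall fun z => ?_)
    rw [← NNReal.coe_le_coe, coe_nnnorm, hnorm]
    exact norm_fderiv_le_of_lipschitz ℝ hρ
  have hae : ∀ᵐ z, DifferentiableAt ℝ ρ z ∧ ‖fderiv ℝ ρ z‖ ≤ gradSup ρ := by
    filter_upwards [hρ.ae_differentiableAt, enorm_ae_le_eLpNormEssSup (gradient ρ) volume]
      with z hz hz2
    refine ⟨hz, ?_⟩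
    rw [← hnorm, gradSup, ← toReal_enorm]
    rw [eLpNorm_exponent_top] at hfin ⊢
    exact ENNReal.toReal_mono hfin hz2
  obtain ⟨t, ht, htm, ht0⟩ := exists_measurable_superset_of_null (ae_iff.1 hae)
  have hs : ∀ z ∈ tᶜ, DifferentiableAt ℝ ρ z ∧ ‖fderiv ℝ ρ z‖ ≤ gradSup ρ :=
    fun z hz => not_not.1 fun h => hz (ht h)
  have hsm := htm.compl
  have hline : ∀ᵐ z : EuclideanSpace ℝ (Fin d), ∀ᵐ r : ℝ, z + r • h ∈ tᶜ := by
    have hm : MeasurableSet {w : ℝ × EuclideanSpace ℝ (Fin d) | w.2 + w.1 • h ∈ tᶜ} :=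
      hsm.preimage (by fun_prop)
    rw [← Measure.ae_ae_comm hm]
    refine Eventually.of_forall fun r => ?_
    have hr0 : volume ((fun z => z + r • h) ⁻¹' t) = 0 :=
      (measure_preimage_add_right volume (r • h) t).trans ht0
    exact measure_eq_zero_iff_ae_notMem.1 hr0
  have hgood : ∀ᵐ z, |ρ (z + h) - ρ z| ≤ gradSup ρ * ‖h‖ := by
    filter_upwards [hline] with z hz
    have hlip : LipschitzWith (K * ‖h‖₊) fun t : ℝ => ρ (z + t • h) := by
      refine hρ.comp (LipschitzWith.of_dist_le_mul fun t t' => ?_)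
      rw [dist_add_left, dist_eq_norm, ← sub_smul, norm_smul, mul_comm]
      rfl
    have hint := (hlip.lipschitzOnWith.absolutelyContinuousOnInterval (a := 0)
      (b := 1)).integral_deriv_eq_sub
    have hb := intervalIntegral.norm_integral_le_of_norm_le_const_ae (a := 0) (b := 1)
      (f := deriv fun t : ℝ => ρ (z + t • h)) (C := gradSup ρ * ‖h‖) (by
        filter_upwards [hz] with r hr _
        obtain ⟨h1, h2⟩ := hs _ hr
        have h3 : HasDerivAt (fun t : ℝ => z + t • h) h r := by
          have := ((hasDerivAt_id r).smul_const h).const_add z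
          rwa [one_smul] at this
        have h4 : HasDerivAt (fun r : ℝ => ρ (z + r • h)) (fderiv ℝ ρ (z + r • h) h) r :=
          h1.hasFDerivAt.comp_hasDerivAt r h3
        rw [h4.deriv]
        refine (ContinuousLinearMap.le_opNorm _ _).trans ?_
        gcongr)
    rw [hint, one_smul, zero_smul, add_zero] at hb
    simpa using hb
  have hcl : IsClosed {z | |ρ (z + h) - ρ z| ≤ gradSup ρ * ‖h‖} := by
    have := hρ.continuous
    exact isClosed_le (by fun_prop) continuous_const
  have := (Measure.dense_of_ae hgood).closure_eq
  rw [hcl.closure_eq] at this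
  exact this.ge (Set.mem_univ x)

/-- The cone `{xₙ < -‖∇ρ‖ |x'|}`. -/
def cone {d : ℕ} (ρ : EuclideanSpace ℝ (Fin d) → ℝ) : Set (Rn d) :=
  {x | last x < -(gradSup ρ) * ‖head x‖}

theorem isOpen_epigraph {d : ℕ} {ρ : EuclideanSpace ℝ (Fin d) → ℝ} (hρ : Continuous ρ) :
    IsOpen (epigraph ρ) :=
  isOpen_lt (hρ.comp (continuous_head d)) (continuous_last d)

/-- The cone is convex, and the domain is stable under subtraction of the cone. -/
theorem isAdmissible_epigraph {d : ℕ} {ρ : EuclideanSpace ℝ (Fin d) → ℝ} {K : ℝ≥0}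
    (hρ : LipschitzWith K ρ) : IsAdmissible (cone ρ) (epigraph ρ) := by
  have h0 : 0 ≤ gradSup ρ := ENNReal.toReal_nonneg
  have hadd : ∀ x y : Rn d, head (x + y) = head x + head y := fun x y => rfl
  have hsub : ∀ x y : Rn d, head (x - y) = head x - head y := fun x y => rfl
  have hsmul : ∀ (c : ℝ) (x : Rn d), head (c • x) = c • head x := fun c x => rfl
  refine ⟨fun x hx y hy => ?_, fun c hc x hx => ?_, fun x hx y hy => ?_⟩
  · simp only [cone, Set.mem_ofPred_eq] at hx hy ⊢
    have h1 : last (x + y) = last x + last y := rfl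
    have h2 := mul_le_mul_of_nonneg_left (norm_add_le (head x) (head y)) h0
    rw [hadd, h1]
    linarith
  · simp only [cone, Set.mem_ofPred_eq] at hx ⊢
    have h1 : last (c • x) = c * last x := rfl
    rw [hsmul, h1, norm_smul, Real.norm_of_nonneg hc.le]
    nlinarith
  · simp only [cone, epigraph, Set.mem_ofPred_eq] at hx hy ⊢
    have h1 : last (x - y) = last x - last y := rfl
    have h2 := (abs_le.1 (abs_sub_le_gradSup_mul hρ (head x) (-head y))).2
    rw [norm_neg, ← sub_eq_add_neg] at h2
    rw [hsub, h1]
    linarith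

/-! ### Littlewood-Paley families are generated by their first member -/

/-- Vanishing of the moments in terms of the Fourier transform. -/
theorem flat_of_moment {d : ℕ} {a : 𝓢(Rn d, ℂ)}
    (h : ∀ α : Fin (d + 1) → ℕ, ∫ x : Rn d, (∏ i, x i ^ α i : ℝ) • a x = 0) : Flat a := by
  refine ⟨contDiff_fourier a, fun n => ?_⟩
  have hint : ∀ k : ℕ, Integrable fun v : Rn d => ‖v‖ ^ k * ‖a v‖ := fun k =>
    a.integrable_pow_mul volume k
  have hmeas := a.continuous.aestronglyMeasurable (μ := volume)
  rw [SchwartzMap.fourier_coe, congrFun (Real.iteratedFDeriv_fourier (N := (⊤ : ℕ∞))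
    (fun k _ => hint k) hmeas (n := n) le_top) 0, Real.fourier_eq]
  simp only [inner_zero_right, neg_zero, AddChar.map_zero_eq_one, one_smul]
  have hI : Integrable fun v => VectorFourier.fourierPowSMulRight (innerSL ℝ) (a : Rn d → ℂ) v n :=
    VectorFourier.integrable_fourierPowSMulRight _ (hint n) hmeas
  refine ContinuousMultilinearMap.toMultilinearMap_injective
    (Module.Basis.ext_multilinear (fun _ => (EuclideanSpace.basisFun (Fin (d + 1)) ℝ).toBasis)
      fun k => ?_)
  have e := (ContinuousMultilinearMap.apply ℝ (fun _ : Fin n => Rn d) ℂ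
    fun i => (EuclideanSpace.basisFun (Fin (d + 1)) ℝ).toBasis (k i)).integral_comp_comm hI
  refine Eq.trans e.symm ?_
  have e2 : ∀ x : Rn d, ∏ i, x (k i) = ∏ l, x l ^ (Finset.univ.filter fun i => k i = l).card := by
    intro x
    rw [← Finset.prod_fiberwise Finset.univ k fun i => x (k i)]
    refine Finset.prod_congr rfl fun l _ => ?_
    have hl : ∀ i ∈ Finset.univ.filter fun i => k i = l, x (k i) = x l := fun i hi => by
      rw [(Finset.mem_filter.1 hi).2]
    rw [Finset.prod_congr rfl hl, Finset.prod_const]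
  have e3 : ∀ x : Rn d, ContinuousMultilinearMap.apply ℝ (fun _ : Fin n => Rn d) ℂ
      (fun i => (EuclideanSpace.basisFun (Fin (d + 1)) ℝ).toBasis (k i))
      (VectorFourier.fourierPowSMulRight (innerSL ℝ) (a : Rn d → ℂ) x n) =
      (-(2 * Real.pi * Complex.I)) ^ n •
        ((∏ l, x l ^ (Finset.univ.filter fun i => k i = l).card : ℝ) • a x) := by
    intro x
    have he : ∀ i, innerSL ℝ x ((EuclideanSpace.basisFun (Fin (d + 1)) ℝ).toBasis (k i)) =
        x (k i) := fun i => by simp [EuclideanSpace.inner_single_right]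
    rw [ContinuousMultilinearMap.apply_apply, VectorFourier.fourierPowSMulRight_apply, ← e2]
    simp only [he]
  simp only [e3]
  rw [integral_smul, h, smul_zero]
  rfl

theorem exists_apply_zero_eq_one (d : ℕ) : ∃ g : 𝓢(Rn d, ℂ), g 0 = 1 := by
  let b : ContDiffBump (0 : Rn d) := ⟨1, 2, one_pos, one_lt_two⟩
  have hbc : HasCompactSupport fun x => (b x : ℂ) :=
    b.hasCompactSupport.comp_left Complex.ofReal_zero
  have hbs : ContDiff ℝ (⊤ : ℕ∞) fun x => (b x : ℂ) := Complex.ofRealCLM.contDiff.comp b.contDiff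
  refine ⟨hbc.toSchwartzMap hbs, ?_⟩
  have : b 0 = 1 := b.one_of_mem_closedBall (by simp [b])
  exact congrArg Complex.ofReal this

theorem integrable_mul {d : ℕ} (a g : 𝓢(Rn d, ℂ)) : Integrable fun x => a x * g x := by
  obtain ⟨B, hB0, hB⟩ := exists_weightedBound 0 g
  refine a.integrable.mul_bdd (c := B) g.continuous.aestronglyMeasurable
    (Eventually.of_forall fun x => ?_)
  simpa using hB 0 le_rfl x

theorem eq_zero_of_integral_mul_eq_zero {d : ℕ} {T : 𝓢(Rn d, ℂ)}
    (h : ∀ g : 𝓢(Rn d, ℂ), ∫ x, T x * g x = 0) : T = 0 := by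
  have h1 : ∀ᵐ x, T x = 0 := by
    refine ae_eq_zero_of_integral_contDiff_smul_eq_zero T.continuous.locallyIntegrable
      fun g hg hgc => ?_
    have hbc : HasCompactSupport fun x => (g x : ℂ) := hgc.comp_left Complex.ofReal_zero
    have hbs : ContDiff ℝ (⊤ : ℕ∞) fun x => (g x : ℂ) := Complex.ofRealCLM.contDiff.comp hg
    rw [← h (hbc.toSchwartzMap hbs)]
    congr 1 with x
    rw [Complex.real_smul, mul_comm]
    rfl
  ext x
  exact congrFun (T.continuous.ae_eq_iff_eq volume continuous_const |>.1 h1) x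

theorem tendsto_integral_dil_mul {d : ℕ} (S g : 𝓢(Rn d, ℂ)) :
    Tendsto (fun J : ℕ => ∫ x, dil J S x * g x) atTop (𝓝 ((∫ x, S x) * g 0)) := by
  obtain ⟨B, hB0, hB⟩ := exists_weightedBound 0 g
  simp only [integral_dil_mul]
  rw [← integral_mul_const]
  refine tendsto_integral_of_dominated_convergence (fun x => ‖S x‖ * B)
    (fun J => (S.continuous.mul (g.continuous.comp
      (continuous_const_smul _))).aestronglyMeasurable) (S.integrable.norm.mul_const _)
    (fun J => Eventually.of_forall fun x => ?_) (Eventually.of_forall fun x => ?_)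
  · rw [norm_mul]
    gcongr
    simpa using hB 0 le_rfl ((2 : ℝ) ^ (-(J : ℤ)) • x)
  · refine Tendsto.const_mul _ ?_
    have h5 : Tendsto (fun K : ℕ => (2⁻¹ : ℝ) ^ K) atTop (𝓝 0) :=
      tendsto_pow_atTop_nhds_zero_of_lt_one (by norm_num) (by norm_num)
    have h6 := h5.smul_const x
    rw [zero_smul] at h6
    refine (g.continuous.tendsto 0).comp (h6.congr fun K => ?_)
    rw [zpow_neg, zpow_natCast, inv_pow]

/-- If `2^n a(2 ·) - a` has vanishing moments and `∫ a = 1`, then `a` has the moments of `δ₀`: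
for `s = 𝓕 a - 1` and `n ≥ 1` one has `(2^{-n} - 1) D^n s(0) = 0`. -/
theorem deltaLike_of_flat_sub {d : ℕ} {a : 𝓢(Rn d, ℂ)} (ha : ∫ x, a x = 1)
    (h : Flat (dil 1 a - a)) : DeltaLike a := by
  have hc : ContDiff ℝ (⊤ : ℕ∞) fun ξ => 𝓕 a ξ - 1 := (contDiff_fourier a).sub contDiff_const
  refine ⟨hc, fun n => ?_⟩
  have hn : ((n : ℕ∞) : WithTop ℕ∞) ≤ ((⊤ : ℕ∞) : WithTop ℕ∞) := by exact_mod_cast le_top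
  rcases eq_or_ne n 0 with rfl | hn0
  · ext m
    simp [fourier_zero, ha]
  have h1 := h.2 n
  have e : ((𝓕 (dil 1 a - a) : 𝓢(Rn d, ℂ)) : Rn d → ℂ) =
      (fun ξ => (fun ξ => 𝓕 a ξ - 1) ((2 : ℝ)⁻¹ • ξ)) - fun ξ => 𝓕 a ξ - 1 := by
    funext ξ
    rw [fourier_sub_apply, fourier_dil]
    simp
  have hc' : ContDiff ℝ (⊤ : ℕ∞) fun ξ => (fun ξ => 𝓕 a ξ - 1) ((2 : ℝ)⁻¹ • ξ) :=
    hc.comp (contDiff_const_smul _)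
  rw [e, iteratedFDeriv_sub_apply (hc'.of_le hn).contDiffAt (hc.of_le hn).contDiffAt,
    congrFun (iteratedFDeriv_comp_const_smul (i := n) (2 : ℝ)⁻¹ (hc.of_le hn)) 0, smul_zero] at h1
  have h2 : ((2 : ℝ)⁻¹ ^ n - 1) • iteratedFDeriv ℝ n (fun ξ => 𝓕 a ξ - 1) 0 = 0 := by
    rw [sub_smul, one_smul, h1]
  refine (smul_eq_zero.1 h2).resolve_left (sub_ne_zero.2 (ne_of_lt ?_))
  exact pow_lt_one₀ (by norm_num) (by norm_num) hn0

theorem IsLPFamily.eq_dil {d : ℕ} {ρ : EuclideanSpace ℝ (Fin d) → ℝ} {φ : ℕ → 𝓢(Rn d, ℂ)}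
    (hφ : IsLPFamily ρ φ) (j : ℕ) : φ (j + 1) = dil j (φ 1) := by
  rcases j with _ | j
  · rw [Nat.cast_zero, dil_zero]
  · ext x
    rw [hφ.scaling _ (by omega), dil_apply, zpow_natCast, ← pow_mul]
    rfl

/-- The partial sums of `∑_j φ_j = δ₀` satisfy a dilation relation. Hence `φ₁ = 2^n φ₀(2 ·) - φ₀`
and the partial sums are dilates of `φ₀`. -/
theorem IsLPFamily.one_eq {d : ℕ} {ρ : EuclideanSpace ℝ (Fin d) → ℝ} {φ : ℕ → 𝓢(Rn d, ℂ)}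
    (hφ : IsLPFamily ρ φ) : φ 1 = dil 1 (φ 0) - φ 0 := by
  have key : ∀ g : 𝓢(Rn d, ℂ), ∫ x, (φ 1 - (dil 1 (φ 0) - φ 0)) x * g x = 0 := by
    intro g
    -- the test function `g(· / 2)`
    let g' : 𝓢(Rn d, ℂ) := ((2 : ℝ) ^ (d + 1)) • dil (-1) g
    have hg' : ∀ x, g' x = g ((2 : ℝ) ^ (-1 : ℤ) • x) := by
      intro x
      have : g' x = ((2 : ℝ) ^ (d + 1)) • dil (-1) g x := rfl
      rw [this, dil_apply, smul_smul, ← mul_pow]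
      norm_num
    have hdil : ∀ j : ℕ, ∫ x, φ (j + 1) x * g' x = ∫ x, φ (j + 2) x * g x := by
      intro j
      rw [hφ.eq_dil (j + 1), Nat.cast_add, Nat.cast_one, add_comm (j : ℤ) 1, ← dil_dil,
        integral_dil_mul, ← hφ.eq_dil]
      simp only [hg']
    have h0 : ∫ x, φ 0 x * g' x = ∫ x, dil 1 (φ 0) x * g x := by
      rw [integral_dil_mul]
      simp only [hg']
    have h1 := (tendsto_add_atTop_iff_nat 1).2 (hφ.approxId g')
    have h2 := (tendsto_add_atTop_iff_nat 2).2 (hφ.approxId g)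
    have hg0 : g' 0 = g 0 := by rw [hg', smul_zero]
    rw [hg0] at h1
    have h3 := h2.sub h1
    rw [sub_self] at h3
    refine tendsto_nhds_unique (tendsto_const_nhds.congr fun J => ?_) h3
    rw [Finset.sum_range_succ', Finset.sum_range_succ', Finset.sum_range_succ' _ J, h0]
    simp only [hdil, zero_add, add_assoc, Nat.reduceAdd]
    have e : ∀ x, (φ 1 - (dil 1 (φ 0) - φ 0)) x * g x =
        φ 1 x * g x + φ 0 x * g x - dil 1 (φ 0) x * g x := fun x => by
      simp only [_root_.sub_apply]
      ring
    simp only [e]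
    have hI := fun a : 𝓢(Rn d, ℂ) => integrable_mul a g
    refine (integral_sub ((hI _).add (hI _)) (hI _)).trans ?_
    rw [integral_add' (hI _) (hI _)]
    ring
  exact sub_eq_zero.1 (eq_zero_of_integral_mul_eq_zero key)

theorem IsLPFamily.eq_lpFam {d : ℕ} {ρ : EuclideanSpace ℝ (Fin d) → ℝ} {φ : ℕ → 𝓢(Rn d, ℂ)}
    (hφ : IsLPFamily ρ φ) : φ = lpFam (φ 0) := by
  funext j
  rcases j with _ | j
  · rw [lpFam, if_pos rfl]
  · rw [lpFam, if_neg (Nat.succ_ne_zero j), hφ.eq_dil, hφ.one_eq, dil_sub, dil_sub, dil_dil,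
      dil_dil]
    push_cast
    rw [add_neg_cancel_right]

theorem IsLPFamily.integral_eq_one {d : ℕ} {ρ : EuclideanSpace ℝ (Fin d) → ℝ}
    {φ : ℕ → 𝓢(Rn d, ℂ)} (hφ : IsLPFamily ρ φ) : ∫ x, φ 0 x = 1 := by
  obtain ⟨g, hg⟩ := exists_apply_zero_eq_one d
  have h1 := (tendsto_add_atTop_iff_nat 1).2 (hφ.approxId g)
  have h2 := tendsto_integral_dil_mul (φ 0) g
  have e : ∀ J : ℕ, ∑ j ∈ Finset.range (J + 1), ∫ x, φ j x * g x = ∫ x, dil J (φ 0) x * g x := by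
    intro J
    induction J with
    | zero => simp [dil_zero]
    | succ J ih =>
      rw [Finset.sum_range_succ, ih, hφ.eq_dil, hφ.one_eq, dil_sub, dil_dil,
        ← integral_add (integrable_mul _ _) (integrable_mul _ _)]
      congr 1 with x
      rw [_root_.sub_apply]
      push_cast
      ring
  simp only [e] at h1
  have h3 := tendsto_nhds_unique h2 h1
  rwa [hg, mul_one] at h3

theorem IsLPFamily.deltaLike {d : ℕ} {ρ : EuclideanSpace ℝ (Fin d) → ℝ} {φ : ℕ → 𝓢(Rn d, ℂ)}
    (hφ : IsLPFamily ρ φ) : DeltaLike (φ 0) :=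
  deltaLike_of_flat_sub hφ.integral_eq_one (hφ.one_eq ▸ flat_of_moment hφ.moment)

theorem IsClassicalLPFamily.eq_lpFam {d : ℕ} {lam : ℕ → 𝓢(Rn d, ℂ)}
    (h : IsClassicalLPFamily lam) : lam = lpFam (lam 0) := by
  funext j
  rcases j with _ | j
  · rw [lpFam, if_pos rfl]
  · ext x
    rw [lpFam, if_neg (Nat.succ_ne_zero j), h.scaling _ (by omega), dil_sub, dil_dil,
      _root_.sub_apply, dil_apply, dil_apply, zpow_natCast, ← pow_mul,
      show ((j + 1 : ℕ) : ℤ) + -1 = (j : ℕ) by push_cast; ring, zpow_natCast, ← pow_mul]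
    rfl

theorem IsClassicalLPFamily.deltaLike {d : ℕ} {lam : ℕ → 𝓢(Rn d, ℂ)}
    (h : IsClassicalLPFamily lam) : DeltaLike (lam 0) := by
  refine ⟨(contDiff_fourier _).sub contDiff_const, fun n => ?_⟩
  have h0 : (fun ξ => 𝓕 (lam 0) ξ - 1) =ᶠ[𝓝 0] fun _ => (0 : ℂ) := by
    filter_upwards [Metric.ball_mem_nhds (0 : Rn d) one_pos] with ξ hξ
    rw [h.fourier_one ξ (by simpa using hξ), sub_self]
  rw [(h0.iteratedFDeriv ℝ n).eq_of_nhds]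
  simp

/-! ### Comparison of the quasi-norms of the endpoint spaces -/

theorem eLpNorm_lqNorm {α ι : Type*} [MeasurableSpace α] [Countable ι] {μ : Measure α}
    {q : ℝ≥0∞} (hq : q ≠ 0) {f : ι → α → ℝ≥0∞} (hf : ∀ i, Measurable (f i)) :
    eLpNorm (fun x => lqNorm q fun i => f i x) q μ = lqNorm q fun i => eLpNorm (f i) q μ := by
  by_cases h : q = ∞
  · subst h
    simp only [lqNorm_top, eLpNorm_exponent_top]
    refine le_antisymm ?_ (iSup_le fun i => ?_)
    · refine essSup_le_of_ae_le _ ?_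
      have h1 : ∀ᵐ x ∂μ, ∀ i, f i x ≤ eLpNormEssSup (f i) μ := ae_all_iff.2 fun i => by
        simpa only [enorm_eq_self] using enorm_ae_le_eLpNormEssSup (f i) μ
      filter_upwards [h1] with x hx
      rw [enorm_eq_self]
      exact iSup_mono hx
    · refine essSup_mono_ae (Eventually.of_forall fun x => ?_)
      simp only [enorm_eq_self]
      exact le_iSup (fun i => f i x) i
  · have h0 : q.toReal ≠ 0 := (ENNReal.toReal_pos hq h).ne'
    simp only [lqNorm_of_ne_top h, eLpNorm_eq_lintegral_rpow_enorm_toReal hq h, enorm_eq_self,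
      ← ENNReal.rpow_mul, one_div_mul_cancel h0, ENNReal.rpow_one]
    rw [lintegral_tsum fun i => ((hf i).pow_const _).aemeasurable]

theorem LplqE_eq_lqLpE {d : ℕ} {q : ℝ≥0∞} (hq : q ≠ 0) (τ : ℝ) {w : ℕ → Rn d → ℝ≥0∞}
    (hw : ∀ j, Measurable (w j)) : LplqE q q τ w = lqLpE q q τ w := by
  unfold LplqE lqLpE
  congr 1 with J
  congr 1 with v
  rw [eLpNorm_lqNorm hq fun j : Tail J => hw j]

theorem volume_dyadicCube {d : ℕ} (J : ℤ) (v : Fin (d + 1) → ℤ) :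
    volume (dyadicCube J v : Set (Rn d)) = cubeWeight d J (-1) := by
  have h : (dyadicCube J v : Set (Rn d)) = WithLp.ofLp ⁻¹'
      (Set.univ.pi fun i => Set.Ioo ((2 : ℝ) ^ (-J) * v i) ((2 : ℝ) ^ (-J) * v i + 2 ^ (-J))) := by
    ext x
    simp [dyadicCube]
  have hc : ENNReal.ofReal ((2 : ℝ) ^ (-J)) = 2 ^ (-(J : ℝ)) := by
    rw [← Real.rpow_intCast, ← ENNReal.ofReal_rpow_of_pos two_pos]
    simp
  rw [h, (PiLp.volume_preserving_ofLp (Fin (d + 1))).measure_preimage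
    (MeasurableSet.univ_pi fun i => measurableSet_Ioo).nullMeasurableSet, volume_pi_pi]
  simp only [Real.volume_Ioo, add_sub_cancel_left, Finset.prod_const, Finset.card_univ,
    Fintype.card_fin, hc]
  rw [cubeWeight, ← ENNReal.rpow_natCast, ← ENNReal.rpow_mul]
  congr 1
  push_cast
  ring

/-- A bound for the integrals over all unit cubes bounds the averages over larger cubes. -/
theorem setLIntegral_dyadicCube_le {d : ℕ} {f : Rn d → ℝ≥0∞} (hf : Measurable f) {B : ℝ≥0∞}
    (hB : ∀ w, ∫⁻ x in dyadicCube 0 w, f x ≤ B) {J : ℤ} (hJ : J ≤ 0) (v : Fin (d + 1) → ℤ) :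
    ∫⁻ x in dyadicCube J v, f x ≤ cubeWeight d J (-1) * B := by
  obtain ⟨l, rfl⟩ : ∃ l : ℕ, J = 0 - l := ⟨(-J).toNat, by omega⟩
  have hdec : ∀ f : Rn d → ℝ≥0∞, Measurable f → ∫⁻ x in dyadicCube (0 - l) v, f x =
      ∑' w, ∫⁻ x in dyadicCube 0 w ∩ dyadicCube (0 - l) v, f x := by
    intro f hf
    rw [← lintegral_congr_ae (ae_restrict_of_ae (tsum_indicator_dyadicCube 0 f)),
      lintegral_tsum fun w => (hf.indicator (measurableSet_dyadicCube 0 w)).aemeasurable]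
    congr 1 with w
    rw [lintegral_indicator (measurableSet_dyadicCube 0 w),
      Measure.restrict_restrict (measurableSet_dyadicCube 0 w)]
  have h1 := hdec (fun _ => 1) measurable_const
  simp only [setLIntegral_one] at h1
  rw [hdec f hf, ← volume_dyadicCube _ v, h1, ← ENNReal.tsum_mul_right]
  refine ENNReal.tsum_le_tsum fun w => ?_
  rcases (dyadicCube 0 w ∩ dyadicCube (0 - l) v : Set (Rn d)).eq_empty_or_nonempty
    with h | ⟨x, hx, hx'⟩
  · rw [h]
    simp
  · have hs := dyadicCube_subset 0 l w
    rw [← mem_dyadicCube_unique hx' (hs hx)] at hs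
    rw [Set.inter_eq_left.2 hs, volume_dyadicCube_zero, one_mul]
    exact hB w

theorem cubeWeight_mul_eLpNorm_le {d : ℕ} {q : ℝ≥0∞} (hq : q ≠ 0) {u : Rn d → ℝ≥0∞}
    (hu : Measurable u) {B : ℝ≥0∞} (hB : ∀ w, eLpNorm u q (volume.restrict (dyadicCube 0 w)) ≤ B)
    {J : ℤ} (hJ : J ≤ 0) (v : Fin (d + 1) → ℤ) :
    cubeWeight d J (q⁻¹).toReal * eLpNorm u q (volume.restrict (dyadicCube J v)) ≤ B := by
  by_cases h : q = ∞
  · subst h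
    have h1 : cubeWeight d J ((∞ : ℝ≥0∞)⁻¹).toReal = 1 := by simp [cubeWeight]
    rw [h1, one_mul]
    refine (eLpNorm_mono_measure u Measure.restrict_le_self).trans ?_
    rw [eLpNorm_exponent_top]
    refine essSup_le_of_ae_le _ ?_
    have h2 : ∀ᵐ x : Rn d, ∀ w, x ∈ dyadicCube 0 w → u x ≤ B := by
      refine ae_all_iff.2 fun w => (ae_restrict_iff' (measurableSet_dyadicCube 0 w)).1 ?_
      filter_upwards [enorm_ae_le_eLpNormEssSup u (volume.restrict (dyadicCube 0 w))] with x hx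
      rw [enorm_eq_self] at hx
      exact hx.trans (by simpa only [eLpNorm_exponent_top] using hB w)
    filter_upwards [h2, ae_exists_mem_dyadicCube 0] with x hx ⟨w, hw⟩
    exact hx w hw
  · have h0 : 0 < q.toReal := ENNReal.toReal_pos hq h
    simp only [eLpNorm_eq_lintegral_rpow_enorm_toReal hq h, enorm_eq_self] at hB ⊢
    have h1 := setLIntegral_dyadicCube_le (hu.pow_const q.toReal) (B := B ^ q.toReal)
      (fun w => by rw [← ENNReal.rpow_inv_le_iff h0, ← one_div]; exact hB w) hJ v
    calc _ ≤ cubeWeight d J (q⁻¹).toReal *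
          (cubeWeight d J (-1) * B ^ q.toReal) ^ (1 / q.toReal) := by
          gcongr
      _ = B := by
          rw [ENNReal.mul_rpow_of_nonneg _ _ (by positivity), ← ENNReal.rpow_mul B,
            mul_one_div_cancel h0.ne', ENNReal.rpow_one, ← mul_assoc, cubeWeight, cubeWeight,
            ← ENNReal.rpow_mul, ← ENNReal.rpow_add _ _ (by simp) (by simp), ENNReal.toReal_inv]
          rw [show ((d : ℝ) + 1) * J * (q.toReal)⁻¹ + ((d : ℝ) + 1) * J * -1 * (1 / q.toReal) = 0 by
            ring, ENNReal.rpow_zero, one_mul]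

/-- Cubes of side length larger than one do not contribute to the endpoint quasi-norm. -/
theorem iSup_nat_eq_LplqE {d : ℕ} {q : ℝ≥0∞} (hq : q ≠ 0) {w : ℕ → Rn d → ℝ≥0∞}
    (hw : ∀ j, Measurable (w j)) :
    ⨆ (J : ℕ) (v : Fin (d + 1) → ℤ), cubeWeight d J (q⁻¹).toReal *
      eLpNorm (fun x => lqNorm q (fun j : {j : ℕ // J ≤ j} => w j x)) q
        (volume.restrict (dyadicCube (J : ℤ) v)) = LplqE q q (q⁻¹).toReal w := by
  have hnat : ∀ (J : ℕ) (x : Rn d), lqNorm q (fun j : {j : ℕ // J ≤ j} => w j x) =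
      lqNorm q (fun j : Tail J => w j x) := fun J x => le_antisymm
    (lqNorm_comp_le (fun j : {j : ℕ // J ≤ j} => (⟨j.1, by have := j.2; omega⟩ : Tail J))
      (fun i j hij => Subtype.ext (congrArg (fun k : Tail J => k.1) hij)) fun j : Tail J => w j x)
    (lqNorm_comp_le (fun j : Tail J => (⟨j.1, by have := j.2; omega⟩ : {j : ℕ // J ≤ j}))
      (fun i j hij => Subtype.ext (congrArg (fun k : {j : ℕ // J ≤ j} => k.1) hij))
      fun j : {j : ℕ // J ≤ j} => w j x)
  simp only [hnat]
  refine le_antisymm (iSup₂_le fun J v => le_iSup₂_of_le (J : ℤ) v le_rfl) (iSup₂_le fun J v => ?_)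
  rcases le_total 0 J with hJ | hJ
  · lift J to ℕ using hJ
    exact le_iSup₂_of_le J v le_rfl
  · have h1 : ∀ x, lqNorm q (fun j : Tail J => w j x) ≤ lqNorm q (fun j : Tail (0 : ℕ) => w j x) :=
      fun x => lqNorm_comp_le (fun j : Tail J => (⟨j.1, by simp⟩ : Tail (0 : ℕ)))
        (fun i j hij => Subtype.ext (congrArg (fun k : Tail (0 : ℕ) => k.1) hij))
        fun j : Tail (0 : ℕ) => w j x
    refine le_trans (mul_le_mul_right (eLpNorm_mono_ennreal (Eventually.of_forall h1) q) _) ?_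
    refine cubeWeight_mul_eLpNorm_le hq (measurable_lqNorm q fun j : Tail (0 : ℕ) => hw j)
      (fun v' => le_iSup₂_of_le 0 v' (le_of_eq ?_)) hJ v
    simp [cubeWeight]

/-! ### Equivalence of the quasi-norms -/

/-- Littlewood-Paley characterization of the quotient quasi-norm on a special Lipschitz domain, for
all quasi-norms at once. -/
theorem PowNorm.exists_equivWith {d : ℕ} {X : (ℕ → Rn d → ℝ≥0∞) → ℝ≥0∞} (hX : PowNorm X)
    (s : ℝ) {lam : ℕ → 𝓢(Rn d, ℂ)} (hlam : IsClassicalLPFamily lam) (φ : ℕ → 𝓢(Rn d, ℂ)) :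
    ∃ C : ℝ≥0, 0 < C ∧ ∀ ρ : EuclideanSpace ℝ (Fin d) → ℝ,
      (∃ K : ℝ≥0, LipschitzWith K ρ) → IsLPFamily ρ φ →
      ∀ (f : TestFun (epigraph ρ) → ℂ) (F : 𝓢'(Rn d, ℂ)), restr (epigraph ρ) F = f →
        EquivWith C
          (restrNorm (fun G => X fun j x => 2 ^ ((j : ℝ) * s) * ‖conv (lam j) G x‖ₑ) (epigraph ρ) f)
          (X fun j x => 2 ^ ((j : ℝ) * s) * absConvOn (epigraph ρ) φ F j x) := by
  -- `ρ₀` only serves to extract properties of `φ` that do not mention the domain; the constants are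
  -- fixed before the actual `ρ` is introduced
  by_cases hφ : ∃ ρ, IsLPFamily ρ φ
  swap
  · exact ⟨1, one_pos, fun ρ _ h => absurd ⟨ρ, h⟩ hφ⟩
  obtain ⟨ρ₀, hρ₀⟩ := hφ
  have hS := hρ₀.deltaLike
  have hfam := hρ₀.eq_lpFam
  have hφd : IsDyadicFamily φ := hfam ▸ isDyadicFamily_lpFam hS
  have hld : IsDyadicFamily lam := hlam.eq_lpFam ▸ isDyadicFamily_lpFam hlam.deltaLike
  obtain ⟨C₁, hC₁, h₁⟩ := hX.exists_extension_bound s hS hld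
  obtain ⟨C₂, hC₂, h₂⟩ := hX.exists_change_bound s hlam.deltaLike hφd
  rw [← hfam] at h₁
  rw [← hlam.eq_lpFam] at h₂
  have hle₁ : C₁ ≤ ((C₁.toNNReal + C₂.toNNReal + 1 : ℝ≥0) : ℝ≥0∞) := by
    push_cast
    rw [ENNReal.coe_toNNReal hC₁, add_assoc]
    exact le_self_add
  have hle₂ : C₂ ≤ ((C₁.toNNReal + C₂.toNNReal + 1 : ℝ≥0) : ℝ≥0∞) := by
    push_cast
    rw [ENNReal.coe_toNNReal hC₂, add_right_comm]
    exact le_add_self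
  refine ⟨C₁.toNNReal + C₂.toNNReal + 1, by positivity, fun ρ ⟨K, hK⟩ hρ f F hf => ⟨?_, ?_⟩⟩
  · have hΓ := isAdmissible_epigraph hK
    have hSΓ : ∀ x, φ 0 x ≠ 0 → x ∈ cone ρ := fun x hx => hρ.support 0 (subset_tsupport _ hx)
    obtain ⟨G, hG⟩ := exists_extension hS (epigraph ρ) F
    have hGf : restr (epigraph ρ) G = f := by
      rw [← hf]
      funext u
      exact (hG u.1).trans (extSum_eq_of_support_subset hΓ hS hSΓ F
        fun x hx => u.2.2 (subset_tsupport _ hx))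
    refine (iInf₂_le G hGf).trans ((h₁ _ _ hΓ (isOpen_epigraph hK.continuous).measurableSet
      hSΓ F G hG).trans ?_)
    gcongr
  · unfold restrNorm
    rw [ENNReal.mul_iInf_of_ne (by positivity) ENNReal.coe_ne_top]
    refine le_iInf fun G => ?_
    rw [ENNReal.mul_iInf_of_ne (by positivity) ENNReal.coe_ne_top]
    refine le_iInf fun hG => ?_
    rw [absConvOn_congr (isAdmissible_epigraph hK) hρ.support (hf.trans hG.symm)]
    refine le_trans (hX.mono fun j x => ?_) ((h₂ G).trans (by gcongr))
    exact mul_le_mul_right (Set.indicator_le_self _ _ x) _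

theorem lqLpNorm_eq_lqLpE {d : ℕ} (p q : ℝ≥0∞) (τ : ℝ) (g : ℕ → Rn d → ℂ) :
    lqLpNorm p q τ g = lqLpE p q τ fun j x => ‖g j x‖ₑ := by
  simp only [lqLpNorm, lqLpE, eLpNorm_enorm]

theorem lqMpNorm_eq_baseN {d : ℕ} (p q : ℝ≥0∞) (τ : ℝ) (g : ℕ → Rn d → ℂ) :
    lqMpNorm p q τ g = baseN p q τ fun j x => ‖g j x‖ₑ := by
  simp only [lqMpNorm, baseN, morreyNorm, morrey, eLpNorm_enorm]

theorem enorm_two_rpow (r : ℝ) : ‖(2 : ℝ) ^ r‖ₑ = 2 ^ r := by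
  rw [Real.enorm_of_nonneg (by positivity), ← ENNReal.ofReal_rpow_of_pos two_pos]
  simp

theorem enorm_lpSeq {d : ℕ} (φ : ℕ → 𝓢(Rn d, ℂ)) (s : ℝ) (F : 𝓢'(Rn d, ℂ)) (j : ℕ) (x : Rn d) :
    ‖lpSeq φ s F j x‖ₑ = 2 ^ ((j : ℝ) * s) * ‖conv (φ j) F x‖ₑ := by
  rw [lpSeq, enorm_smul, enorm_two_rpow]

theorem enorm_lpSeqOn {d : ℕ} (U : Set (Rn d)) (φ : ℕ → 𝓢(Rn d, ℂ)) (s : ℝ) (F : 𝓢'(Rn d, ℂ))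
    (j : ℕ) (x : Rn d) :
    ‖lpSeqOn U φ s F j x‖ₑ = 2 ^ ((j : ℝ) * s) * absConvOn U φ F j x := by
  by_cases hx : x ∈ U
  · rw [lpSeqOn, absConvOn, Set.indicator_of_mem hx, Set.indicator_of_mem hx, enorm_lpSeq]
  · rw [lpSeqOn, absConvOn, Set.indicator_of_notMem hx, Set.indicator_of_notMem hx, enorm_zero,
      mul_zero]

theorem eLpNorm_lpSeqOn {d : ℕ} {U : Set (Rn d)} (hU : MeasurableSet U) (φ : ℕ → 𝓢(Rn d, ℂ))
    (s : ℝ) (F : 𝓢'(Rn d, ℂ)) (p : ℝ≥0∞) (j : ℕ) (A : Set (Rn d)) :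
    eLpNorm (lpSeqOn U φ s F j) p (volume.restrict A) =
      2 ^ ((j : ℝ) * s) * eLpNorm (conv (φ j) F) p (volume.restrict (A ∩ U)) := by
  rw [lpSeqOn, eLpNorm_indicator_eq_eLpNorm_restrict hU, Measure.restrict_restrict hU,
    Set.inter_comm, ← enorm_two_rpow, ← eLpNorm_const_smul]
  rfl

theorem eLpNorm_lqNorm_lpSeqOn {d : ℕ} {U : Set (Rn d)} (hU : MeasurableSet U)
    (φ : ℕ → 𝓢(Rn d, ℂ)) (s : ℝ) (F : 𝓢'(Rn d, ℂ)) (p : ℝ≥0∞) {q : ℝ≥0∞} (hq : q ≠ 0) (J : ℤ)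
    (A : Set (Rn d)) :
    eLpNorm (fun x => lqNorm q fun j : Tail J => ‖lpSeqOn U φ s F j x‖ₑ) p (volume.restrict A) =
      eLpNorm (fun x => lqNorm q fun j : Tail J => 2 ^ ((j : ℝ) * s) * ‖conv (φ j) F x‖ₑ) p
        (volume.restrict (A ∩ U)) := by
  rw [Set.inter_comm, ← Measure.restrict_restrict hU, ← eLpNorm_indicator_eq_eLpNorm_restrict hU]
  congr 1 with x
  by_cases hx : x ∈ U
  · rw [Set.indicator_of_mem hx]
    simp only [enorm_lpSeqOn, absConvOn, Set.indicator_of_mem hx]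
  · rw [Set.indicator_of_notMem hx]
    simp only [enorm_lpSeqOn, absConvOn, Set.indicator_of_notMem hx, mul_zero, lqNorm_zero hq]

end LPDomain

end

open LPDomain in
/-- Littlewood-Paley characterizations of `B^{sτ}_{pq}(Ω)`, `F^{sτ}_{pq}(Ω)`, `N^{sτ}_{pq}(Ω)` and
`F^s_{∞q}(Ω)` on the special Lipschitz domain `Ω = {xₙ > ρ(x')} ⊂ ℝⁿ`, `n = d + 1`. The spaces on
`ℝⁿ` are defined by the fixed family `lam`. The constants do not depend on `ρ` and `f`. Every
`f ∈ S'(Ω)` is `F|_Ω` for a tempered `F`, and on `Ω` the function `φ_j ∗ f` is `φ_j ∗ F`; the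
assertion is made for every tempered extension `F` of `f`. -/
theorem theorem1p1 (d : ℕ) (lam : ℕ → 𝓢(Rn d, ℂ)) (hlam : IsClassicalLPFamily lam)
    (φ : ℕ → 𝓢(Rn d, ℂ)) :
    (∀ (p q : ℝ≥0∞) (s τ : ℝ), 0 < p → 0 < q → 0 ≤ τ →
      (∃ C : ℝ≥0, 0 < C ∧ ∀ ρ : EuclideanSpace ℝ (Fin d) → ℝ,
        (∃ K : ℝ≥0, LipschitzWith K ρ) → IsLPFamily ρ φ →
        ∀ (f : TestFun (epigraph ρ) → ℂ) (F : 𝓢'(Rn d, ℂ)), restr (epigraph ρ) F = f →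
          EquivWith C (restrNorm (normB lam p q s τ) (epigraph ρ) f)
            (lqLpNorm p q τ (lpSeqOn (epigraph ρ) φ s F)) ∧
          lqLpNorm p q τ (lpSeqOn (epigraph ρ) φ s F) =
            ⨆ (J : ℤ) (v : Fin (d + 1) → ℤ), cubeWeight d J τ *
              lqNorm q (fun j : Tail J => (2 : ℝ≥0∞) ^ ((j : ℝ) * s) *
                eLpNorm (conv (φ j) F) p (volume.restrict (dyadicCube J v ∩ epigraph ρ)))) ∧
      (p < ∞ → ∃ C : ℝ≥0, 0 < C ∧ ∀ ρ : EuclideanSpace ℝ (Fin d) → ℝ,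
        (∃ K : ℝ≥0, LipschitzWith K ρ) → IsLPFamily ρ φ →
        ∀ (f : TestFun (epigraph ρ) → ℂ) (F : 𝓢'(Rn d, ℂ)), restr (epigraph ρ) F = f →
          EquivWith C (restrNorm (normF lam p q s τ) (epigraph ρ) f)
            (LplqNorm p q τ (lpSeqOn (epigraph ρ) φ s F)) ∧
          LplqNorm p q τ (lpSeqOn (epigraph ρ) φ s F) =
            ⨆ (J : ℤ) (v : Fin (d + 1) → ℤ), cubeWeight d J τ *
              (∫⁻ x in dyadicCube J v ∩ epigraph ρ,
                lqNorm q (fun j : Tail J => (2 : ℝ≥0∞) ^ ((j : ℝ) * s) * ‖conv (φ j) F x‖ₑ)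
                  ^ p.toReal) ^ (1 / p.toReal)) ∧
      (∃ C : ℝ≥0, 0 < C ∧ ∀ ρ : EuclideanSpace ℝ (Fin d) → ℝ,
        (∃ K : ℝ≥0, LipschitzWith K ρ) → IsLPFamily ρ φ →
        ∀ (f : TestFun (epigraph ρ) → ℂ) (F : 𝓢'(Rn d, ℂ)), restr (epigraph ρ) F = f →
          EquivWith C (restrNorm (normN lam p q s τ) (epigraph ρ) f)
            (lqMpNorm p q τ (lpSeqOn (epigraph ρ) φ s F)) ∧
          lqMpNorm p q τ (lpSeqOn (epigraph ρ) φ s F) =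
            lqNorm q (fun j : ℕ => ⨆ (J : ℤ) (v : Fin (d + 1) → ℤ),
              (2 : ℝ≥0∞) ^ ((j : ℝ) * s) * cubeWeight d J τ *
                eLpNorm (conv (φ j) F) p (volume.restrict (dyadicCube J v ∩ epigraph ρ))))) ∧
    (∀ (q : ℝ≥0∞) (s : ℝ), 0 < q →
      ∃ C : ℝ≥0, 0 < C ∧ ∀ ρ : EuclideanSpace ℝ (Fin d) → ℝ,
        (∃ K : ℝ≥0, LipschitzWith K ρ) → IsLPFamily ρ φ →
        ∀ (f : TestFun (epigraph ρ) → ℂ) (F : 𝓢'(Rn d, ℂ)), restr (epigraph ρ) F = f →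
          EquivWith C (restrNorm (normFInf lam q s) (epigraph ρ) f)
            (⨆ (J : ℤ) (v : Fin (d + 1) → ℤ), cubeWeight d J (q⁻¹).toReal *
              eLpNorm (fun x => lqNorm q (fun j : Tail J =>
                  (2 : ℝ≥0∞) ^ ((j : ℝ) * s) * ‖conv (φ j) F x‖ₑ)) q
                (volume.restrict (dyadicCube J v ∩ epigraph ρ)))) := by
  have hB : ∀ p q s τ, normB lam p q s τ =
      fun G => lqLpE p q τ fun j x => 2 ^ ((j : ℝ) * s) * ‖conv (lam j) G x‖ₑ := fun p q s τ => by
    funext G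
    simp only [normB, lqLpNorm_eq_lqLpE, enorm_lpSeq]
  have hF : ∀ p q s τ, normF lam p q s τ =
      fun G => LplqE p q τ fun j x => 2 ^ ((j : ℝ) * s) * ‖conv (lam j) G x‖ₑ := fun p q s τ => by
    funext G
    simp only [normF, LplqNorm, LplqE, enorm_lpSeq]
  have hN : ∀ p q s τ, normN lam p q s τ =
      fun G => baseN p q τ fun j x => 2 ^ ((j : ℝ) * s) * ‖conv (lam j) G x‖ₑ := fun p q s τ => by
    funext G
    simp only [normN, lqMpNorm_eq_baseN, enorm_lpSeq]
  refine ⟨fun p q s τ hp hq _ => ⟨?_, fun hp' => ?_, ?_⟩, fun q s hq => ?_⟩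
  · obtain ⟨C, hC, h⟩ := (PowNorm.lqLpE hp.ne' hq.ne' τ).exists_equivWith s hlam φ
    refine ⟨C, hC, fun ρ ⟨K, hK⟩ hρ f F hf => ⟨?_, ?_⟩⟩
    · have h1 := h ρ ⟨K, hK⟩ hρ f F hf
      rw [← hB] at h1
      simpa only [lqLpNorm_eq_lqLpE, enorm_lpSeqOn] using h1
    · simp only [lqLpNorm,
        eLpNorm_lpSeqOn (isOpen_epigraph hK.continuous).measurableSet φ s F p]
  · obtain ⟨C, hC, h⟩ := (PowNorm.LplqE hp.ne' hp'.ne hq.ne' τ).exists_equivWith s hlam φ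
    refine ⟨C, hC, fun ρ ⟨K, hK⟩ hρ f F hf => ⟨?_, ?_⟩⟩
    · have h1 := h ρ ⟨K, hK⟩ hρ f F hf
      rw [← hF] at h1
      simpa only [LplqNorm, LplqE, enorm_lpSeqOn] using h1
    · simp only [LplqNorm,
        eLpNorm_lqNorm_lpSeqOn (isOpen_epigraph hK.continuous).measurableSet φ s F p hq.ne',
        eLpNorm_eq_lintegral_rpow_enorm_toReal hp.ne' hp'.ne, enorm_eq_self]
  · obtain ⟨C, hC, h⟩ := (PowNorm.baseN hp.ne' hq.ne' τ).exists_equivWith s hlam φ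
    refine ⟨C, hC, fun ρ ⟨K, hK⟩ hρ f F hf => ⟨?_, ?_⟩⟩
    · have h1 := h ρ ⟨K, hK⟩ hρ f F hf
      rw [← hN] at h1
      simpa only [lqMpNorm_eq_baseN, enorm_lpSeqOn] using h1
    · simp only [lqMpNorm, morreyNorm,
        eLpNorm_lpSeqOn (isOpen_epigraph hK.continuous).measurableSet φ s F p, mul_left_comm,
        mul_assoc]
  · -- both sides are `ℓ^q L^q_τ` quasi-norms with `τ = 1 / q`
    obtain ⟨C, hC, h⟩ := (PowNorm.lqLpE hq.ne' hq.ne' (q⁻¹).toReal).exists_equivWith s hlam φ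
    refine ⟨C, hC, fun ρ ⟨K, hK⟩ hρ f F hf => ?_⟩
    have hm := (isOpen_epigraph hK.continuous).measurableSet
    have h1 := h ρ ⟨K, hK⟩ hρ f F hf
    have hI : normFInf lam q s = fun G => lqLpE q q (q⁻¹).toReal
        fun j x => 2 ^ ((j : ℝ) * s) * ‖conv (lam j) G x‖ₑ := by
      funext G
      have hw : ∀ j : ℕ, Measurable fun x => 2 ^ ((j : ℝ) * s) * ‖conv (lam j) G x‖ₑ := fun j =>
        (continuous_conv (lam j) G).measurable.enorm.const_mul _
      rw [← LplqE_eq_lqLpE hq.ne' _ hw, ← iSup_nat_eq_LplqE hq.ne' hw]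
      simp only [normFInf, enorm_lpSeq]
    rw [← hI, ← LplqE_eq_lqLpE hq.ne' _ fun j => (measurable_absConvOn hm φ F j).const_mul _] at h1
    simp only [← eLpNorm_lqNorm_lpSeqOn hm φ s F q hq.ne']
    simpa only [LplqE, enorm_lpSeqOn] using h1
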